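/- **Setting.** The language of set theory is the first-order language with equality and the single nonlogical symbol $\in$, with connectives $\land,\lor,\neg,\to$, unbounded quantifiers $\forall x,\exists x$, and bounded quantifiers $\forall x\in y,\ \exists x\in y$ as quantifiers in their own right (governed by the usual rules, by which they are provably equivalent to $\forall x(x\in y\to\cdot)$ and $\exists x(x\in y\land\cdot)$). $\mathsf{CZF}$ is the theory in this language over intuitionistic logic with equality with the axioms Extensionality, Pairing, Union, Infinity, Set Induction, Bounded Separation, Strong Collection and Subset Collection. The following is defined in $\mathsf{CZF}$. A *pca over $\omega$* is a set $A$ with at least two elements and a partial binary operation $(a,b)\mapsto ab$ on $A$ (application, associated to the left), elements $\mathbf k,\mathbf s,\mathbf{succ},\mathbf{pred},\mathbf d\in A$ and a map $n\mapsto\bar n$ from $\omega$ to $A$, such that $\mathbf ka$, $\mathbf sa$, $\mathbf sab$ are always defined and, for all $a,b,c\in A$ and $n,m\in\omega$, $\mathbf kab\simeq a$, $\mathbf sabc\simeq ac(bc)$, $\mathbf{succ}\,\bar n\simeq\overline{n+1}$, $\mathbf{pred}\,\overline{n+1}\simeq\bar n$, and $\mathbf d\bar n\bar mab\simeq a$ if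 $n=m$, $\mathbf d\bar n\bar mab\simeq b$ if $n\ne m$. *Closed application terms* are built by application from the constants $\mathbf k,\mathbf s,\mathbf{succ},\mathbf{pred},\mathbf d,\mathbf 0$, where $\mathbf 0$ denotes $\bar 0$; put $\mathbf 1=\bar 1$. Let $(a)_0=\mathbf{p_0}a$ and $(a)_1=\mathbf{p_1}a$, where $\mathbf{p_0}=\lambda x.x\mathbf k$, $\mathbf{p_1}=\lambda x.x(\lambda xy.y)$ (with $\lambda$ the usual combinatory abstraction). A formula $\varphi(t)$ with a term $t$ in it means that $t$ is defined and $\varphi$ holds of its value. Let $\mathrm V_{\mathrm{ex}}(A)$ be the inductively defined class with $\forall x\,(x\in \mathrm V_{\mathrm{ex}}(A)\leftrightarrow x\subseteq A\times A\times \mathrm V_{\mathrm{ex}}(A))$. For $a,b\in A$ and a formula $\varphi$ with parameters in $\mathrm V_{\mathrm{ex}}(A)$, *extensional realizability* $a=b\Vdash\varphi$ is defined as follows (the atomic cases by recursion on sets; $c,d$ range over $A$): - $a=b\Vdash x\in y$ iff $\exists z\,(\langle (a)_0,(b)_0,z\rangle\in y\land (a)_1=(b)_1\Vdash x=z)$;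 - $a=b\Vdash x=y$ iff $(ac)_0=(bd)_0\Vdash z\in y$ for all $\langle c,d,z\rangle\in x$, and $(ac)_1=(bd)_1\Vdash z\in x$ for all $\langle c,d,z\rangle\in y$; - $a=b\Vdash\varphi\land\psi$ iff $(a)_0=(b)_0\Vdash\varphi$ and $(a)_1=(b)_1\Vdash\psi$; - $a=b\Vdash\varphi\lor\psi$ iff $(a)_0\simeq(b)_0\simeq\mathbf 0$ and $(a)_1=(b)_1\Vdash\varphi$, or $(a)_0\simeq(b)_0\simeq\mathbf 1$ and $(a)_1=(b)_1\Vdash\psi$; - $a=b\Vdash\neg\varphi$ iff $\forall c,d\ \neg(c=d\Vdash\varphi)$; - $a=b\Vdash\varphi\to\psi$ iff $\forall c,d\,(c=d\Vdash\varphi\ \to\ ac=bd\Vdash\psi)$; - $a=b\Vdash\forall x\in y\,\varphi$ iff $ac=bd\Vdash\varphi$ for all $\langle c,d,x\rangle\in y$; - $a=b\Vdash\exists x\in y\,\varphi$ iff $\exists x\,(\langle(a)_0,(b)_0,x\rangle\in y\land(a)_1=(b)_1\Vdash\varphi)$; - $a=b\Vdash\forall x\,\varphi$ iff $\forall x\in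 \mathrm V_{\mathrm{ex}}(A)\,(a=b\Vdash\varphi)$; - $a=b\Vdash\exists x\,\varphi$ iff $\exists x\in \mathrm V_{\mathrm{ex}}(A)\,(a=b\Vdash\varphi)$. Write $a\Vdash\varphi$ for $a=a\Vdash\varphi$. **Theorem.** For every formula $\varphi(x_1,\ldots,x_n)$ of the language of set theory that is provable in intuitionistic first-order logic with equality (without nonlogical axioms), there is a closed application term $\mathbf e$ such that $\mathsf{CZF}$ proves: for every pca $A$ over $\omega$, the term $\mathbf e$ is defined in $A$ and $$\mathbf e\Vdash\forall x_1\cdots\forall x_n\,\varphi(x_1,\ldots,x_n).$$ -/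

import Mathlib

/-! ## The language of set theory

Formulas over `∈` and `=`, with bounded quantifiers as quantifiers in their own right.  The only terms
are variables, written as de Bruijn indices: in `all φ`, `ex φ`, `ball y φ`, `bex y φ` the
variable `0` of `φ` is the bound one and the variable `i + 1` of `φ` is the variable `i` outside.
The bound `y` of `ball y φ` (read `∀ x ∈ y, φ`) and `bex y φ` is a variable outside the quantifier. -/

inductive Fml : Type
  | mem (x y : ℕ) : Fml
  | eq (x y : ℕ) : Fml
  | conj (φ ψ : Fml) : Fml
  | disj (φ ψ : Fml) : Fml
  | neg (φ : Fml) : Fml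
  | imp (φ ψ : Fml) : Fml
  | ball (y : ℕ) (φ : Fml) : Fml
  | bex (y : ℕ) (φ : Fml) : Fml
  | all (φ : Fml) : Fml
  | ex (φ : Fml) : Fml

/-- Extension of a renaming of variables under one binder. -/
def liftRen (ρ : ℕ → ℕ) : ℕ → ℕ
  | 0 => 0
  | i + 1 => ρ i + 1

namespace Fml

def iff (φ ψ : Fml) : Fml := conj (imp φ ψ) (imp ψ φ)

/-- Simultaneous capture-free replacement of the free variables of a formula. -/
def rename : (ℕ → ℕ) → Fml → Fml
  | ρ, mem x y => mem (ρ x) (ρ y)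
  | ρ, eq x y => eq (ρ x) (ρ y)
  | ρ, conj φ ψ => conj (rename ρ φ) (rename ρ ψ)
  | ρ, disj φ ψ => disj (rename ρ φ) (rename ρ ψ)
  | ρ, neg φ => neg (rename ρ φ)
  | ρ, imp φ ψ => imp (rename ρ φ) (rename ρ ψ)
  | ρ, ball y φ => ball (ρ y) (rename (liftRen ρ) φ)
  | ρ, bex y φ => bex (ρ y) (rename (liftRen ρ) φ)
  | ρ, all φ => all (rename (liftRen ρ) φ)
  | ρ, ex φ => ex (rename (liftRen ρ) φ)

/-- The formula `φ` seen from under one additional binder. -/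
def lift (φ : Fml) : Fml := rename Nat.succ φ

/-- The renaming that puts the variable `x` for the variable `0` and removes one binder. -/
def instRen (x : ℕ) : ℕ → ℕ
  | 0 => x
  | i + 1 => i

/-- The body `φ` of a quantifier, with the variable `x` put for the bound variable. -/
def inst (φ : Fml) (x : ℕ) : Fml := rename (instRen x) φ

/-- All free variables of the formula are smaller than `n`. -/
def FreeBelow : ℕ → Fml → Prop
  | n, mem x y => x < n ∧ y < n
  | n, eq x y => x < n ∧ y < n
  | n, conj φ ψ => FreeBelow n φ ∧ FreeBelow n ψ
  | n, disj φ ψ => FreeBelow n φ ∧ FreeBelow n ψ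
  | n, neg φ => FreeBelow n φ
  | n, imp φ ψ => FreeBelow n φ ∧ FreeBelow n ψ
  | n, ball y φ => y < n ∧ FreeBelow (n + 1) φ
  | n, bex y φ => y < n ∧ FreeBelow (n + 1) φ
  | n, all φ => FreeBelow (n + 1) φ
  | n, ex φ => FreeBelow (n + 1) φ

/-- Bounded formulas: all quantifiers are bounded quantifiers. -/
def Bounded : Fml → Prop
  | mem _ _ => True
  | eq _ _ => True
  | conj φ ψ => Bounded φ ∧ Bounded ψ
  | disj φ ψ => Bounded φ ∧ Bounded ψ
  | neg φ => Bounded φ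
  | imp φ ψ => Bounded φ ∧ Bounded ψ
  | ball _ φ => Bounded φ
  | bex _ φ => Bounded φ
  | all _ => False
  | ex _ => False

/-- The formula `φ` preceded by `n` universal quantifiers, which bind its variables below `n`. -/
def alls : ℕ → Fml → Fml
  | 0, φ => φ
  | n + 1, φ => alls n (all φ)

end Fml

open Fml

/-- Natural deduction for intuitionistic first order logic with equality, from the nonlogical axioms
`T`; `Deriv T Γ φ` says that `φ` is derivable from the open assumptions `Γ`.
An axiom with free variables counts as its universal closure. -/
inductive Deriv (T : Set Fml) : List Fml → Fml → Prop
  | ax {Γ : List Fml} {φ : Fml} : φ ∈ T → Deriv T Γ φ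
  | hyp {Γ : List Fml} {φ : Fml} : φ ∈ Γ → Deriv T Γ φ
  | andI {Γ : List Fml} {φ ψ : Fml} : Deriv T Γ φ → Deriv T Γ ψ → Deriv T Γ (conj φ ψ)
  | andE₁ {Γ : List Fml} {φ ψ : Fml} : Deriv T Γ (conj φ ψ) → Deriv T Γ φ
  | andE₂ {Γ : List Fml} {φ ψ : Fml} : Deriv T Γ (conj φ ψ) → Deriv T Γ ψ
  | orI₁ {Γ : List Fml} {φ ψ : Fml} : Deriv T Γ φ → Deriv T Γ (disj φ ψ)
  | orI₂ {Γ : List Fml} {φ ψ : Fml} : Deriv T Γ ψ → Deriv T Γ (disj φ ψ)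
  | orE {Γ : List Fml} {φ ψ χ : Fml} : Deriv T Γ (disj φ ψ) → Deriv T (φ :: Γ) χ → Deriv T (ψ :: Γ) χ → Deriv T Γ χ
  | negI {Γ : List Fml} {φ ψ : Fml} : Deriv T (φ :: Γ) ψ → Deriv T (φ :: Γ) (neg ψ) → Deriv T Γ (neg φ)
  | negE {Γ : List Fml} {φ ψ : Fml} : Deriv T Γ φ → Deriv T Γ (neg φ) → Deriv T Γ ψ
  | impI {Γ : List Fml} {φ ψ : Fml} : Deriv T (φ :: Γ) ψ → Deriv T Γ (imp φ ψ)
  | impE {Γ : List Fml} {φ ψ : Fml} : Deriv T Γ (imp φ ψ) → Deriv T Γ φ → Deriv T Γ ψ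
  | allI {Γ : List Fml} {φ : Fml} : Deriv T (Γ.map lift) φ → Deriv T Γ (all φ)
  | allE {Γ : List Fml} {φ : Fml} (x : ℕ) : Deriv T Γ (all φ) → Deriv T Γ (φ.inst x)
  | exI {Γ : List Fml} {φ : Fml} (x : ℕ) : Deriv T Γ (φ.inst x) → Deriv T Γ (ex φ)
  | exE {Γ : List Fml} {φ ψ : Fml} : Deriv T Γ (ex φ) → Deriv T (φ :: Γ.map lift) ψ.lift → Deriv T Γ ψ
  | ballI {Γ : List Fml} {φ : Fml} {y : ℕ} : Deriv T (mem 0 (y + 1) :: Γ.map lift) φ → Deriv T Γ (ball y φ)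
  | ballE {Γ : List Fml} {φ : Fml} {y : ℕ} (x : ℕ) : Deriv T Γ (ball y φ) → Deriv T Γ (mem x y) → Deriv T Γ (φ.inst x)
  | bexI {Γ : List Fml} {φ : Fml} {y : ℕ} (x : ℕ) : Deriv T Γ (mem x y) → Deriv T Γ (φ.inst x) → Deriv T Γ (bex y φ)
  | bexE {Γ : List Fml} {φ ψ : Fml} {y : ℕ} : Deriv T Γ (bex y φ) →
      Deriv T (φ :: mem 0 (y + 1) :: Γ.map lift) ψ.lift → Deriv T Γ ψ
  | eqRefl {Γ : List Fml} (x : ℕ) : Deriv T Γ (eq x x)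
  | eqSubst {Γ : List Fml} {φ : Fml} {x y : ℕ} : Deriv T Γ (eq x y) → Deriv T Γ (φ.inst x) → Deriv T Γ (φ.inst y)

/-! ## Set-theoretic abbreviations

The arguments are variables; every abbreviation is a bounded formula, except `isOmega`. -/

/-- `x = 0` -/
def isEmpty (x : ℕ) : Fml := ball x (neg (eq 0 0))

/-- `x = y ∪ {y}` -/
def isSucc (x y : ℕ) : Fml :=
  conj (ball x (disj (mem 0 (y + 1)) (eq 0 (y + 1)))) (conj (ball y (mem 0 (x + 1))) (mem y x))

/-- `w = ω`, in the form `∀ y, y ∈ w ↔ y = 0 ∨ ∃ z ∈ w, y = z ∪ {z}` -/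
def isOmega (w : ℕ) : Fml :=
  all (iff (mem 0 (w + 1)) (disj (isEmpty 0) (bex (w + 1) (isSucc 1 0))))

/-- `w = {x, y}` -/
def isUPair (w x y : ℕ) : Fml :=
  conj (mem x w) (conj (mem y w) (ball w (disj (eq 0 (x + 1)) (eq 0 (y + 1)))))

/-- `p = ⟨x, y⟩ = {{x}, {x, y}}` -/
def isPair (p x y : ℕ) : Fml :=
  conj (bex p (isUPair 0 (x + 1) (x + 1))) (conj (bex p (isUPair 0 (x + 1) (y + 1)))
    (ball p (disj (isUPair 0 (x + 1) (x + 1)) (isUPair 0 (x + 1) (y + 1)))))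

/-- `p = ⟨x, y, z⟩ = ⟨x, ⟨y, z⟩⟩` -/
def isTriple (p x y z : ℕ) : Fml :=
  bex p (bex 0 (conj (isPair 0 (y + 2) (z + 2)) (isPair (p + 2) (x + 2) 0)))

/-- `p = ⟨x, y, z, u⟩ = ⟨x, ⟨y, z, u⟩⟩` -/
def isQuad (p x y z u : ℕ) : Fml :=
  bex p (bex 0 (conj (isTriple 0 (y + 2) (z + 2) (u + 2)) (isPair (p + 2) (x + 2) 0)))

/-- `⟨x, y⟩ ∈ r` -/
def pairMem (x y r : ℕ) : Fml := bex r (isPair 0 (x + 1) (y + 1))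

/-- `⟨x, y, z⟩ ∈ r` -/
def tripleMem (x y z r : ℕ) : Fml := bex r (isTriple 0 (x + 1) (y + 1) (z + 1))

/-- `⟨x, y, z, u⟩ ∈ r` -/
def quadMem (x y z u r : ℕ) : Fml := bex r (isQuad 0 (x + 1) (y + 1) (z + 1) (u + 1))

/-! ## The axioms of constructive Zermelo-Fraenkel set theory -/

/-- `∀ x y, (∀ z, z ∈ x ↔ z ∈ y) → x = y` -/
def extensionality : Fml :=
  all (all (imp (all (iff (mem 0 2) (mem 0 1))) (eq 1 0)))

/-- `∀ x y, ∃ z, x ∈ z ∧ y ∈ z` -/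
def pairing : Fml := all (all (ex (conj (mem 2 0) (mem 1 0))))

/-- `∀ x, ∃ y, ∀ u z, u ∈ z ∧ z ∈ x → u ∈ y` -/
def union : Fml :=
  all (ex (all (all (imp (conj (mem 1 0) (mem 0 3)) (mem 1 2)))))

/-- `∃ x, ∀ y, y ∈ x ↔ y = 0 ∨ ∃ z ∈ x, y = z ∪ {z}` -/
def infinity : Fml := ex (isOmega 0)

/-- `(∀ x, (∀ y ∈ x, φ y) → φ x) → ∀ x, φ x`, where `x` is the variable `0` of `φ` -/
def setInduction (φ : Fml) : Fml :=
  imp (all (imp (ball 0 (φ.rename fun | 0 => 0 | i + 1 => i + 2)) φ)) (all φ)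

/-- `∀ x, ∃ y, ∀ z, z ∈ y ↔ z ∈ x ∧ φ z`, where `z, x` are the variables `0, 1` of `φ`
and `y` does not occur in it -/
def separation (φ : Fml) : Fml :=
  all (ex (all (iff (mem 0 1) (conj (mem 0 2) (φ.rename fun | 0 => 0 | i + 1 => i + 2)))))

/-- `∀ x, (∀ u ∈ x, ∃ v, φ u v) →
  ∃ y, (∀ u ∈ x, ∃ v ∈ y, φ u v) ∧ (∀ v ∈ y, ∃ u ∈ x, φ u v)`,
where `v, u, x` are the variables `0, 1, 2` of `φ` and `y` does not occur in it -/
def strongCollection (φ : Fml) : Fml :=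
  all (imp (ball 0 (ex φ))
    (ex (conj
      (ball 1 (bex 1 (φ.rename fun | 0 => 0 | 1 => 1 | i + 2 => i + 3)))
      (ball 0 (bex 2 (φ.rename fun | 0 => 1 | 1 => 0 | i + 2 => i + 3))))))

/-- `∀ x y, ∃ z, ∀ p, (∀ u ∈ x, ∃ v ∈ y, φ u v p) →
  ∃ q ∈ z, (∀ u ∈ x, ∃ v ∈ q, φ u v p) ∧ (∀ v ∈ q, ∃ u ∈ x, φ u v p)`,
where `v, u, p, y, x` are the variables `0, 1, 2, 3, 4` of `φ`, and `z`, `q` do not occur in it -/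
def subsetCollection (φ : Fml) : Fml :=
  all (all (ex (all (imp
    (ball 3 (bex 3 (φ.rename fun | 0 => 0 | 1 => 1 | 2 => 2 | i + 3 => i + 4)))
    (bex 1 (conj
      (ball 4 (bex 1 (φ.rename fun | 0 => 0 | 1 => 1 | 2 => 3 | i + 3 => i + 5)))
      (ball 0 (bex 5 (φ.rename fun | 0 => 1 | 1 => 0 | 2 => 3 | i + 3 => i + 5)))))))))

inductive CZF : Set Fml
  | extensionality : CZF extensionality
  | pairing : CZF pairing
  | union : CZF union
  | infinity : CZF infinity
  | setInduction (φ : Fml) : CZF (setInduction φ)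
  | boundedSeparation (φ : Fml) : φ.Bounded → CZF (separation φ)
  | strongCollection (φ : Fml) : CZF (strongCollection φ)
  | subsetCollection (φ : Fml) : CZF (subsetCollection φ)

/-! ## Application terms -/

/-- Application terms over the language of partial combinatory algebras over `ω`; the constant
`zero` stands for the numeral of `0`. -/
inductive Tm : Type
  | var (i : ℕ) : Tm
  | k : Tm
  | s : Tm
  | succ : Tm
  | pred : Tm
  | d : Tm
  | zero : Tm
  | app (t u : Tm) : Tm

namespace Tm

/-- No variable occurs in the term. -/
def Closed : Tm → Prop
  | var _ => False
  | app t u => Closed t ∧ Closed u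
  | _ => True

/-- The abstraction `λ x. t` -/
def lam (x : ℕ) : Tm → Tm
  | var i => if i = x then app (app s k) k else app k (var i)
  | app t u => app (app s (lam x t)) (lam x u)
  | t => app k t

/-- The numeral of `1` -/
def one : Tm := app succ zero

/-- The projection `λ x. x k` -/
def p₀ : Tm := lam 0 (app (var 0) k)

/-- The projection `λ x. x (λ x y. y)` -/
def p₁ : Tm := lam 0 (app (var 0) (lam 0 (lam 1 (var 1))))

/-- `(a)₀`, for a variable `a` -/
def fst (a : ℕ) : Tm := app p₀ (var a)

/-- `(a)₁`, for a variable `a` -/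
def snd (a : ℕ) : Tm := app p₁ (var a)

/-- `a c`, for variables `a` and `c` -/
def ap (a c : ℕ) : Tm := app (var a) (var c)

end Tm

/-! ## Partial combinatory algebras over `ω` in set theory -/

/-- The variables that stand for a structure: its domain `A`, the graph `app` of its partial
application (a set of triples), the elements `k`, `s`, `succ`, `pred`, `d`, and the map `num` (a set
of pairs) that takes `n ∈ ω` to its numeral. -/
structure Par : Type where
  (A app k s succ pred d num : ℕ)

/-- The same structure, seen from under `n` additional binders. -/
def Par.shift (P : Par) (n : ℕ) : Par where
  A := P.A + n
  app := P.app + n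
  k := P.k + n
  s := P.s + n
  succ := P.succ + n
  pred := P.pred + n
  d := P.d + n
  num := P.num + n

/-- `c` is the numeral of `0` -/
def Par.isZero (P : Par) (c : ℕ) : Fml :=
  bex P.num (bex 0 (bex 0 (conj (isEmpty 0) (isPair 2 0 (c + 3)))))

/-- `t ≃ c`: the term `t` is defined with value `c`.  The variable `i` of `t` denotes the set
variable `v i`. -/
def Tm.eval (P : Par) (v : ℕ → ℕ) : Tm → ℕ → Fml
  | var i, c => eq (v i) c
  | k, c => eq P.k c
  | s, c => eq P.s c
  | succ, c => eq P.succ c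
  | pred, c => eq P.pred c
  | d, c => eq P.d c
  | zero, c => P.isZero c
  | app t u, c =>
      bex P.A (bex (P.A + 1) (conj (t.eval (P.shift 2) (fun i => v i + 2) 1)
        (conj (u.eval (P.shift 2) (fun i => v i + 2) 0)
          (tripleMem 1 0 (c + 2) (P.app + 2)))))

namespace Par

/-- `t ≃ c` -/
def val (P : Par) (t : Tm) (c : ℕ) : Fml := t.eval P id c

/-- `t↓` -/
def defd (P : Par) (t : Tm) : Fml :=
  bex P.A (t.eval (P.shift 1) (fun i => i + 1) 0)

/-- `φ(t, u)`, that is, `∃ c ∈ A, ∃ d ∈ A, t ≃ c ∧ u ≃ d ∧ φ(c, d)`, where `c` is the variable `1`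
and `d` the variable `0` of `φ`. -/
def sub₂ (P : Par) (t u : Tm) (φ : Fml) : Fml :=
  bex P.A (bex (P.A + 1) (conj (t.eval (P.shift 2) (fun i => i + 2) 1)
    (conj (u.eval (P.shift 2) (fun i => i + 2) 0) φ)))

/-- `app` is a partial binary operation on `A`. -/
def isOp (P : Par) : Fml :=
  conj
    (ball P.app (bex (P.A + 1) (bex (P.A + 2) (bex (P.A + 3) (isTriple 3 2 1 0)))))
    (ball P.A (ball (P.A + 1) (ball (P.A + 2) (ball (P.A + 3)
      (imp (tripleMem 3 2 1 (P.app + 4)) (imp (tripleMem 3 2 0 (P.app + 4)) (eq 1 0)))))))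

/-- `k ∈ A`, `s ∈ A`, and for all `a, b, c ∈ A`: `k a ↓`, `k a b ≃ a`, `s a ↓`, `s a b ↓`,
`s a b c ≃ a c (b c)`, the last being an equality of partially defined terms. -/
def isComb (P : Par) : Fml :=
  conj (conj (mem P.k P.A) (mem P.s P.A)) (conj
    (conj
      (ball P.A ((P.shift 1).defd (.app .k (.var 0))))
      (ball P.A (ball (P.A + 1) ((P.shift 2).val (.app (.app .k (.var 1)) (.var 0)) 1))))
    (conj
      (ball P.A ((P.shift 1).defd (.app .s (.var 0))))
      (conj
        (ball P.A (ball (P.A + 1) ((P.shift 2).defd (.app (.app .s (.var 1)) (.var 0)))))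
        (ball P.A (ball (P.A + 1) (ball (P.A + 2) (ball (P.A + 3)
          (iff
            ((P.shift 4).val (.app (.app (.app .s (.var 3)) (.var 2)) (.var 1)) 0)
            ((P.shift 4).val
              (.app (.app (.var 3) (.var 1)) (.app (.var 2) (.var 1))) 0)))))))))

/-- Partial combinatory algebra: a partial binary operation on `A` with combinators `k` and `s`,
where `A` has at least two elements. -/
def isPCA (P : Par) : Fml :=
  conj P.isOp (conj (bex P.A (bex (P.A + 1) (neg (eq 1 0)))) P.isComb)

/-- `num` is a function from `w` to `A`. -/
def isNum (P : Par) (w : ℕ) : Fml :=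
  conj
    (ball P.num (bex (w + 1) (bex (P.A + 2) (isPair 2 1 0))))
    (conj
      (ball w (bex (P.A + 1) (pairMem 1 0 (P.num + 2))))
      (ball w (ball (P.A + 1) (ball (P.A + 2)
        (imp (pairMem 2 1 (P.num + 3)) (imp (pairMem 2 0 (P.num + 3)) (eq 1 0)))))))

/-- `succ n̄ ≃ m̄` and `pred m̄ ≃ n̄` for all `n, m ∈ w` with `m = n ∪ {n}`
(variables in the order of their quantifiers: `n, m, n̄, m̄`). -/
def isSuccPred (P : Par) (w : ℕ) : Fml :=
  ball w (ball (w + 1) (ball (P.A + 2) (ball (P.A + 3)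
    (imp (isSucc 2 3) (imp (pairMem 3 1 (P.num + 4)) (imp (pairMem 2 0 (P.num + 4))
      (conj
        ((P.shift 4).val (.app .succ (.var 1)) 0)
        ((P.shift 4).val (.app .pred (.var 0)) 1))))))))

/-- `d n̄ m̄ a b ≃ a` if `n = m`, and `d n̄ m̄ a b ≃ b` if `n ≠ m`, for all `n, m ∈ w` and
`a, b ∈ A` (variables in the order of their quantifiers: `n, m, n̄, m̄, a, b`). -/
def isCases (P : Par) (w : ℕ) : Fml :=
  ball w (ball (w + 1) (ball (P.A + 2) (ball (P.A + 3) (ball (P.A + 4) (ball (P.A + 5)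
    (imp (pairMem 5 3 (P.num + 6)) (imp (pairMem 4 2 (P.num + 6))
      (conj
        (imp (eq 5 4) ((P.shift 6).val
          (.app (.app (.app (.app .d (.var 3)) (.var 2)) (.var 1)) (.var 0)) 1))
        (imp (neg (eq 5 4)) ((P.shift 6).val
          (.app (.app (.app (.app .d (.var 3)) (.var 2)) (.var 1)) (.var 0)) 0))))))))))

/-- Partial combinatory algebra over `ω` -/
def isPCAω (P : Par) : Fml :=
  conj P.isPCA (conj (conj (mem P.succ P.A) (conj (mem P.pred P.A) (mem P.d P.A)))
    (ex (conj (isOmega 0) (conj ((P.shift 1).isNum 0)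
      (conj ((P.shift 1).isSuccPred 0) ((P.shift 1).isCases 0))))))

/-! ## The realizability universe and extensional realizability -/

/-- `x ∈ V`, where `V` is the inductively defined class with `x ∈ V ↔ x ⊆ A × A × V`, given
explicitly by `∃ t, x ∈ t ∧ ∀ y ∈ t, y ⊆ A × A × t`.  (The explicit class satisfies the equivalence, by
collection, and by set induction it is the only class that does.) -/
def inV (P : Par) (x : ℕ) : Fml :=
  ex (conj (mem (x + 1) 0)
    (ball 0 (ball 0 (bex (P.A + 3) (bex (P.A + 4) (bex 4 (isTriple 3 2 1 0)))))))

/-- `a = b ⊩ x ∈ y` relative to a relation `E` that is put for realized equality: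
`∃ z, ⟨(a)₀, (b)₀, z⟩ ∈ y ∧ E (a)₁ (b)₁ x z`.  The formula `E` is taken under three binders. -/
def memClause (P : Par) (E : ℕ → ℕ → ℕ → ℕ → Fml) (a b x y : ℕ) : Fml :=
  ex (conj
    ((P.shift 1).sub₂ (.fst (a + 1)) (.fst (b + 1)) (tripleMem 1 0 2 (y + 3)))
    ((P.shift 1).sub₂ (.snd (a + 1)) (.snd (b + 1)) (E 1 0 (x + 3) 2)))

/-- `a = b ⊩ x = y` with the set `R` of quadruples put for realized equality on the right:
`(ac)₀ = (bd)₀ ⊩ z ∈ y` for all `⟨c, d, z⟩ ∈ x`, and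
`(ac)₁ = (bd)₁ ⊩ z ∈ x` for all `⟨c, d, z⟩ ∈ y`. -/
def eqClause (P : Par) (R a b x y : ℕ) : Fml :=
  conj
    (ball P.A (ball (P.A + 1) (all (imp (tripleMem 2 1 0 (x + 3))
      ((P.shift 3).sub₂ (.app .p₀ (.ap (a + 3) 2)) (.app .p₀ (.ap (b + 3) 1))
        ((P.shift 5).memClause (fun a' b' x' y' => quadMem a' b' x' y' (R + 8))
          1 0 2 (y + 5)))))))
    (ball P.A (ball (P.A + 1) (all (imp (tripleMem 2 1 0 (y + 3))
      ((P.shift 3).sub₂ (.app .p₁ (.ap (a + 3) 2)) (.app .p₁ (.ap (b + 3) 1))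
        ((P.shift 5).memClause (fun a' b' x' y' => quadMem a' b' x' y' (R + 8))
          1 0 2 (x + 5)))))))

/-- `a = b ⊩ x = y`, defined by recursion on sets.  The recursion is solved explicitly:
some set `R` of quadruples has `⟨a, b, x, y⟩` as an element, and each of its elements `⟨a, b, x, y⟩`
satisfies the clause for `a = b ⊩ x = y` with `R` on the right.  (This relation satisfies the recursion
equation, by collection, and by set induction it is the only class on the realizability universe that
does.) -/
def rlzEq (P : Par) (a b x y : ℕ) : Fml :=
  ex (conj (quadMem (a + 1) (b + 1) (x + 1) (y + 1) 0)
    (ball (P.A + 1) (ball (P.A + 2) (all (all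
      (imp (quadMem 3 2 1 0 4) ((P.shift 5).eqClause 4 3 2 1 0)))))))

/-- `a = b ⊩ x ∈ y` -/
def rlzMem (P : Par) (a b x y : ℕ) : Fml :=
  P.memClause (fun a' b' x' y' => (P.shift 3).rlzEq a' b' x' y') a b x y

end Par

/-- `a = b ⊩ φ`, as a formula of set theory, for variables `a`, `b`.  The variable `i` of `φ`
is interpreted by the set variable `v i`. -/
def rlz : Fml → Par → (a b : ℕ) → (v : ℕ → ℕ) → Fml
  | mem x y, P, a, b, v => P.rlzMem a b (v x) (v y)
  | eq x y, P, a, b, v => P.rlzEq a b (v x) (v y)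
  | conj φ ψ, P, a, b, v =>
      conj
        (P.sub₂ (.fst a) (.fst b) (rlz φ (P.shift 2) 1 0 (fun i => v i + 2)))
        (P.sub₂ (.snd a) (.snd b) (rlz ψ (P.shift 2) 1 0 (fun i => v i + 2)))
  | disj φ ψ, P, a, b, v =>
      disj
        (conj
          (P.sub₂ (.fst a) (.fst b) (conj ((P.shift 2).val .zero 1) ((P.shift 2).val .zero 0)))
          (P.sub₂ (.snd a) (.snd b) (rlz φ (P.shift 2) 1 0 (fun i => v i + 2))))
        (conj
          (P.sub₂ (.fst a) (.fst b) (conj ((P.shift 2).val .one 1) ((P.shift 2).val .one 0)))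
          (P.sub₂ (.snd a) (.snd b) (rlz ψ (P.shift 2) 1 0 (fun i => v i + 2))))
  | neg φ, P, _, _, v =>
      ball P.A (ball (P.A + 1) (neg (rlz φ (P.shift 2) 1 0 (fun i => v i + 2))))
  | imp φ ψ, P, a, b, v =>
      ball P.A (ball (P.A + 1) (imp
        (rlz φ (P.shift 2) 1 0 (fun i => v i + 2))
        ((P.shift 2).sub₂ (.ap (a + 2) 1) (.ap (b + 2) 0)
          (rlz ψ (P.shift 4) 1 0 (fun i => v i + 4)))))
  | ball y φ, P, a, b, v =>
      ball P.A (ball (P.A + 1) (all (imp (tripleMem 2 1 0 (v y + 3))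
        ((P.shift 3).sub₂ (.ap (a + 3) 2) (.ap (b + 3) 1)
          (rlz φ (P.shift 5) 1 0 (fun | 0 => 2 | i + 1 => v i + 5))))))
  | bex y φ, P, a, b, v =>
      ex (conj
        ((P.shift 1).sub₂ (.fst (a + 1)) (.fst (b + 1)) (tripleMem 1 0 2 (v y + 3)))
        ((P.shift 1).sub₂ (.snd (a + 1)) (.snd (b + 1))
          (rlz φ (P.shift 3) 1 0 (fun | 0 => 2 | i + 1 => v i + 3))))
  | all φ, P, a, b, v =>
      all (imp ((P.shift 1).inV 0) (rlz φ (P.shift 1) (a + 1) (b + 1) (liftRen v)))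
  | ex φ, P, a, b, v =>
      ex (conj ((P.shift 1).inV 0) (rlz φ (P.shift 1) (a + 1) (b + 1) (liftRen v)))

/-- `e ⊩ φ` for a closed term `e` and a sentence `φ`: the term is defined, with a value `a` such that
`a = a ⊩ φ`. -/
def Par.realizes (P : Par) (e : Tm) (φ : Fml) : Fml :=
  bex P.A (conj ((P.shift 1).val e 0) (rlz φ (P.shift 1) 0 0 id))

/-- The structure given by the variables `0, …, 7`. -/
def stdPar : Par where
  A := 0
  app := 1
  k := 2
  s := 3
  succ := 4
  pred := 5
  d := 6
  num := 7

/-! ## Renaming and supports -/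

/-! A realizer is read off a natural deduction proof in the Curry–Howard manner. The induction on
derivations shows that the term obtained realizes the conclusion, and `CZF` has to prove this for
every pca. Writing out formal derivations in `CZF` would be unmanageable, so provability is replaced
by forcing. By completeness for Kripke models (`deriv_of_forces`, proved classically with prime
theories that have witnesses), a sentence is derivable from `CZF` as soon as it is forced in every
Kripke model of `CZF`. One fixes such a model, a world `w` and a structure `P` forced to be a pca
over `ω`, and argues with elements of the model. The predicates `App`, `Ev`, `InV`, `RlzEq`, `Rlz`
are what the corresponding formulas mean at a world, and `forces_rlz` links the two levels.

Extensional realizability relates two realizers. Accordingly one term is evaluated in two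
environments that are related pointwise, and `OnEv` says that both values exist and are related.
Each term former has a rule for `OnEv`, and realizers are assembled from these rules.

Three points need work. First, realized equality is defined by the existence of a set of quadruples
closed under the defining clause. That it satisfies the recursion equation (`rlzEq_of_eqClause`)
uses Strong Collection: witnesses for all elements are collected in a set whose members are all
closed, and the union of closed sets is closed.

Second, equality must be realized to be a congruence. Reflexivity and transitivity need realizers
that call themselves. These are self-applications `j j` of a closed abstraction, and they are
verified by set induction along the relation `⟨c, d, z⟩ ∈ x`. A realizer of `x = y` may have only
one of its two projections defined at a given argument, so its values are built with a lazy pair.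

Third, the Leibniz law for arbitrary formulas is realized by recursion on the formula
(`substitutes_substBody`). It also serves the bounded quantifier rules: `x ∈ y` is realized by a
name of some `z` in `y` together with a realizer of `x = z`, so facts about `z` have to be carried
over to `x`.

The term depends on the derivation only and works in all models at once (`exists_realizes`). Hence a
single closed term is obtained before completeness is applied. -/

theorem liftRen_comp (ρ τ : ℕ → ℕ) : liftRen τ ∘ liftRen ρ = liftRen (τ ∘ ρ) := by
  funext i; cases i <;> rfl

theorem liftRen_id : liftRen id = id := by
  funext i; cases i <;> rfl

/-- Extension of a predicate on variables under one binder. -/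
def liftPred (U : ℕ → Prop) : ℕ → Prop
  | 0 => True
  | i + 1 => U i

/-- The environment `σ` with the value `c` put for the variable `0`. -/
def scons (c : ℕ) (σ : ℕ → ℕ) : ℕ → ℕ
  | 0 => c
  | i + 1 => σ i

namespace Fml

theorem rename_rename (φ : Fml) :
    ∀ ρ τ : ℕ → ℕ, rename τ (rename ρ φ) = rename (τ ∘ ρ) φ := by
  induction φ <;> intro ρ τ <;> simp_all [rename, liftRen_comp]

theorem rename_id (φ : Fml) : rename id φ = φ := by
  induction φ <;> simp_all [rename, liftRen_id]

/-- All free variables of the formula satisfy `U`. -/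
def Supp : (ℕ → Prop) → Fml → Prop
  | U, mem x y => U x ∧ U y
  | U, eq x y => U x ∧ U y
  | U, conj φ ψ => Supp U φ ∧ Supp U ψ
  | U, disj φ ψ => Supp U φ ∧ Supp U ψ
  | U, neg φ => Supp U φ
  | U, imp φ ψ => Supp U φ ∧ Supp U ψ
  | U, ball y φ => U y ∧ Supp (liftPred U) φ
  | U, bex y φ => U y ∧ Supp (liftPred U) φ
  | U, all φ => Supp (liftPred U) φ
  | U, ex φ => Supp (liftPred U) φ

theorem Supp.rename {φ : Fml} : ∀ {U U' : ℕ → Prop} {ρ : ℕ → ℕ}, Supp U φ →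
    (∀ i, U i → U' (ρ i)) → Supp U' (φ.rename ρ) := by
  have key : ∀ {U U' : ℕ → Prop} {ρ : ℕ → ℕ}, (∀ i, U i → U' (ρ i)) →
      ∀ i, liftPred U i → liftPred U' (liftRen ρ i) := by
    intro U U' ρ h i hi
    cases i with
    | zero => trivial
    | succ i => exact h i hi
  induction φ with
  | mem x y => exact fun h H => ⟨H _ h.1, H _ h.2⟩
  | eq x y => exact fun h H => ⟨H _ h.1, H _ h.2⟩
  | conj φ ψ ih₁ ih₂ => exact fun h H => ⟨ih₁ h.1 H, ih₂ h.2 H⟩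
  | disj φ ψ ih₁ ih₂ => exact fun h H => ⟨ih₁ h.1 H, ih₂ h.2 H⟩
  | imp φ ψ ih₁ ih₂ => exact fun h H => ⟨ih₁ h.1 H, ih₂ h.2 H⟩
  | neg φ ih => exact fun h H => ih h H
  | ball y φ ih => exact fun h H => ⟨H _ h.1, ih h.2 (key H)⟩
  | bex y φ ih => exact fun h H => ⟨H _ h.1, ih h.2 (key H)⟩
  | all φ ih => exact fun h H => ih h (key H)
  | ex φ ih => exact fun h H => ih h (key H)

theorem Supp.mono {φ : Fml} {U U' : ℕ → Prop} (h : Supp U φ) (H : ∀ i, U i → U' i) :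
    Supp U' φ := by
  simpa [rename_id] using h.rename (ρ := id) H

theorem supp_true (φ : Fml) : ∀ {U : ℕ → Prop}, (∀ i, U i) → Supp U φ := by
  have key : ∀ {U : ℕ → Prop}, (∀ i, U i) → ∀ i, liftPred U i := by
    intro U h i
    cases i with
    | zero => trivial
    | succ i => exact h i
  induction φ with
  | mem x y => exact fun H => ⟨H _, H _⟩
  | eq x y => exact fun H => ⟨H _, H _⟩
  | conj φ ψ ih₁ ih₂ => exact fun H => ⟨ih₁ H, ih₂ H⟩
  | disj φ ψ ih₁ ih₂ => exact fun H => ⟨ih₁ H, ih₂ H⟩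
  | imp φ ψ ih₁ ih₂ => exact fun H => ⟨ih₁ H, ih₂ H⟩
  | neg φ ih => exact fun H => ih H
  | ball y φ ih => exact fun H => ⟨H _, ih (key H)⟩
  | bex y φ ih => exact fun H => ⟨H _, ih (key H)⟩
  | all φ ih => exact fun H => ih (key H)
  | ex φ ih => exact fun H => ih (key H)

theorem supp_rename_of_forall (φ : Fml) {U : ℕ → Prop} {ρ : ℕ → ℕ} (h : ∀ i, U (ρ i)) :
    Supp U (φ.rename ρ) :=
  (supp_true φ (fun _ => trivial)).rename (U := fun _ => True) fun i _ => h i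

theorem Supp.rename_congr {φ : Fml} : ∀ {U : ℕ → Prop} {ρ τ : ℕ → ℕ}, Supp U φ →
    (∀ i, U i → ρ i = τ i) → φ.rename ρ = φ.rename τ := by
  have key : ∀ {U : ℕ → Prop} {ρ τ : ℕ → ℕ}, (∀ i, U i → ρ i = τ i) →
      ∀ i, liftPred U i → liftRen ρ i = liftRen τ i := by
    intro U ρ τ h i hi
    cases i with
    | zero => rfl
    | succ i => exact congrArg (· + 1) (h i hi)
  induction φ with
  | mem x y => intro U ρ τ h H; simp [Fml.rename, H _ h.1, H _ h.2]
  | eq x y => intro U ρ τ h H; simp [Fml.rename, H _ h.1, H _ h.2]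
  | conj φ ψ ih₁ ih₂ => intro U ρ τ h H; simp [Fml.rename, ih₁ h.1 H, ih₂ h.2 H]
  | disj φ ψ ih₁ ih₂ => intro U ρ τ h H; simp [Fml.rename, ih₁ h.1 H, ih₂ h.2 H]
  | imp φ ψ ih₁ ih₂ => intro U ρ τ h H; simp [Fml.rename, ih₁ h.1 H, ih₂ h.2 H]
  | neg φ ih => intro U ρ τ h H; simp [Fml.rename, ih h H]
  | ball y φ ih => intro U ρ τ h H; simp [Fml.rename, H _ h.1, ih h.2 (key H)]
  | bex y φ ih => intro U ρ τ h H; simp [Fml.rename, H _ h.1, ih h.2 (key H)]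
  | all φ ih => intro U ρ τ h H; simp [Fml.rename, ih h (key H)]
  | ex φ ih => intro U ρ τ h H; simp [Fml.rename, ih h (key H)]

theorem exists_supp_lt (φ : Fml) : ∃ n, Supp (· < n) φ := by
  have two : ∀ {φ ψ : Fml}, (∃ n, Supp (· < n) φ) → (∃ n, Supp (· < n) ψ) →
      ∃ n, Supp (· < n) φ ∧ Supp (· < n) ψ := by
    rintro φ ψ ⟨n, hn⟩ ⟨m, hm⟩
    exact ⟨max n m, hn.mono fun i hi => lt_max_of_lt_left hi,
      hm.mono fun i hi => lt_max_of_lt_right hi⟩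
  have under : ∀ {φ : Fml} (y : ℕ), (∃ n, Supp (· < n) φ) →
      ∃ n, y < n ∧ Supp (liftPred (· < n)) φ := by
    rintro φ y ⟨n, hn⟩
    refine ⟨max (y + 1) n, by omega, hn.mono fun i hi => ?_⟩
    cases i with
    | zero => trivial
    | succ i => show i < _; omega
  induction φ with
  | mem x y => exact ⟨max x y + 1, by show _ < _; omega, by show _ < _; omega⟩
  | eq x y => exact ⟨max x y + 1, by show _ < _; omega, by show _ < _; omega⟩
  | conj φ ψ ih₁ ih₂ => exact two ih₁ ih₂
  | disj φ ψ ih₁ ih₂ => exact two ih₁ ih₂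
  | imp φ ψ ih₁ ih₂ => exact two ih₁ ih₂
  | neg φ ih => exact ih
  | ball y φ ih => exact under y ih
  | bex y φ ih => exact under y ih
  | all φ ih => obtain ⟨n, _, h⟩ := under 0 ih; exact ⟨n, h⟩
  | ex φ ih => obtain ⟨n, _, h⟩ := under 0 ih; exact ⟨n, h⟩

theorem rename_inst (φ : Fml) (ρ : ℕ → ℕ) (x : ℕ) :
    (φ.inst x).rename ρ = (φ.rename (liftRen ρ)).inst (ρ x) := by
  simp only [inst, rename_rename]
  congr 1; funext i; cases i <;> rfl

theorem rename_lift (φ : Fml) (ρ : ℕ → ℕ) :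
    φ.lift.rename (liftRen ρ) = (φ.rename ρ).lift := by
  simp only [lift, rename_rename]; rfl

theorem inst_rename_liftRen (φ : Fml) (σ : ℕ → ℕ) (c : ℕ) :
    (φ.rename (liftRen σ)).inst c = φ.rename (scons c σ) := by
  simp only [inst, rename_rename]
  congr 1; funext i; cases i <;> rfl

theorem rename_bounded {φ : Fml} : ∀ {ρ : ℕ → ℕ}, φ.Bounded → (φ.rename ρ).Bounded := by
  induction φ <;> intro ρ <;> simp_all [Bounded, rename]

/-- An injective numbering of the formulas. -/
def code : Fml → ℕ
  | mem x y => Nat.pair 0 (Nat.pair x y)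
  | eq x y => Nat.pair 1 (Nat.pair x y)
  | conj φ ψ => Nat.pair 2 (Nat.pair φ.code ψ.code)
  | disj φ ψ => Nat.pair 3 (Nat.pair φ.code ψ.code)
  | neg φ => Nat.pair 4 φ.code
  | imp φ ψ => Nat.pair 5 (Nat.pair φ.code ψ.code)
  | ball y φ => Nat.pair 6 (Nat.pair y φ.code)
  | bex y φ => Nat.pair 7 (Nat.pair y φ.code)
  | all φ => Nat.pair 8 φ.code
  | ex φ => Nat.pair 9 φ.code

/-- Prime theories are built by treating the formula with number `n` at stage `n`; injectivity makes
it the only formula at stake there. -/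
theorem code_injective : Function.Injective code := by
  intro φ
  induction φ <;> intro ψ h <;> cases ψ <;> simp_all [code, Nat.pair_eq_pair] <;> aesop

end Fml

/-! ## Structural properties of derivations -/

theorem map_rename_lift (Γ : List Fml) (ρ : ℕ → ℕ) :
    (Γ.map lift).map (rename (liftRen ρ)) = (Γ.map (rename ρ)).map lift := by
  simp [rename_lift]

namespace Deriv

variable {T : Set Fml}

theorem weaken {Γ : List Fml} {φ : Fml} (h : Deriv T Γ φ) :
    ∀ {Δ : List Fml}, Γ ⊆ Δ → Deriv T Δ φ := by
  induction h with
  | ax h => exact fun _ => ax h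
  | hyp h => exact fun H => hyp (H h)
  | andI _ _ i₁ i₂ => exact fun H => andI (i₁ H) (i₂ H)
  | andE₁ _ i => exact fun H => andE₁ (i H)
  | andE₂ _ i => exact fun H => andE₂ (i H)
  | orI₁ _ i => exact fun H => orI₁ (i H)
  | orI₂ _ i => exact fun H => orI₂ (i H)
  | orE _ _ _ i₁ i₂ i₃ =>
    exact fun H => orE (i₁ H) (i₂ (List.cons_subset_cons _ H)) (i₃ (List.cons_subset_cons _ H))
  | negI _ _ i₁ i₂ =>
    exact fun H => negI (i₁ (List.cons_subset_cons _ H)) (i₂ (List.cons_subset_cons _ H))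
  | negE _ _ i₁ i₂ => exact fun H => negE (i₁ H) (i₂ H)
  | impI _ i => exact fun H => impI (i (List.cons_subset_cons _ H))
  | impE _ _ i₁ i₂ => exact fun H => impE (i₁ H) (i₂ H)
  | allI _ i => exact fun H => allI (i (List.map_subset _ H))
  | allE x _ i => exact fun H => allE x (i H)
  | exI x _ i => exact fun H => exI x (i H)
  | exE _ _ i₁ i₂ => exact fun H => exE (i₁ H) (i₂ (List.cons_subset_cons _ (List.map_subset _ H)))
  | ballI _ i => exact fun H => ballI (i (List.cons_subset_cons _ (List.map_subset _ H)))
  | ballE x _ _ i₁ i₂ => exact fun H => ballE x (i₁ H) (i₂ H)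
  | bexI x _ _ i₁ i₂ => exact fun H => bexI x (i₁ H) (i₂ H)
  | bexE _ _ i₁ i₂ =>
    exact fun H => bexE (i₁ H)
      (i₂ (List.cons_subset_cons _ (List.cons_subset_cons _ (List.map_subset _ H))))
  | eqRefl x => exact fun _ => eqRefl x
  | eqSubst _ _ i₁ i₂ => exact fun H => eqSubst (i₁ H) (i₂ H)

/-- Axioms with free variables stand for their universal closures, so the set of axioms has to be
closed under renaming; the other rules commute with renaming, with `liftRen` below binders. -/
theorem rename (hT : ∀ φ ∈ T, ∀ ρ, φ.rename ρ ∈ T) {Γ : List Fml} {φ : Fml} (h : Deriv T Γ φ) :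
    ∀ ρ : ℕ → ℕ, Deriv T (Γ.map (Fml.rename ρ)) (φ.rename ρ) := by
  induction h with
  | ax h => exact fun ρ => ax (hT _ h ρ)
  | hyp h => exact fun ρ => hyp (List.mem_map_of_mem h)
  | andI _ _ i₁ i₂ => exact fun ρ => andI (i₁ ρ) (i₂ ρ)
  | andE₁ _ i => exact fun ρ => andE₁ (i ρ)
  | andE₂ _ i => exact fun ρ => andE₂ (i ρ)
  | orI₁ _ i => exact fun ρ => orI₁ (i ρ)
  | orI₂ _ i => exact fun ρ => orI₂ (i ρ)
  | orE _ _ _ i₁ i₂ i₃ => exact fun ρ => orE (i₁ ρ) (i₂ ρ) (i₃ ρ)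
  | negI _ _ i₁ i₂ => exact fun ρ => negI (i₁ ρ) (i₂ ρ)
  | negE _ _ i₁ i₂ => exact fun ρ => negE (i₁ ρ) (i₂ ρ)
  | impI _ i => exact fun ρ => impI (i ρ)
  | impE _ _ i₁ i₂ => exact fun ρ => impE (i₁ ρ) (i₂ ρ)
  | allI _ i =>
    intro ρ
    have := i (liftRen ρ)
    rw [map_rename_lift] at this
    exact allI this
  | allE x _ i => intro ρ; rw [rename_inst]; exact allE _ (i ρ)
  | exI x _ i => intro ρ; have := i ρ; rw [rename_inst] at this; exact exI _ this
  | exE _ _ i₁ i₂ =>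
    intro ρ
    have := i₂ (liftRen ρ)
    rw [List.map_cons, map_rename_lift, rename_lift] at this
    exact exE (i₁ ρ) this
  | ballI _ i =>
    intro ρ
    have := i (liftRen ρ)
    rw [List.map_cons, map_rename_lift] at this
    exact ballI this
  | ballE x _ _ i₁ i₂ => intro ρ; rw [rename_inst]; exact ballE _ (i₁ ρ) (i₂ ρ)
  | bexI x _ _ i₁ i₂ =>
    intro ρ; have := i₂ ρ; rw [rename_inst] at this; exact bexI _ (i₁ ρ) this
  | bexE _ _ i₁ i₂ =>
    intro ρ
    have := i₂ (liftRen ρ)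
    rw [List.map_cons, List.map_cons, map_rename_lift, rename_lift] at this
    exact bexE (i₁ ρ) this
  | eqRefl x => exact fun ρ => eqRefl _
  | eqSubst _ _ i₁ i₂ =>
    intro ρ
    have := i₂ ρ
    rw [rename_inst] at this ⊢
    exact eqSubst (i₁ ρ) this

/-- The renaming that puts the variable `0` for the variable `c` and makes room for it. -/
def captureRen (c : ℕ) : ℕ → ℕ := fun i => if i = c then 0 else i + 1

theorem rename_captureRen {φ : Fml} {c : ℕ} (h : φ.Supp (· ≠ c)) :
    φ.rename (captureRen c) = φ.lift :=
  h.rename_congr fun _ hi => if_neg hi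

theorem inst_rename_captureRen {φ : Fml} {c : ℕ} (h : φ.Supp (liftPred (· ≠ c))) :
    (φ.inst c).rename (captureRen c) = φ := by
  rw [inst, rename_rename]
  conv_rhs => rw [← rename_id φ]
  refine h.rename_congr fun i hi => ?_
  cases i with
  | zero => simp [captureRen, instRen]
  | succ i =>
    have hi : i ≠ c := hi
    simp [captureRen, instRen, hi]

theorem map_rename_captureRen {Γ : List Fml} {c : ℕ} (h : ∀ γ ∈ Γ, γ.Supp (· ≠ c)) :
    Γ.map (Fml.rename (captureRen c)) = Γ.map lift :=
  List.map_congr_left fun γ hγ => rename_captureRen (h γ hγ)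

variable {Γ : List Fml} {φ ψ : Fml} {c : ℕ}

/-- The eigenvariable form of the rule. The primitive rule wants the generic element to be the
variable `0`; for a fresh `c`, the renaming `captureRen c` turns `φ.inst c` back into `φ` and lifts
the context. -/
theorem allI_fresh (hT : ∀ φ ∈ T, ∀ ρ, φ.rename ρ ∈ T)
    (hΓ : ∀ γ ∈ Γ, γ.Supp (· ≠ c)) (hφ : φ.Supp (liftPred (· ≠ c)))
    (h : Deriv T Γ (φ.inst c)) : Deriv T Γ (all φ) := by
  have := h.rename hT (captureRen c)
  rw [map_rename_captureRen hΓ, inst_rename_captureRen hφ] at this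
  exact allI this

theorem ballI_fresh (hT : ∀ φ ∈ T, ∀ ρ, φ.rename ρ ∈ T)
    {y : ℕ} (hy : y ≠ c) (hΓ : ∀ γ ∈ Γ, γ.Supp (· ≠ c))
    (hφ : φ.Supp (liftPred (· ≠ c)))
    (h : Deriv T (mem c y :: Γ) (φ.inst c)) : Deriv T Γ (ball y φ) := by
  have := h.rename hT (captureRen c)
  rw [List.map_cons, map_rename_captureRen hΓ, inst_rename_captureRen hφ] at this
  simp only [Fml.rename, captureRen, if_neg hy, if_true] at this
  exact ballI this

theorem exE_fresh (hT : ∀ φ ∈ T, ∀ ρ, φ.rename ρ ∈ T)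
    (hΓ : ∀ γ ∈ Γ, γ.Supp (· ≠ c)) (hφ : φ.Supp (liftPred (· ≠ c)))
    (hψ : ψ.Supp (· ≠ c)) (h₁ : Deriv T Γ (ex φ)) (h : Deriv T (φ.inst c :: Γ) ψ) :
    Deriv T Γ ψ := by
  have := h.rename hT (captureRen c)
  rw [List.map_cons, map_rename_captureRen hΓ, inst_rename_captureRen hφ,
    rename_captureRen hψ] at this
  exact exE h₁ this

end Deriv

/-! ## Kripke models -/

/-- A Kripke model of the language of set theory, where the elements of the domains are numbers and
equality is interpreted by a congruence. -/
structure KripkeModel where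
  World : Type
  [pre : Preorder World]
  Ex : World → ℕ → Prop
  Mem : World → ℕ → ℕ → Prop
  Eq : World → ℕ → ℕ → Prop
  ex_mono {w w' x} : w ≤ w' → Ex w x → Ex w' x
  mem_mono {w w' x y} : w ≤ w' → Mem w x y → Mem w' x y
  eq_mono {w w' x y} : w ≤ w' → Eq w x y → Eq w' x y
  mem_ex {w x y} : Mem w x y → Ex w x ∧ Ex w y
  eq_ex {w x y} : Eq w x y → Ex w x ∧ Ex w y
  eq_refl {w x} : Ex w x → Eq w x x
  eq_symm {w x y} : Eq w x y → Eq w y x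
  eq_trans {w x y z} : Eq w x y → Eq w y z → Eq w x z
  mem_congr {w x x' y y'} : Eq w x x' → Eq w y y' → Mem w x y → Mem w x' y'

namespace KripkeModel

instance (K : KripkeModel) : Preorder K.World := K.pre

variable {K : KripkeModel}

/-- The formula `φ` is forced at the world `w` in the environment `σ`. -/
def Forces : K.World → Fml → (ℕ → ℕ) → Prop
  | w, mem x y, σ => K.Mem w (σ x) (σ y)
  | w, eq x y, σ => K.Eq w (σ x) (σ y)
  | w, conj φ ψ, σ => Forces w φ σ ∧ Forces w ψ σ
  | w, disj φ ψ, σ => Forces w φ σ ∨ Forces w ψ σ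
  | w, neg φ, σ => ∀ w', w ≤ w' → ¬ Forces w' φ σ
  | w, imp φ ψ, σ => ∀ w', w ≤ w' → Forces w' φ σ → Forces w' ψ σ
  | w, ball y φ, σ => ∀ w', w ≤ w' → ∀ c, K.Mem w' c (σ y) → Forces w' φ (scons c σ)
  | w, bex y φ, σ => ∃ c, K.Mem w c (σ y) ∧ Forces w φ (scons c σ)
  | w, all φ, σ => ∀ w', w ≤ w' → ∀ c, K.Ex w' c → Forces w' φ (scons c σ)
  | w, ex φ, σ => ∃ c, K.Ex w c ∧ Forces w φ (scons c σ)

/-- All values of the environment exist at the world `w`. -/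
def Env (w : K.World) (σ : ℕ → ℕ) : Prop := ∀ i, K.Ex w (σ i)

theorem Env.mono {w w' : K.World} {σ : ℕ → ℕ} (h : Env w σ) (H : w ≤ w') : Env w' σ :=
  fun i => K.ex_mono H (h i)

theorem Env.scons {w : K.World} {σ : ℕ → ℕ} {c : ℕ} (hc : K.Ex w c) (h : Env w σ) :
    Env w (scons c σ) := by
  intro i; cases i
  · exact hc
  · exact h _

theorem Forces.mono {φ : Fml} : ∀ {w w' : K.World} {σ : ℕ → ℕ}, Forces w φ σ → w ≤ w' →
    Forces w' φ σ := by
  induction φ with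
  | mem x y => exact fun h H => K.mem_mono H h
  | eq x y => exact fun h H => K.eq_mono H h
  | conj φ ψ ih₁ ih₂ => exact fun h H => ⟨ih₁ h.1 H, ih₂ h.2 H⟩
  | disj φ ψ ih₁ ih₂ => exact fun h H => h.imp (ih₁ · H) (ih₂ · H)
  | imp φ ψ ih₁ ih₂ => exact fun h H w hw => h w (H.trans hw)
  | neg φ ih => exact fun h H w hw => h w (H.trans hw)
  | ball y φ ih => exact fun h H w hw => h w (H.trans hw)
  | bex y φ ih => exact fun ⟨c, h₁, h₂⟩ H => ⟨c, K.mem_mono H h₁, ih h₂ H⟩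
  | all φ ih => exact fun h H w hw => h w (H.trans hw)
  | ex φ ih => exact fun ⟨c, h₁, h₂⟩ H => ⟨c, K.ex_mono H h₁, ih h₂ H⟩

theorem eq_scons {w : K.World} {σ τ : ℕ → ℕ} {c d : ℕ} (hc : K.Eq w c d)
    (h : ∀ i, K.Eq w (σ i) (τ i)) : ∀ i, K.Eq w (scons c σ i) (scons d τ i)
  | 0 => hc
  | i + 1 => h i

/-- Any predicate that is the forcing of some formula inherits from this that it respects equality
of its arguments; later congruence lemmas only exhibit the formula. -/
theorem Forces.congr {φ : Fml} : ∀ {w : K.World} {σ τ : ℕ → ℕ}, (∀ i, K.Eq w (σ i) (τ i)) →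
    Forces w φ σ → Forces w φ τ := by
  have up : ∀ {w w' : K.World} {σ τ : ℕ → ℕ}, (∀ i, K.Eq w (σ i) (τ i)) → w ≤ w' →
      ∀ i, K.Eq w' (σ i) (τ i) := fun h H i => K.eq_mono H (h i)
  have symm : ∀ {w : K.World} {σ τ : ℕ → ℕ}, (∀ i, K.Eq w (σ i) (τ i)) →
      ∀ i, K.Eq w (τ i) (σ i) := fun h i => K.eq_symm (h i)
  have memSet : ∀ {w : K.World} {c y y' : ℕ}, K.Eq w y y' → K.Mem w c y → K.Mem w c y' :=
    fun h h' => K.mem_congr (K.eq_refl (K.mem_ex h').1) h h'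
  induction φ with
  | mem x y => exact fun h H => K.mem_congr (h _) (h _) H
  | eq x y => exact fun h H => K.eq_trans (K.eq_symm (h _)) (K.eq_trans H (h _))
  | conj φ ψ ih₁ ih₂ => exact fun h H => ⟨ih₁ h H.1, ih₂ h H.2⟩
  | disj φ ψ ih₁ ih₂ => exact fun h H => H.imp (ih₁ h) (ih₂ h)
  | imp φ ψ ih₁ ih₂ =>
    exact fun h H w hw h' => ih₂ (up h hw) (H w hw (ih₁ (symm (up h hw)) h'))
  | neg φ ih => exact fun h H w hw h' => H w hw (ih (symm (up h hw)) h')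
  | ball y φ ih =>
    exact fun h H w hw c hc => ih (eq_scons (K.eq_refl (K.mem_ex hc).1) (up h hw))
      (H w hw c (memSet (K.eq_symm (up h hw y)) hc))
  | bex y φ ih =>
    exact fun h ⟨c, hc, H⟩ => ⟨c, memSet (h y) hc,
      ih (eq_scons (K.eq_refl (K.mem_ex hc).1) h) H⟩
  | all φ ih =>
    exact fun h H w hw c hc => ih (eq_scons (K.eq_refl hc) (up h hw)) (H w hw c hc)
  | ex φ ih => exact fun h ⟨c, hc, H⟩ => ⟨c, hc, ih (eq_scons (K.eq_refl hc) h) H⟩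

theorem forces_rename (φ : Fml) : ∀ (w : K.World) (ρ σ : ℕ → ℕ),
    Forces w (φ.rename ρ) σ ↔ Forces w φ (σ ∘ ρ) := by
  have key : ∀ (ρ σ : ℕ → ℕ) (c : ℕ), scons c σ ∘ liftRen ρ = scons c (σ ∘ ρ) := by
    intro ρ σ c; funext i; cases i <;> rfl
  induction φ <;> intro w ρ σ <;> simp_all [Fml.rename, Forces]

end KripkeModel

/-! ## Prime theories -/

/-- The variables of level at most `k`. -/
def HasLevel (k x : ℕ) : Prop := x.unpair.1 ≤ k

theorem HasLevel.mono {k l x : ℕ} (h : HasLevel k x) (H : k ≤ l) : HasLevel l x := le_trans h H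

/-- Derivability from a set of assumptions. -/
def SetDeriv (T Θ : Set Fml) (φ : Fml) : Prop :=
  ∃ Γ : List Fml, (∀ γ ∈ Γ, γ ∈ Θ) ∧ Deriv T Γ φ

theorem SetDeriv.mono {T Θ Θ' : Set Fml} {φ : Fml} (h : SetDeriv T Θ φ) (H : Θ ⊆ Θ') :
    SetDeriv T Θ' φ := by
  obtain ⟨Γ, h₁, h₂⟩ := h
  exact ⟨Γ, fun γ hγ => H (h₁ γ hγ), h₂⟩

theorem setDeriv_of_mem {T Θ : Set Fml} {φ : Fml} (h : φ ∈ Θ) : SetDeriv T Θ φ :=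
  ⟨[φ], by simpa using h, Deriv.hyp (by simp)⟩

/-- A derivation from `φ` and further assumptions, with `φ` as the first assumption. -/
theorem SetDeriv.insert_elim {T Θ : Set Fml} {φ ψ : Fml} (h : SetDeriv T (insert φ Θ) ψ) :
    ∃ Γ : List Fml, (∀ γ ∈ Γ, γ ∈ Θ) ∧ Deriv T (φ :: Γ) ψ := by
  classical
  obtain ⟨Γ, h₁, h₂⟩ := h
  refine ⟨Γ.filter (· ≠ φ), ?_, h₂.weaken ?_⟩
  · intro γ hγ
    simp only [List.mem_filter, decide_eq_true_eq] at hγ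
    exact (h₁ γ hγ.1).resolve_left hγ.2
  · intro γ hγ
    by_cases h : γ = φ
    · simp [h]
    · simp [h, hγ]

theorem SetDeriv.cut {T Θ : Set Fml} {φ ψ : Fml} (h₁ : SetDeriv T Θ φ)
    (h₂ : SetDeriv T (insert φ Θ) ψ) : SetDeriv T Θ ψ := by
  obtain ⟨Γ, h, d⟩ := h₁
  obtain ⟨Δ, h', d'⟩ := h₂.insert_elim
  refine ⟨Γ ++ Δ, ?_, Deriv.impE (φ := φ) (Deriv.impI ?_) (d.weaken (by simp))⟩
  · simp only [List.mem_append]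
    rintro γ (hγ | hγ)
    · exact h γ hγ
    · exact h' γ hγ
  · exact d'.weaken (List.cons_subset_cons _ (by simp))

theorem SetDeriv.cut_list {T Θ : Set Fml} {φ : Fml} : ∀ {Γ : List Fml},
    (∀ γ ∈ Γ, SetDeriv T Θ γ) → Deriv T Γ φ → SetDeriv T Θ φ := by
  intro Γ
  induction Γ generalizing φ with
  | nil => exact fun _ d => ⟨[], by simp, d⟩
  | cons γ Γ ih =>
    intro h d
    have h₁ : SetDeriv T Θ (imp γ φ) := ih (fun δ hδ => h δ (by simp [hδ])) (Deriv.impI d)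
    obtain ⟨Δ, e, f⟩ := h₁
    obtain ⟨Δ', e', f'⟩ := h γ (by simp)
    refine ⟨Δ ++ Δ', ?_, Deriv.impE (f.weaken (by simp)) (f'.weaken (by simp))⟩
    simp only [List.mem_append]
    rintro γ (hγ | hγ)
    · exact e γ hγ
    · exact e' γ hγ

/-- A prime theory with witnesses, in the language with the variables of level at most `lvl`. -/
structure PrimeTheory (T : Set Fml) where
  lvl : ℕ
  th : Set Fml
  supp : ∀ φ ∈ th, φ.Supp (HasLevel lvl)
  closed : ∀ φ, φ.Supp (HasLevel lvl) → SetDeriv T th φ → φ ∈ th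
  prime : ∀ φ ψ, disj φ ψ ∈ th → φ ∈ th ∨ ψ ∈ th
  witness : ∀ φ, ex φ ∈ th → ∃ c, HasLevel lvl c ∧ φ.inst c ∈ th
  proper : ∃ φ, φ.Supp (HasLevel lvl) ∧ φ ∉ th

/-- The level of a variable is its first coordinate under `Nat.unpair`, so each level is infinite.
The second coordinate `N` is taken beyond all variables of `L`, and `Nat.pair (k + 1) N` is at least
`N`. -/
theorem exists_fresh (k : ℕ) (L : List Fml) :
    ∃ c, HasLevel (k + 1) c ∧ ¬ HasLevel k c ∧ ∀ γ ∈ L, γ.Supp (· ≠ c) := by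
  have : ∃ N, ∀ γ ∈ L, γ.Supp (· < N) := by
    induction L with
    | nil => exact ⟨0, by simp⟩
    | cons γ L ih =>
      obtain ⟨N, hN⟩ := ih
      obtain ⟨M, hM⟩ := exists_supp_lt γ
      refine ⟨max N M, ?_⟩
      simp only [List.mem_cons]
      rintro δ (rfl | hδ)
      · exact hM.mono fun i hi => lt_max_of_lt_right hi
      · exact (hN δ hδ).mono fun i hi => lt_max_of_lt_left hi
  obtain ⟨N, hN⟩ := this
  refine ⟨Nat.pair (k + 1) N, by simp [HasLevel], by simp [HasLevel], fun γ hγ => ?_⟩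
  refine (hN γ hγ).mono fun i hi => ?_
  have := Nat.right_le_pair (k + 1) N
  show i ≠ _
  omega

theorem Fml.Supp.ne {k c : ℕ} {φ : Fml} (h : φ.Supp (HasLevel k)) (hc : ¬ HasLevel k c) :
    φ.Supp (· ≠ c) :=
  h.mono fun _ hi e => hc (e ▸ hi)

theorem Fml.Supp.inst {U : ℕ → Prop} {c : ℕ} {φ : Fml} (h : φ.Supp (liftPred U)) (hc : U c) :
    (φ.inst c).Supp U := by
  refine Supp.rename h fun i hi => ?_
  cases i with
  | zero => exact hc
  | succ i => exact hi

namespace PrimeTheory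

variable {T : Set Fml}

/-- One step in the construction of a prime theory: the formula with the number `n` is added, with a
witness, if `ψ` does not become derivable. -/
theorem exists_step (hT : ∀ φ ∈ T, ∀ ρ, φ.rename ρ ∈ T) {k : ℕ} {Θ : Set Fml}
    (hΘ : ∀ φ ∈ Θ, φ.Supp (HasLevel k)) {ψ : Fml} (n : ℕ) (L : List Fml)
    (hL : (∀ φ ∈ L, φ.Supp (HasLevel (k + 1))) ∧ ¬ SetDeriv T (Θ ∪ {γ | γ ∈ L}) ψ) :
    ∃ L' : List Fml,
      ((∀ φ ∈ L', φ.Supp (HasLevel (k + 1))) ∧ ¬ SetDeriv T (Θ ∪ {γ | γ ∈ L'}) ψ) ∧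
      L ⊆ L' ∧ ∀ φ : Fml, φ.code = n → φ.Supp (HasLevel (k + 1)) →
        ¬ SetDeriv T (insert φ (Θ ∪ {γ | γ ∈ L})) ψ →
        φ ∈ L' ∧ ∀ χ, φ = ex χ → ∃ c, HasLevel (k + 1) c ∧ χ.inst c ∈ L' := by
  by_cases h : ∃ φ : Fml, φ.code = n ∧ φ.Supp (HasLevel (k + 1)) ∧
      ¬ SetDeriv T (insert φ (Θ ∪ {γ | γ ∈ L})) ψ
  · obtain ⟨φ, hn, hs, hd⟩ := h
    have uniq : ∀ φ' : Fml, φ'.code = n → φ' = φ := fun φ' h' => code_injective (h'.trans hn.symm)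
    have hset : Θ ∪ {γ | γ ∈ φ :: L} = insert φ (Θ ∪ {γ | γ ∈ L}) := by
      ext γ; simp only [List.mem_cons, Set.mem_union, Set.mem_insert_iff, Set.mem_ofPred_eq]; tauto
    by_cases hex : ∃ χ, φ = ex χ
    · obtain ⟨χ, rfl⟩ := hex
      -- The witness is not of level `k`, so it occurs nowhere in the possibly infinite `Θ`, and it
      -- avoids the finitely many remaining formulas. Hence adding `χ.inst c` proves no more of `ψ`
      -- than adding `ex χ` does.
      obtain ⟨c, hc, hck, hfresh⟩ := exists_fresh k (ψ :: ex χ :: L)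
      refine ⟨χ.inst c :: ex χ :: L, ⟨?_, ?_⟩, by intro γ; simp +contextual, ?_⟩
      · simp only [List.mem_cons]
        rintro φ (rfl | rfl | hφ)
        · exact Supp.inst hs hc
        · exact hs
        · exact hL.1 φ hφ
      · intro hbad
        have hset' : Θ ∪ {γ | γ ∈ χ.inst c :: ex χ :: L} =
            insert (χ.inst c) (insert (ex χ) (Θ ∪ {γ | γ ∈ L})) := by
          ext γ; simp only [List.mem_cons, Set.mem_union, Set.mem_insert_iff, Set.mem_ofPred_eq]
          tauto
        rw [hset'] at hbad
        obtain ⟨Γ, hΓ, d⟩ := hbad.insert_elim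
        refine hd ⟨ex χ :: Γ, ?_, ?_⟩
        · simp only [List.mem_cons]
          rintro γ (rfl | hγ)
          · simp
          · exact hΓ γ hγ
        · refine Deriv.exE_fresh hT (c := c) (φ := χ) ?_ (hfresh (ex χ) (by simp))
            (hfresh ψ (by simp)) (Deriv.hyp (by simp))
            (d.weaken (List.cons_subset_cons _ (by simp)))
          simp only [List.mem_cons]
          rintro γ (rfl | hγ)
          · exact hfresh (ex χ) (by simp)
          · rcases hΓ γ hγ with rfl | hγ | hγ
            · exact hfresh (ex χ) (by simp)
            · exact (hΘ γ hγ).ne hck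
            · exact hfresh γ (by simp [show γ ∈ L from hγ])
      · rintro φ' h' - -
        rw [uniq φ' h']
        refine ⟨by simp, ?_⟩
        rintro χ' h
        cases h
        exact ⟨c, hc, by simp⟩
    · refine ⟨φ :: L, ⟨?_, by rwa [hset]⟩, by simp, ?_⟩
      · simp only [List.mem_cons]
        rintro φ' (rfl | hφ)
        · exact hs
        · exact hL.1 φ' hφ
      · rintro φ' h' - -
        rw [uniq φ' h']
        exact ⟨by simp, fun χ hχ => (hex ⟨χ, hχ⟩).elim⟩
  · exact ⟨L, hL, fun _ h => h, fun φ h₁ h₂ h₃ => (h ⟨φ, h₁, h₂, h₃⟩).elim⟩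

/-- Lindenbaum's construction with Henkin witnesses. Every stage is `Θ` plus a finite list, so fresh
variables of level `k + 1` never run out. The limit consists of what the stages derive and does not
derive `ψ`. A formula rejected at its stage derives `ψ` together with that stage; if both disjuncts
of a derived disjunction were rejected, `ψ` would follow by cases, which gives primeness. -/
theorem exists_extension (hT : ∀ φ ∈ T, ∀ ρ, φ.rename ρ ∈ T) {k : ℕ} {Θ : Set Fml}
    (hΘ : ∀ φ ∈ Θ, φ.Supp (HasLevel k)) {L₀ : List Fml}
    (hL₀ : ∀ φ ∈ L₀, φ.Supp (HasLevel (k + 1))) {ψ : Fml} (hψ : ψ.Supp (HasLevel (k + 1)))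
    (h : ¬ SetDeriv T (Θ ∪ {γ | γ ∈ L₀}) ψ) :
    ∃ w : PrimeTheory T, w.lvl = k + 1 ∧ Θ ⊆ w.th ∧ (∀ φ ∈ L₀, φ ∈ w.th) ∧ ψ ∉ w.th := by
  choose! next hnext using fun (n : ℕ) (L : List Fml) => exists_step hT hΘ (ψ := ψ) n L
  let seq : ℕ → List Fml := fun n => Nat.rec L₀ (fun n L => next n L) n
  have good : ∀ n, (∀ φ ∈ seq n, φ.Supp (HasLevel (k + 1))) ∧
      ¬ SetDeriv T (Θ ∪ {γ | γ ∈ seq n}) ψ := by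
    intro n
    induction n with
    | zero => exact ⟨hL₀, h⟩
    | succ n ih => exact (hnext n (seq n) ih).1
  have step : ∀ n, seq n ⊆ seq (n + 1) := fun n => (hnext n (seq n) (good n)).2.1
  have mono : ∀ {m n}, m ≤ n → seq m ⊆ seq n := by
    intro m n hmn
    induction hmn with
    | refl => exact fun _ h => h
    | step _ ih => exact fun _ h => step _ (ih h)
  let S : ℕ → Set Fml := fun n => Θ ∪ {γ | γ ∈ seq n}
  have Smono : ∀ {m n}, m ≤ n → S m ⊆ S n := fun hmn =>
    Set.union_subset_union_right _ fun _ h => mono hmn h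
  let th : Set Fml := {φ | φ.Supp (HasLevel (k + 1)) ∧ ∃ n, SetDeriv T (S n) φ}
  have hSth : ∀ n, S n ⊆ th := by
    intro n φ hφ
    refine ⟨?_, n, setDeriv_of_mem hφ⟩
    rcases hφ with hφ | hφ
    · exact (hΘ φ hφ).mono fun i hi => hi.mono (Nat.le_succ k)
    · exact (good n).1 φ hφ
  have gather : ∀ {φ}, SetDeriv T th φ → ∃ n, SetDeriv T (S n) φ := by
    rintro φ ⟨Γ, hΓ, d⟩
    have : ∃ n, ∀ γ ∈ Γ, SetDeriv T (S n) γ := by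
      clear d
      induction Γ with
      | nil => exact ⟨0, by simp⟩
      | cons γ Γ ih =>
        obtain ⟨n, hn⟩ := ih fun δ hδ => hΓ δ (by simp [hδ])
        obtain ⟨m, hm⟩ := (hΓ γ (by simp)).2
        refine ⟨max n m, ?_⟩
        simp only [List.mem_cons]
        rintro δ (rfl | hδ)
        · exact hm.mono (Smono (le_max_right _ _))
        · exact (hn δ hδ).mono (Smono (le_max_left _ _))
    obtain ⟨n, hn⟩ := this
    exact ⟨n, SetDeriv.cut_list hn d⟩
  have hψth : ¬ SetDeriv T th ψ := fun hbad => by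
    obtain ⟨n, hn⟩ := gather hbad
    exact (good n).2 hn
  -- Maximality relative to `ψ`: a formula is accepted at the stage given by its own number, or it
  -- derives `ψ` over that stage.
  have dich : ∀ φ : Fml, φ.Supp (HasLevel (k + 1)) →
      φ ∈ seq (φ.code + 1) ∨ SetDeriv T (insert φ (S φ.code)) ψ := by
    intro φ hφ
    by_cases hd : SetDeriv T (insert φ (S φ.code)) ψ
    · exact Or.inr hd
    · exact Or.inl ((hnext φ.code (seq φ.code) (good _)).2.2 φ rfl hφ hd).1
  refine ⟨⟨k + 1, th, fun φ hφ => hφ.1, fun φ hφ hd => ⟨hφ, gather hd⟩, ?_, ?_, ψ, hψ, ?_⟩,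
    rfl, ?_, ?_, ?_⟩
  · intro φ χ hd
    by_contra hno
    rw [not_or] at hno
    have hφ : SetDeriv T (insert φ (S φ.code)) ψ :=
      (dich φ hd.1.1).resolve_left fun h => hno.1 (hSth (φ.code + 1) (Or.inr h))
    have hχ : SetDeriv T (insert χ (S χ.code)) ψ :=
      (dich χ hd.1.2).resolve_left fun h => hno.2 (hSth (χ.code + 1) (Or.inr h))
    obtain ⟨Γ, hΓ, d⟩ := (hφ.mono (Set.insert_subset_insert (hSth _))).insert_elim
    obtain ⟨Δ, hΔ, d'⟩ := (hχ.mono (Set.insert_subset_insert (hSth _))).insert_elim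
    refine hψth ⟨disj φ χ :: (Γ ++ Δ), ?_, Deriv.orE (Deriv.hyp (by simp))
      (d.weaken (List.cons_subset_cons _ ?_)) (d'.weaken (List.cons_subset_cons _ ?_))⟩
    · simp only [List.mem_cons, List.mem_append]
      rintro γ (rfl | hγ | hγ)
      · exact hd
      · exact hΓ γ hγ
      · exact hΔ γ hγ
    · intro γ; simp +contextual
    · intro γ; simp +contextual
  · intro φ hφ
    by_cases hd : SetDeriv T (insert (ex φ) (S (ex φ).code)) ψ
    · exact (hψth (SetDeriv.cut (setDeriv_of_mem hφ)
        (hd.mono (Set.insert_subset_insert (hSth _))))).elim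
    · obtain ⟨c, hc, hm⟩ :=
        ((hnext _ (seq (ex φ).code) (good _)).2.2 (ex φ) rfl hφ.1 hd).2 φ rfl
      exact ⟨c, hc, hSth ((ex φ).code + 1) (Or.inr hm)⟩
  · exact fun hbad => hψth (setDeriv_of_mem hbad)
  · exact fun φ hφ => hSth 0 (Or.inl hφ)
  · exact fun φ hφ => hSth 0 (Or.inr hφ)
  · exact fun hbad => hψth (setDeriv_of_mem hbad)

/-! ## Completeness for Kripke models -/

instance : Preorder (PrimeTheory T) where
  le w w' := w.lvl ≤ w'.lvl ∧ w.th ⊆ w'.th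
  le_refl w := ⟨le_refl _, subset_refl _⟩
  le_trans _ _ _ h h' := ⟨h.1.trans h'.1, h.2.trans h'.2⟩

theorem mem_of_deriv (w : PrimeTheory T) {φ : Fml} {Γ : List Fml} (hΓ : ∀ γ ∈ Γ, γ ∈ w.th)
    (hφ : φ.Supp (HasLevel w.lvl)) (d : Deriv T Γ φ) : φ ∈ w.th :=
  w.closed φ hφ ⟨Γ, hΓ, d⟩

variable (T) in
/-- The Kripke model of all prime theories. -/
def canonical : KripkeModel where
  World := PrimeTheory T
  Ex w x := HasLevel w.lvl x
  Mem w x y := mem x y ∈ w.th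
  Eq w x y := eq x y ∈ w.th
  ex_mono {w w' _} (H : LE.le (α := PrimeTheory T) w w') h := h.mono H.1
  mem_mono {w w' _ _} (H : LE.le (α := PrimeTheory T) w w') h := H.2 h
  eq_mono {w w' _ _} (H : LE.le (α := PrimeTheory T) w w') h := H.2 h
  mem_ex {w _ _} h := w.supp _ h
  eq_ex {w _ _} h := w.supp _ h
  eq_refl {w x} h := w.mem_of_deriv (Γ := []) (by simp) ⟨h, h⟩ (Deriv.eqRefl x)
  eq_symm {w x y} h := w.mem_of_deriv (Γ := [eq x y]) (by simpa using h)
    ⟨(w.supp _ h).2, (w.supp _ h).1⟩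
    (Deriv.eqSubst (φ := eq 0 (x + 1)) (Deriv.hyp (by simp)) (Deriv.eqRefl x))
  eq_trans {w x y z} h h' := w.mem_of_deriv (Γ := [eq x y, eq y z]) (by simpa using ⟨h, h'⟩)
    ⟨(w.supp _ h).1, (w.supp _ h').2⟩
    (Deriv.eqSubst (φ := eq (x + 1) 0) (x := y) (Deriv.hyp (by simp)) (Deriv.hyp (by
      simp [inst, Fml.rename, instRen])))
  mem_congr {w x x' y y'} h h' hm :=
    w.mem_of_deriv (Γ := [eq x x', eq y y', mem x y]) (by simpa using ⟨h, h', hm⟩)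
    ⟨(w.supp _ h).2, (w.supp _ h').2⟩
    (Deriv.eqSubst (φ := mem (x' + 1) 0) (x := y) (Deriv.hyp (by simp))
      (Deriv.eqSubst (φ := mem 0 (y + 1)) (x := x) (Deriv.hyp (by simp)) (Deriv.hyp (by
        simp [inst, Fml.rename, instRen]))))

open KripkeModel

theorem exists_extension_insert (hT : ∀ φ ∈ T, ∀ ρ, φ.rename ρ ∈ T) (w : PrimeTheory T)
    {φ ψ : Fml} (hφ : φ.Supp (HasLevel (w.lvl + 1))) (hψ : ψ.Supp (HasLevel (w.lvl + 1)))
    (h : ∀ Γ : List Fml, (∀ γ ∈ Γ, γ ∈ w.th) → ¬ Deriv T (φ :: Γ) ψ) :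
    ∃ w' : PrimeTheory T, w ≤ w' ∧ w'.lvl = w.lvl + 1 ∧ φ ∈ w'.th ∧ ψ ∉ w'.th := by
  obtain ⟨w', h₁, h₂, h₃, h₄⟩ := exists_extension hT (Θ := w.th) w.supp (L₀ := [φ]) (ψ := ψ)
    (by simpa using hφ) hψ (fun hd => by
      have hd : SetDeriv T (insert φ w.th) ψ := hd.mono (by
        intro γ; simp)
      obtain ⟨Γ, hΓ, d⟩ := hd.insert_elim
      exact h Γ hΓ d)
  exact ⟨w', ⟨by omega, h₂⟩, h₁, h₃ φ (by simp), h₄⟩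

theorem supp_rename (φ : Fml) {w : PrimeTheory T} {σ : ℕ → ℕ}
    (hσ : Env (K := canonical T) w σ) : (φ.rename σ).Supp (HasLevel w.lvl) :=
  supp_rename_of_forall φ hσ

/-- The truth lemma. If an implication, a negation or a universal statement is missing from `w`,
there is a prime extension that contains the premise and omits the conclusion. For the quantifiers
the generic element is a variable of the next level, which exists only in the extension. Disjunction
and existence are the primeness and the witnesses. -/
theorem forces_iff_mem (hT : ∀ φ ∈ T, ∀ ρ, φ.rename ρ ∈ T) (φ : Fml) :
    ∀ (w : PrimeTheory T) (σ : ℕ → ℕ), Env (K := canonical T) w σ →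
      (Forces (K := canonical T) w φ σ ↔ φ.rename σ ∈ w.th) := by
  induction φ with
  | mem x y => exact fun w σ _ => Iff.rfl
  | eq x y => exact fun w σ _ => Iff.rfl
  | conj φ ψ ih₁ ih₂ =>
    intro w σ hσ
    refine (and_congr (ih₁ w σ hσ) (ih₂ w σ hσ)).trans ?_
    constructor
    · rintro ⟨h₁, h₂⟩
      exact w.mem_of_deriv (Γ := [φ.rename σ, ψ.rename σ]) (by simpa using ⟨h₁, h₂⟩)
        (supp_rename (conj φ ψ) hσ) (Deriv.andI (Deriv.hyp (by simp)) (Deriv.hyp (by simp)))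
    · intro h
      exact ⟨w.mem_of_deriv (Γ := [_]) (by simpa using h) (supp_rename φ hσ)
          (Deriv.andE₁ (ψ := ψ.rename σ) (Deriv.hyp (by simp [Fml.rename]))),
        w.mem_of_deriv (Γ := [_]) (by simpa using h) (supp_rename ψ hσ)
          (Deriv.andE₂ (φ := φ.rename σ) (Deriv.hyp (by simp [Fml.rename])))⟩
  | disj φ ψ ih₁ ih₂ =>
    intro w σ hσ
    refine (or_congr (ih₁ w σ hσ) (ih₂ w σ hσ)).trans ?_
    constructor
    · rintro (h | h)
      · exact w.mem_of_deriv (Γ := [_]) (by simpa using h)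
          (supp_rename (disj φ ψ) hσ) (Deriv.orI₁ (Deriv.hyp (by simp)))
      · exact w.mem_of_deriv (Γ := [_]) (by simpa using h)
          (supp_rename (disj φ ψ) hσ) (Deriv.orI₂ (Deriv.hyp (by simp)))
    · exact w.prime _ _
  | neg φ ih =>
    intro w σ hσ
    constructor
    · intro h
      by_contra hno
      have hneg := supp_rename (neg φ) hσ
      -- The extension needs some formula to omit. `¬φ` can be chosen: if it followed from `φ` and
      -- `w`, then `w` would already derive it.
      obtain ⟨w', hw, -, h₁, h₂⟩ := exists_extension_insert hT w
        (φ := φ.rename σ) (ψ := neg (φ.rename σ))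
        ((supp_rename φ hσ).mono fun i hi => hi.mono (Nat.le_succ _))
        (hneg.mono fun i hi => hi.mono (Nat.le_succ _))
        (fun Γ hΓ d => hno (w.mem_of_deriv hΓ hneg (Deriv.negI (Deriv.hyp (by simp)) d)))
      exact h w' hw ((ih w' σ (hσ.mono hw)).2 h₁)
    · intro h w' hw h'
      have h' := (ih w' σ (hσ.mono hw)).1 h'
      obtain ⟨χ, hχ, hχw⟩ := w'.proper
      exact hχw (w'.mem_of_deriv (Γ := [φ.rename σ, neg (φ.rename σ)])
        (by simpa using ⟨h', hw.2 h⟩) hχ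
        (Deriv.negE (φ := φ.rename σ) (Deriv.hyp (by simp)) (Deriv.hyp (by simp))))
  | imp φ ψ ih₁ ih₂ =>
    intro w σ hσ
    constructor
    · intro h
      by_contra hno
      obtain ⟨w', hw, -, h₁, h₂⟩ := exists_extension_insert hT w
        (φ := φ.rename σ) (ψ := ψ.rename σ)
        ((supp_rename φ hσ).mono fun i hi => hi.mono (Nat.le_succ _))
        ((supp_rename ψ hσ).mono fun i hi => hi.mono (Nat.le_succ _))
        (fun Γ hΓ d => hno (w.mem_of_deriv hΓ (supp_rename (imp φ ψ) hσ) (Deriv.impI d)))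
      exact h₂ ((ih₂ w' σ (hσ.mono hw)).1 (h w' hw ((ih₁ w' σ (hσ.mono hw)).2 h₁)))
    · intro h w' hw h'
      rw [ih₁ w' σ (hσ.mono hw)] at h'
      rw [ih₂ w' σ (hσ.mono hw)]
      exact w'.mem_of_deriv (Γ := [φ.rename σ, imp (φ.rename σ) (ψ.rename σ)])
        (by simpa using ⟨h', hw.2 h⟩) (supp_rename ψ (hσ.mono hw))
        (Deriv.impE (φ := φ.rename σ) (Deriv.hyp (by simp)) (Deriv.hyp (by simp)))
  | ball y φ ih =>
    intro w σ hσ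
    constructor
    · intro h
      by_contra hno
      have hball := supp_rename (ball y φ) hσ
      -- A variable beyond the level of `w` occurs in no formula of `w`, so it is generic over `w`
      -- whichever assumptions from `w` a derivation uses.
      obtain ⟨c, hc, hck, -⟩ := exists_fresh w.lvl []
      obtain ⟨w', hw, hlvl, h₁, h₂⟩ := exists_extension_insert hT w
        (φ := mem c (σ y)) (ψ := (φ.rename (liftRen σ)).inst c)
        ⟨hc, (hσ y).mono (Nat.le_succ _)⟩
        (Supp.inst ((hball.mono fun i hi => hi.mono (Nat.le_succ _)).2) hc)
        (fun Γ hΓ d => hno (w.mem_of_deriv hΓ hball (Deriv.ballI_fresh hT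
          (fun e => hck (by rw [← e]; exact hσ y)) (fun γ hγ => (w.supp γ (hΓ γ hγ)).ne hck)
          (hball.ne hck).2 d)))
      refine h₂ ?_
      rw [inst_rename_liftRen, ← ih w' _ (Env.scons (w'.supp _ h₁).1 (hσ.mono hw))]
      exact h w' hw c h₁
    · intro h w' hw c hc
      have hE : Env (K := canonical T) w' (scons c σ) := Env.scons (w'.supp _ hc).1 (hσ.mono hw)
      rw [ih w' _ hE, ← inst_rename_liftRen]
      exact w'.mem_of_deriv (Γ := [ball (σ y) (φ.rename (liftRen σ)), mem c (σ y)])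
        (by simpa using ⟨(hw.2 h : ball (σ y) (φ.rename (liftRen σ)) ∈ w'.th), hc⟩)
        (by rw [inst_rename_liftRen]; exact supp_rename φ hE)
        (Deriv.ballE (y := σ y) c (Deriv.hyp (by simp)) (Deriv.hyp (by simp)))
  | bex y φ ih =>
    intro w σ hσ
    have hbex := supp_rename (bex y φ) hσ
    constructor
    · rintro ⟨c, hc, h⟩
      rw [ih w _ (Env.scons (w.supp _ hc).1 hσ), ← inst_rename_liftRen] at h
      exact w.mem_of_deriv (Γ := [mem c (σ y), (φ.rename (liftRen σ)).inst c])
        (by simpa using ⟨hc, h⟩) hbex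
        (Deriv.bexI c (Deriv.hyp (by simp)) (Deriv.hyp (by simp)))
    · intro h
      -- Prime theories have witnesses for unbounded existence only, so the bounded quantifier is
      -- first rewritten as an unbounded one.
      have hex : ex (conj (mem 0 (σ y + 1)) (φ.rename (liftRen σ))) ∈ w.th := by
        refine w.mem_of_deriv (Γ := [_]) (by simpa using h) ⟨⟨trivial, hbex.1⟩, hbex.2⟩
          (Deriv.bexE (y := σ y) (φ := φ.rename (liftRen σ)) (Deriv.hyp (by simp [Fml.rename]))
            (Deriv.exI 0 (Deriv.andI (Deriv.hyp ?_) (Deriv.hyp ?_))))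
        · simp [Fml.rename, instRen, liftRen]
        · refine List.mem_cons.2 (Or.inl ?_)
          rw [rename_rename, rename_rename]
          congr 1; funext i; cases i <;> rfl
      obtain ⟨c, hc, hm⟩ := w.witness _ hex
      have hcy : mem c (σ y) ∈ w.th := w.mem_of_deriv (Γ := [_]) (by simpa using hm)
        ⟨hc, hσ y⟩ (Deriv.andE₁ (ψ := (φ.rename (liftRen σ)).inst c) (Deriv.hyp (by
          simp [Fml.rename, inst, instRen])))
      refine ⟨c, hcy, ?_⟩
      rw [ih w _ (Env.scons hc hσ), ← inst_rename_liftRen]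
      exact w.mem_of_deriv (Γ := [_]) (by simpa using hm)
        (by rw [inst_rename_liftRen]; exact supp_rename φ (Env.scons hc hσ))
        (Deriv.andE₂ (φ := mem c (σ y)) (Deriv.hyp (by simp [Fml.rename, inst, instRen])))
  | all φ ih =>
    intro w σ hσ
    constructor
    · intro h
      by_contra hno
      have hall := supp_rename (all φ) hσ
      obtain ⟨c, hc, hck, -⟩ := exists_fresh w.lvl []
      obtain ⟨w', h₁, h₂, -, h₄⟩ := exists_extension hT w.supp (L₀ := [])
        (ψ := (φ.rename (liftRen σ)).inst c) (by simp)
        (Supp.inst (hall.mono fun i hi => hi.mono (Nat.le_succ _)) hc)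
        (fun ⟨Γ, hΓ, d⟩ => hno (w.mem_of_deriv (by simpa using hΓ) hall
          (Deriv.allI_fresh hT (fun γ hγ => (w.supp γ (by simpa using hΓ γ hγ)).ne hck)
            (hall.ne hck) d)))
      have hw : w ≤ w' := ⟨by omega, h₂⟩
      have hc' : (canonical T).Ex w' c := by show HasLevel w'.lvl c; rwa [h₁]
      refine h₄ ?_
      rw [inst_rename_liftRen, ← ih w' _ (Env.scons hc' (hσ.mono hw))]
      exact h w' hw c hc'
    · intro h w' hw c hc
      have hE : Env (K := canonical T) w' (scons c σ) := Env.scons hc (hσ.mono hw)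
      rw [ih w' _ hE, ← inst_rename_liftRen]
      exact w'.mem_of_deriv (Γ := [all (φ.rename (liftRen σ))])
        (by simpa using (hw.2 h : all (φ.rename (liftRen σ)) ∈ w'.th)) (by rw [inst_rename_liftRen]; exact supp_rename φ hE)
        (Deriv.allE c (Deriv.hyp (by simp)))
  | ex φ ih =>
    intro w σ hσ
    constructor
    · rintro ⟨c, hc, h⟩
      rw [ih w _ (Env.scons hc hσ), ← inst_rename_liftRen] at h
      exact w.mem_of_deriv (Γ := [(φ.rename (liftRen σ)).inst c])
        (by simpa using h) (supp_rename (ex φ) hσ) (Deriv.exI c (Deriv.hyp (by simp)))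
    · intro h
      obtain ⟨c, hc, hm⟩ := w.witness _ h
      refine ⟨c, hc, ?_⟩
      rwa [ih w _ (Env.scons hc hσ), ← inst_rename_liftRen]

end PrimeTheory

open KripkeModel in
-- Completeness, by contraposition: an underivable formula is omitted by some prime theory, at which
-- the canonical model refutes it. The canonical model forces `T` because all renamings of axioms
-- belong to `T` and hence, by deductive closure, to every prime theory whose level covers their
-- variables.
theorem deriv_of_forces {T : Set Fml} (hT : ∀ φ ∈ T, ∀ ρ, φ.rename ρ ∈ T) {φ : Fml}
    (h : ∀ (K : KripkeModel), (∀ ψ ∈ T, ∀ (w : K.World) σ, Env w σ → Forces w ψ σ) →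
      ∀ (w : K.World) σ, Env w σ → Forces w φ σ) : Deriv T [] φ := by
  by_contra hno
  -- All variables are moved to level `0`, which leaves the higher levels free for witnesses. The
  -- second projection undoes the renaming, so nothing becomes derivable.
  have hno' : ¬ SetDeriv T (∅ ∪ {γ | γ ∈ []}) (φ.rename (Nat.pair 0)) := by
    rintro ⟨Γ, hΓ, d⟩
    obtain rfl : Γ = [] := List.eq_nil_iff_forall_not_mem.2 fun γ hγ => by simpa using hΓ γ hγ
    have := d.rename hT fun x => x.unpair.2
    rw [rename_rename, show (fun x => x.unpair.2) ∘ Nat.pair 0 = id by funext x; simp,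
      rename_id] at this
    exact hno this
  obtain ⟨w, hw, -, -, hn⟩ := PrimeTheory.exists_extension hT (k := 0) (Θ := ∅) (by simp) (by simp)
    (supp_rename_of_forall φ fun i => by simp [HasLevel]) hno'
  have hE : Env (K := PrimeTheory.canonical T) w (Nat.pair 0) := fun i => by
    show HasLevel w.lvl _; simp [HasLevel]
  refine hn ((PrimeTheory.forces_iff_mem hT φ w _ hE).1 (h (PrimeTheory.canonical T) ?_ w _ hE))
  intro ψ hψ w' σ hσ
  rw [PrimeTheory.forces_iff_mem hT ψ w' σ hσ]
  exact w'.mem_of_deriv (Γ := []) (by simp) (PrimeTheory.supp_rename ψ hσ) (Deriv.ax (hT ψ hψ σ))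

/-! ## CZF is closed under renaming of parameters -/

namespace CZF

/-- Renaming an instance of a schema gives the instance for the formula renamed under one `liftRen`
per distinguished variable of the schema. -/
theorem rename_mem : ∀ φ ∈ CZF, ∀ ρ, φ.rename ρ ∈ CZF := by
  have key : ∀ {φ : Fml} {a b c d : ℕ → ℕ}, (∀ i, b (a i) = d (c i)) →
      (φ.rename a).rename b = (φ.rename c).rename d := by
    intro φ a b c d h
    rw [rename_rename, rename_rename]
    exact congrArg (φ.rename ·) (funext h)
  intro φ hφ ρ
  cases hφ with
  | extensionality => exact CZF.extensionality
  | pairing => exact CZF.pairing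
  | union => exact CZF.union
  | infinity => exact CZF.infinity
  | setInduction φ =>
    have : (_root_.setInduction φ).rename ρ = _root_.setInduction (φ.rename (liftRen ρ)) := by
      simp only [_root_.setInduction, rename, liftRen, Fml.imp.injEq, Fml.all.injEq,
        Fml.ball.injEq, true_and, and_true]
      exact key fun i => by cases i <;> rfl
    rw [this]; exact CZF.setInduction _
  | boundedSeparation φ h =>
    have : (_root_.separation φ).rename ρ =
        _root_.separation (φ.rename (liftRen (liftRen ρ))) := by
      simp only [_root_.separation, iff, rename, liftRen, Fml.imp.injEq, Fml.all.injEq,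
        Fml.conj.injEq, Fml.ex.injEq, true_and, and_true, and_self]
      exact key fun i => by rcases i with _ | _ | i <;> rfl
    rw [this]; exact CZF.boundedSeparation _ (rename_bounded h)
  | strongCollection φ =>
    have : (_root_.strongCollection φ).rename ρ =
        _root_.strongCollection (φ.rename (liftRen (liftRen (liftRen ρ)))) := by
      simp only [_root_.strongCollection, rename, liftRen, Fml.imp.injEq, Fml.all.injEq,
        Fml.conj.injEq, Fml.ex.injEq, Fml.ball.injEq, Fml.bex.injEq, true_and]
      exact ⟨key fun i => by rcases i with _ | _ | _ | i <;> rfl,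
        key fun i => by rcases i with _ | _ | _ | i <;> rfl⟩
    rw [this]; exact CZF.strongCollection _
  | subsetCollection φ =>
    have : (_root_.subsetCollection φ).rename ρ = _root_.subsetCollection
        (φ.rename (liftRen (liftRen (liftRen (liftRen (liftRen ρ)))))) := by
      simp only [_root_.subsetCollection, rename, liftRen, Fml.imp.injEq, Fml.all.injEq,
        Fml.conj.injEq, Fml.ex.injEq, Fml.ball.injEq, Fml.bex.injEq, true_and]
      exact ⟨key fun i => by rcases i with _ | _ | _ | _ | _ | i <;> rfl,
        key fun i => by rcases i with _ | _ | _ | _ | _ | i <;> rfl,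
        key fun i => by rcases i with _ | _ | _ | _ | _ | i <;> rfl⟩
    rw [this]; exact CZF.subsetCollection _

end CZF

/-! ## Set theory in a Kripke model -/

namespace KripkeModel

variable {K : KripkeModel}

variable (K) in
/-- The axioms of CZF are forced everywhere. -/
def IsCZF : Prop := ∀ ψ ∈ CZF, ∀ (w : K.World) σ, Env w σ → Forces w ψ σ

theorem forces_rename_of {φ : Fml} {w : K.World} {ρ σ τ : ℕ → ℕ} (h : ∀ i, σ (ρ i) = τ i) :
    Forces w (φ.rename ρ) σ ↔ Forces w φ τ := by
  rw [forces_rename, show σ ∘ ρ = τ from funext h]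

/-! ### Unordered pairs and ordered tuples at a world -/

def IsUPair (w : K.World) (p x y : ℕ) : Prop :=
  K.Mem w x p ∧ K.Mem w y p ∧ ∀ w', w ≤ w' → ∀ z, K.Mem w' z p → K.Eq w' z x ∨ K.Eq w' z y

def IsPair (w : K.World) (p x y : ℕ) : Prop :=
  (∃ u, K.Mem w u p ∧ IsUPair w u x x) ∧ (∃ u, K.Mem w u p ∧ IsUPair w u x y) ∧
    ∀ w', w ≤ w' → ∀ u, K.Mem w' u p → IsUPair w' u x x ∨ IsUPair w' u x y

def IsTriple (w : K.World) (p x y z : ℕ) : Prop :=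
  ∃ u, K.Mem w u p ∧ ∃ q, K.Mem w q u ∧ IsPair w q y z ∧ IsPair w p x q

def IsQuad (w : K.World) (p x y z t : ℕ) : Prop :=
  ∃ u, K.Mem w u p ∧ ∃ q, K.Mem w q u ∧ IsTriple w q y z t ∧ IsPair w p x q

def PairMem (w : K.World) (x y r : ℕ) : Prop := ∃ p, K.Mem w p r ∧ IsPair w p x y

def TripleMem (w : K.World) (x y z r : ℕ) : Prop := ∃ p, K.Mem w p r ∧ IsTriple w p x y z

def QuadMem (w : K.World) (x y z t r : ℕ) : Prop := ∃ p, K.Mem w p r ∧ IsQuad w p x y z t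

variable {w w' : K.World} {p x y z t r p' x' y' z' t' r' : ℕ}

theorem forces_isPair {σ : ℕ → ℕ} :
    Forces w (isPair p x y) σ ↔ IsPair w (σ p) (σ x) (σ y) := Iff.rfl
theorem forces_isTriple {σ : ℕ → ℕ} :
    Forces w (isTriple p x y z) σ ↔ IsTriple w (σ p) (σ x) (σ y) (σ z) := Iff.rfl

theorem IsUPair.mono (h : IsUPair w p x y) (H : w ≤ w') : IsUPair w' p x y :=
  ⟨K.mem_mono H h.1, K.mem_mono H h.2.1, fun v hv => h.2.2 v (H.trans hv)⟩

/-- The predicate is by definition the forcing of `isPair 0 1 2` in the environment that lists its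
arguments, so persistence is inherited from forcing. The other tuple predicates are handled in the
same way. -/
theorem IsPair.mono (h : IsPair w p x y) (H : w ≤ w') : IsPair w' p x y :=
  Forces.mono (φ := isPair 0 1 2) (σ := scons p (scons x fun _ => y)) h H

theorem IsQuad.mono (h : IsQuad w p x y z t) (H : w ≤ w') : IsQuad w' p x y z t :=
  Forces.mono (φ := isQuad 0 1 2 3 4)
    (σ := scons p (scons x (scons y (scons z fun _ => t)))) h H

theorem TripleMem.mono (h : TripleMem w x y z r) (H : w ≤ w') : TripleMem w' x y z r :=
  Forces.mono (φ := tripleMem 0 1 2 3) (σ := scons x (scons y (scons z fun _ => r))) h H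

theorem QuadMem.mono (h : QuadMem w x y z t r) (H : w ≤ w') : QuadMem w' x y z t r :=
  Forces.mono (φ := quadMem 0 1 2 3 4)
    (σ := scons x (scons y (scons z (scons t fun _ => r)))) h H

theorem IsPair.congr (h : IsPair w p x y) (hp : K.Eq w p p') (hx : K.Eq w x x')
    (hy : K.Eq w y y') : IsPair w p' x' y' :=
  Forces.congr (φ := isPair 0 1 2) (σ := scons p (scons x fun _ => y))
    (τ := scons p' (scons x' fun _ => y')) (eq_scons hp (eq_scons hx fun _ => hy)) h

theorem IsTriple.congr (h : IsTriple w p x y z) (hp : K.Eq w p p') (hx : K.Eq w x x')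
    (hy : K.Eq w y y') (hz : K.Eq w z z') : IsTriple w p' x' y' z' :=
  Forces.congr (φ := isTriple 0 1 2 3) (σ := scons p (scons x (scons y fun _ => z)))
    (τ := scons p' (scons x' (scons y' fun _ => z')))
    (eq_scons hp (eq_scons hx (eq_scons hy fun _ => hz))) h

theorem IsQuad.congr (h : IsQuad w p x y z t) (hp : K.Eq w p p') (hx : K.Eq w x x')
    (hy : K.Eq w y y') (hz : K.Eq w z z') (ht : K.Eq w t t') : IsQuad w p' x' y' z' t' :=
  Forces.congr (φ := isQuad 0 1 2 3 4) (σ := scons p (scons x (scons y (scons z fun _ => t))))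
    (τ := scons p' (scons x' (scons y' (scons z' fun _ => t'))))
    (eq_scons hp (eq_scons hx (eq_scons hy (eq_scons hz fun _ => ht)))) h

theorem TripleMem.congr (h : TripleMem w x y z r) (hx : K.Eq w x x')
    (hy : K.Eq w y y') (hz : K.Eq w z z') (hr : K.Eq w r r') : TripleMem w x' y' z' r' :=
  Forces.congr (φ := tripleMem 0 1 2 3) (σ := scons x (scons y (scons z fun _ => r)))
    (τ := scons x' (scons y' (scons z' fun _ => r')))
    (eq_scons hx (eq_scons hy (eq_scons hz fun _ => hr))) h

theorem QuadMem.congr (h : QuadMem w x y z t r) (hx : K.Eq w x x') (hy : K.Eq w y y')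
    (hz : K.Eq w z z') (ht : K.Eq w t t') (hr : K.Eq w r r') : QuadMem w x' y' z' t' r' :=
  Forces.congr (φ := quadMem 0 1 2 3 4) (σ := scons x (scons y (scons z (scons t fun _ => r))))
    (τ := scons x' (scons y' (scons z' (scons t' fun _ => r'))))
    (eq_scons hx (eq_scons hy (eq_scons hz (eq_scons ht fun _ => hr)))) h

theorem IsPair.exists_first (h : IsPair w p x y) : K.Ex w p ∧ K.Ex w x ∧ K.Ex w y := by
  obtain ⟨-, ⟨u, hu, h₁, h₂, -⟩, -⟩ := h
  exact ⟨(K.mem_ex hu).2, (K.mem_ex h₁).1, (K.mem_ex h₂).1⟩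

theorem TripleMem.ex (h : TripleMem w x y z r) :
    K.Ex w x ∧ K.Ex w y ∧ K.Ex w z ∧ K.Ex w r := by
  obtain ⟨p, hp, u, hu, q, hq, h₁, h₂⟩ := h
  exact ⟨h₂.exists_first.2.1, h₁.exists_first.2.1, h₁.exists_first.2.2, (K.mem_ex hp).2⟩

theorem QuadMem.ex (h : QuadMem w x y z t r) :
    K.Ex w x ∧ K.Ex w y ∧ K.Ex w z ∧ K.Ex w t ∧ K.Ex w r := by
  obtain ⟨p, hp, u, hu, q, hq, h₁, h₂⟩ := h
  obtain ⟨u', -, q', -, h₃, h₄⟩ := h₁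
  exact ⟨h₂.exists_first.2.1, h₄.exists_first.2.1, h₃.exists_first.2.1, h₃.exists_first.2.2,
    (K.mem_ex hp).2⟩

theorem IsUPair.singleton_eq (h : IsUPair w p x x) (hz : K.Mem w z p) : K.Eq w z x :=
  (h.2.2 w le_rfl z hz).elim id id

/-- No decision whether `x = y` is needed: the pair clauses force disjunctions at `w`, and a forced
disjunction has a forced side. In the degenerate case `y = x'` and `y' = x`, all four elements
coincide. -/
theorem IsPair.inj (h : IsPair w p x y) (h' : IsPair w p x' y') :
    K.Eq w x x' ∧ K.Eq w y y' := by
  obtain ⟨⟨u, hu, hux⟩, ⟨v, hv, hvx⟩, H⟩ := h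
  obtain ⟨⟨u', hu', hux'⟩, ⟨v', hv', hvx'⟩, H'⟩ := h'
  have hx : K.Eq w x' x := by
    rcases H' w le_rfl u hu with h | h <;> exact hux.singleton_eq h.1
  refine ⟨K.eq_symm hx, ?_⟩
  have hy' : K.Eq w y' x ∨ K.Eq w y' y := by
    rcases H w le_rfl v' hv' with h | h
    · exact Or.inl (h.singleton_eq hvx'.2.1)
    · exact h.2.2 w le_rfl y' hvx'.2.1
  have hy : K.Eq w y x' ∨ K.Eq w y y' := by
    rcases H' w le_rfl v hv with h | h
    · exact Or.inl (h.singleton_eq hvx.2.1)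
    · exact h.2.2 w le_rfl y hvx.2.1
  rcases hy with hy | hy
  · rcases hy' with hy' | hy'
    · exact K.eq_trans hy (K.eq_trans hx (K.eq_symm hy'))
    · exact K.eq_symm hy'
  · exact hy

theorem IsTriple.inj (h : IsTriple w p x y z) (h' : IsTriple w p x' y' z') :
    K.Eq w x x' ∧ K.Eq w y y' ∧ K.Eq w z z' := by
  obtain ⟨u, -, q, -, h₁, h₂⟩ := h
  obtain ⟨u', -, q', -, h₁', h₂'⟩ := h'
  obtain ⟨hx, hq⟩ := h₂.inj h₂'
  have ex := h₁.exists_first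
  obtain ⟨hy, hz⟩ := (h₁.congr hq (K.eq_refl ex.2.1) (K.eq_refl ex.2.2)).inj h₁'
  exact ⟨hx, hy, hz⟩

theorem IsTriple.ex (h : IsTriple w p x y z) :
    K.Ex w p ∧ K.Ex w x ∧ K.Ex w y ∧ K.Ex w z := by
  obtain ⟨u, -, q, -, h₁, h₂⟩ := h
  exact ⟨h₂.exists_first.1, h₂.exists_first.2.1, h₁.exists_first.2.1, h₁.exists_first.2.2⟩

theorem IsQuad.inj (h : IsQuad w p x y z t) (h' : IsQuad w p x' y' z' t') :
    K.Eq w x x' ∧ K.Eq w y y' ∧ K.Eq w z z' ∧ K.Eq w t t' := by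
  obtain ⟨u, -, q, -, h₁, h₂⟩ := h
  obtain ⟨u', -, q', -, h₁', h₂'⟩ := h'
  obtain ⟨hx, hq⟩ := h₂.inj h₂'
  have ex := h₁.ex
  obtain ⟨hy, hz, ht⟩ := (h₁.congr hq (K.eq_refl ex.2.1) (K.eq_refl ex.2.2.1)
    (K.eq_refl ex.2.2.2)).inj h₁'
  exact ⟨hx, hy, hz, ht⟩

/-! ### Sets that exist in a model of CZF -/

namespace IsCZF

theorem separation (hK : K.IsCZF) {φ : Fml} (hφ : φ.Bounded) {σ : ℕ → ℕ} (hσ : Env w σ)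
    (hx : K.Ex w x) : ∃ y, K.Ex w y ∧ ∀ w', w ≤ w' → ∀ z,
      (K.Mem w' z y ↔ K.Mem w' z x ∧ Forces w' φ (scons z (scons x σ))) := by
  obtain ⟨y, hy, h⟩ := hK _ (CZF.boundedSeparation φ hφ) w σ hσ w le_rfl x hx
  have e : ∀ (w' : K.World) z, Forces w' (φ.rename fun | 0 => 0 | i + 1 => i + 2)
      (scons z (scons y (scons x σ))) ↔ Forces w' φ (scons z (scons x σ)) :=
    fun w' z => forces_rename_of fun i => by cases i <;> rfl
  refine ⟨y, hy, fun w' hw z => ⟨fun hz => ?_, fun hz => ?_⟩⟩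
  · have := (h w' hw z (K.mem_ex hz).1).1 w' le_rfl hz
    exact ⟨this.1, (e w' z).1 this.2⟩
  · exact (h w' hw z (K.mem_ex hz.1).1).2 w' le_rfl ⟨hz.1, (e w' z).2 hz.2⟩

/-- The axiom only provides a superset of the union; Bounded Separation cuts it down. Unordered
pairs are obtained likewise. -/
theorem union (hK : K.IsCZF) (hx : K.Ex w x) : ∃ y, K.Ex w y ∧ ∀ w', w ≤ w' → ∀ z,
    (K.Mem w' z y ↔ ∃ u, K.Mem w' u x ∧ K.Mem w' z u) := by
  obtain ⟨y, hy, h⟩ := hK _ CZF.union w (fun _ => x) (fun _ => hx) w le_rfl x hx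
  obtain ⟨y', hy', h'⟩ := hK.separation (φ := bex 2 (mem 1 0)) (by simp [Bounded])
    (σ := fun _ => x) (fun _ => hx) hy
  refine ⟨y', hy', fun w' hw z => (h' w' hw z).trans ⟨fun h => h.2, ?_⟩⟩
  rintro ⟨u, hu, hz⟩
  exact ⟨h w' hw z (K.mem_ex hz).1 w' le_rfl u (K.mem_ex hu).1 w' le_rfl ⟨hz, hu⟩, u, hu, hz⟩

theorem upair (hK : K.IsCZF) (hx : K.Ex w x) (hy : K.Ex w y) : ∃ p, K.Ex w p ∧
    ∀ w', w ≤ w' → ∀ z, (K.Mem w' z p ↔ K.Eq w' z x ∨ K.Eq w' z y) := by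
  obtain ⟨p, hp, h₁, h₂⟩ :=
    hK _ CZF.pairing w (fun _ => x) (fun _ => hx) w le_rfl x hx w le_rfl y hy
  obtain ⟨p', hp', h'⟩ := hK.separation (φ := disj (eq 0 2) (eq 0 3)) (by simp [Bounded])
    (σ := scons x fun _ => y) (Env.scons hx fun _ => hy) hp
  refine ⟨p', hp', fun w' hw z => (h' w' hw z).trans ⟨fun h => h.2, fun h => ⟨?_, h⟩⟩⟩
  rcases h with h | h
  · exact K.mem_congr (K.eq_symm h) (K.eq_refl (K.ex_mono hw hp)) (K.mem_mono hw h₁)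
  · exact K.mem_congr (K.eq_symm h) (K.eq_refl (K.ex_mono hw hp)) (K.mem_mono hw h₂)

theorem isUPair (hK : K.IsCZF) (hx : K.Ex w x) (hy : K.Ex w y) : ∃ p, IsUPair w p x y := by
  obtain ⟨p, -, h⟩ := hK.upair hx hy
  exact ⟨p, (h w le_rfl x).2 (Or.inl (K.eq_refl hx)), (h w le_rfl y).2 (Or.inr (K.eq_refl hy)),
    fun w' hw z => (h w' hw z).1⟩

theorem empty (hK : K.IsCZF) (hx : K.Ex w x) :
    ∃ y, K.Ex w y ∧ ∀ w', w ≤ w' → ∀ z, ¬ K.Mem w' z y := by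
  obtain ⟨y, hy, h⟩ := hK.separation (φ := neg (eq 0 0)) (by simp [Bounded])
    (σ := fun _ => x) (fun _ => hx) hx
  exact ⟨y, hy, fun w' hw z hz =>
    ((h w' hw z).1 hz).2 w' le_rfl (K.eq_refl (K.mem_ex hz).1)⟩

end IsCZF

theorem IsUPair.congr (h : IsUPair w p x y) (hp : K.Eq w p p') (hx : K.Eq w x x')
    (hy : K.Eq w y y') : IsUPair w p' x' y' :=
  Forces.congr (φ := _root_.isUPair 0 1 2) (σ := scons p (scons x fun _ => y))
    (τ := scons p' (scons x' fun _ => y')) (eq_scons hp (eq_scons hx fun _ => hy)) h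

namespace IsCZF

theorem isPair (hK : K.IsCZF) (hx : K.Ex w x) (hy : K.Ex w y) : ∃ p, IsPair w p x y := by
  obtain ⟨u, hu⟩ := hK.isUPair hx hx
  obtain ⟨v, hv⟩ := hK.isUPair hx hy
  have eu := (K.mem_ex hu.1).2
  have ev := (K.mem_ex hv.1).2
  obtain ⟨p, hp⟩ := hK.isUPair eu ev
  refine ⟨p, ⟨u, hp.1, hu⟩, ⟨v, hp.2.1, hv⟩, fun w' hw z hz => (hp.2.2 w' hw z hz).imp ?_ ?_⟩
  · intro h
    exact (hu.mono hw).congr (K.eq_symm h) (K.eq_refl (K.ex_mono hw hx))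
      (K.eq_refl (K.ex_mono hw hx))
  · intro h
    exact (hv.mono hw).congr (K.eq_symm h) (K.eq_refl (K.ex_mono hw hx))
      (K.eq_refl (K.ex_mono hw hy))

theorem isTriple (hK : K.IsCZF) (hx : K.Ex w x) (hy : K.Ex w y) (hz : K.Ex w z) :
    ∃ p, IsTriple w p x y z := by
  obtain ⟨q, hq⟩ := hK.isPair hy hz
  obtain ⟨p, hp⟩ := hK.isPair hx hq.exists_first.1
  obtain ⟨u, hu, hu'⟩ := hp.2.1
  exact ⟨p, u, hu, q, hu'.2.1, hq, hp⟩

theorem isQuad (hK : K.IsCZF) (hx : K.Ex w x) (hy : K.Ex w y) (hz : K.Ex w z)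
    (ht : K.Ex w t) : ∃ p, IsQuad w p x y z t := by
  obtain ⟨q, hq⟩ := hK.isTriple hy hz ht
  obtain ⟨p, hp⟩ := hK.isPair hx hq.ex.1
  obtain ⟨u, hu, hu'⟩ := hp.2.1
  exact ⟨p, u, hu, q, hu'.2.1, hq, hp⟩

theorem extensionality (hK : K.IsCZF) (hx : K.Ex w x) (hy : K.Ex w y)
    (h : ∀ w', w ≤ w' → ∀ z, (K.Mem w' z x ↔ K.Mem w' z y)) : K.Eq w x y :=
  hK _ CZF.extensionality w (fun _ => x) (fun _ => hx) w le_rfl x hx w le_rfl y hy w le_rfl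
    fun _ hw z _ => ⟨fun w'' hw' => (h w'' (hw.trans hw') z).1,
      fun w'' hw' => (h w'' (hw.trans hw') z).2⟩

theorem collection (hK : K.IsCZF) (φ : Fml) {σ : ℕ → ℕ} (hσ : Env w σ) (hx : K.Ex w x)
    (h : ∀ w', w ≤ w' → ∀ u, K.Mem w' u x →
      ∃ v, K.Ex w' v ∧ Forces w' φ (scons v (scons u (scons x σ)))) :
    ∃ y, K.Ex w y ∧
      (∀ w', w ≤ w' → ∀ u, K.Mem w' u x →
        ∃ v, K.Mem w' v y ∧ Forces w' φ (scons v (scons u (scons x σ)))) ∧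
      (∀ w', w ≤ w' → ∀ v, K.Mem w' v y →
        ∃ u, K.Mem w' u x ∧ Forces w' φ (scons v (scons u (scons x σ)))) := by
  obtain ⟨y, hy, h₁, h₂⟩ := hK _ (CZF.strongCollection φ) w σ hσ w le_rfl x hx w le_rfl h
  refine ⟨y, hy, fun w' hw u hu => ?_, fun w' hw v hv => ?_⟩
  · obtain ⟨v, hv, h⟩ := h₁ w' hw u hu
    exact ⟨v, hv, (forces_rename_of fun i => by rcases i with _ | _ | i <;> rfl).1 h⟩
  · obtain ⟨u, hu, h⟩ := h₂ w' hw v hv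
    exact ⟨u, hu, (forces_rename_of fun i => by rcases i with _ | _ | i <;> rfl).1 h⟩

theorem induction (hK : K.IsCZF) (φ : Fml) {σ : ℕ → ℕ} (hσ : Env w σ)
    (h : ∀ w', w ≤ w' → ∀ x, K.Ex w' x →
      (∀ w'', w' ≤ w'' → ∀ y, K.Mem w'' y x → Forces w'' φ (scons y σ)) →
      Forces w' φ (scons x σ)) (hx : K.Ex w x) : Forces w φ (scons x σ) := by
  refine hK _ (CZF.setInduction φ) w σ hσ w le_rfl ?_ w le_rfl x hx
  intro w₁ h₁ x hx w₂ h₂ H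
  refine h w₂ (h₁.trans h₂) x (K.ex_mono h₂ hx) fun w₃ h₃ y hy => ?_
  exact (forces_rename_of fun i => by cases i <;> rfl).1 (H w₃ h₃ y hy)

/-- The formula `φ` holds of `x` and of everything that is at most `k` membership steps below. -/
def deep (φ : Fml) : ℕ → Fml
  | 0 => φ
  | k + 1 => conj φ (ball 0 ((deep φ k).rename fun | 0 => 0 | i + 1 => i + 2))

theorem forces_deep_succ {φ : Fml} {k : ℕ} {σ : ℕ → ℕ} :
    Forces w (deep φ (k + 1)) (scons x σ) ↔ Forces w φ (scons x σ) ∧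
      ∀ w', w ≤ w' → ∀ y, K.Mem w' y x → Forces w' (deep φ k) (scons y σ) := by
  exact and_congr Iff.rfl (forall_congr' fun _ => forall_congr' fun _ => forall_congr' fun _ =>
    forall_congr' fun _ => forces_rename_of fun i => by cases i <;> rfl)

theorem forces_deep_of_succ {φ : Fml} {k : ℕ} {σ : ℕ → ℕ} :
    ∀ {w : K.World} {x : ℕ}, Forces w (deep φ (k + 1)) (scons x σ) →
      Forces w (deep φ k) (scons x σ) := by
  induction k with
  | zero => exact fun h => (forces_deep_succ.1 h).1
  | succ k ih =>
    intro w x h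
    rw [forces_deep_succ] at h ⊢
    exact ⟨h.1, fun w' hw y hy => ih (h.2 w' hw y hy)⟩

/-- Induction along the relation `⟨c, d, z⟩ ∈ x`. -/
theorem triple_induction (hK : K.IsCZF) (φ : Fml) {σ : ℕ → ℕ} (hσ : Env w σ)
    (h : ∀ w', w ≤ w' → ∀ x, K.Ex w' x →
      (∀ w'', w' ≤ w'' → ∀ c d z, TripleMem w'' c d z x → Forces w'' φ (scons z σ)) →
      Forces w' φ (scons x σ)) (hx : K.Ex w x) : Forces w φ (scons x σ) := by
  -- If `p = ⟨c, d, z⟩`, then `z` lies four membership steps below `p`: `z ∈ {d, z} ∈ ⟨d, z⟩ ∈ u ∈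
  -- p` for some `u`. The strengthening to depth `4` makes plain set induction, applied to `p ∈ x`,
  -- reach `z`.
  have key : Forces w (deep φ 4) (scons x σ) := by
    refine hK.induction (deep φ 4) hσ ?_ hx
    intro w₁ h₁ x hx ih
    refine forces_deep_succ.2 ⟨h w₁ h₁ x hx fun w₂ h₂ c d z ht => ?_,
      fun w₂ h₂ y hy => forces_deep_of_succ (ih w₂ h₂ y hy)⟩
    obtain ⟨p, hp, u, hu, q, hq, h₃, -⟩ := ht
    obtain ⟨v, hv, hv'⟩ := h₃.2.1
    have i₄ := forces_deep_succ.1 (ih w₂ h₂ p hp)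
    have i₃ := forces_deep_succ.1 (i₄.2 w₂ le_rfl u hu)
    have i₂ := forces_deep_succ.1 (i₃.2 w₂ le_rfl q hq)
    have i₁ := forces_deep_succ.1 (i₂.2 w₂ le_rfl v hv)
    exact i₁.2 w₂ le_rfl z hv'.2.1
  exact (forces_deep_succ.1 key).1

end IsCZF

end KripkeModel

/-- The structure with every variable replaced by its value. -/
def Par.map (σ : ℕ → ℕ) (P : Par) : Par where
  A := σ P.A
  app := σ P.app
  k := σ P.k
  s := σ P.s
  succ := σ P.succ
  pred := σ P.pred
  d := σ P.d
  num := σ P.num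

/-- The environment in which the standard variables of a structure have the given values. -/
def Par.env (P : Par) : ℕ → ℕ :=
  scons P.A (scons P.app (scons P.k (scons P.s (scons P.succ (scons P.pred (scons P.d
    fun _ => P.num))))))

/-! ### Variable bounds, closed terms and pairing terms -/

namespace Tm

/-- All variables of the term are smaller than `n`. -/
def Below (n : ℕ) : Tm → Prop
  | var i => i < n
  | app t u => Below n t ∧ Below n u
  | _ => True

theorem Below.mono {n m : ℕ} {t : Tm} (h : t.Below n) (H : n ≤ m) : t.Below m := by
  induction t with
  | var i => exact lt_of_lt_of_le h H
  | app t u ih₁ ih₂ => exact ⟨ih₁ h.1, ih₂ h.2⟩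
  | _ => trivial

theorem below_zero_iff {t : Tm} : t.Below 0 ↔ t.Closed := by
  induction t with
  | var i => exact iff_of_false (Nat.not_lt_zero i) id
  | app t u ih₁ ih₂ => exact and_congr ih₁ ih₂
  | _ => exact Iff.rfl

theorem Closed.below {t : Tm} (h : t.Closed) (n : ℕ) : t.Below n :=
  (below_zero_iff.2 h).mono (Nat.zero_le n)

theorem Below.lam {n : ℕ} {t : Tm} (h : t.Below (n + 1)) : (t.lam n).Below n := by
  induction t with
  | var i =>
    by_cases hi : i = n
    · simp [Tm.lam, hi, Below]
    · have : i < n + 1 := h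
      simp only [Tm.lam, hi, if_false, Below, true_and]
      omega
  | app t u ih₁ ih₂ => exact ⟨⟨trivial, ih₁ h.1⟩, ih₂ h.2⟩
  | _ => exact ⟨trivial, trivial⟩

/-- The pairing combinator `λ x y z. z x y` -/
def pr : Tm := lam 0 (lam 1 (lam 2 (app (app (var 2) (var 0)) (var 1))))

theorem pr_closed : pr.Closed := by simp [pr, lam, Closed]

/-- The term `⟨t, u⟩` -/
def pair (t u : Tm) : Tm := app (app pr t) u

/-- The term `d 0 t u v`, with the value of `u` if `t` is `0` and the value of `v` if `t` is `1` -/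
def cases (t u v : Tm) : Tm := app (app (app (app d zero) t) u) v

theorem p₀_closed : p₀.Closed := by simp [p₀, lam, Closed]

theorem p₁_closed : p₁.Closed := by simp [p₁, lam, Closed]

end Tm

namespace KripkeModel

variable {K : KripkeModel}

theorem mem_of_eq {w : K.World} {x x' y : ℕ} (h : K.Eq w x x') (H : K.Mem w x y) :
    K.Mem w x' y :=
  K.mem_congr h (K.eq_refl (K.mem_ex H).2) H

/-! ## Values of application terms -/

/-- This is the literal forcing clause of `isEmpty`. Existing elements are equal to themselves, so
it says that `x` has no elements at any later world. -/
def IsEmptySet (w : K.World) (x : ℕ) : Prop :=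
  ∀ w', w ≤ w' → ∀ c, K.Mem w' c x → ∀ w'', w' ≤ w'' → ¬ K.Eq w'' c c

/-- `c` is the numeral of `0` -/
def IsZero (w : K.World) (P : Par) (c : ℕ) : Prop :=
  ∃ p, K.Mem w p P.num ∧ ∃ u, K.Mem w u p ∧ ∃ n, K.Mem w n u ∧ IsEmptySet w n ∧ IsPair w p n c

/-- The application of `a` to `b` is defined with value `c`. -/
def App (w : K.World) (P : Par) (a b c : ℕ) : Prop := TripleMem w a b c P.app

/-- The value of the term `t` in the environment `ρ` is `c`. -/
def Ev (w : K.World) (P : Par) (ρ : ℕ → ℕ) : Tm → ℕ → Prop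
  | .var i, c => K.Eq w (ρ i) c
  | .k, c => K.Eq w P.k c
  | .s, c => K.Eq w P.s c
  | .succ, c => K.Eq w P.succ c
  | .pred, c => K.Eq w P.pred c
  | .d, c => K.Eq w P.d c
  | .zero, c => IsZero w P c
  | .app t u, c => ∃ a, K.Mem w a P.A ∧ ∃ b, K.Mem w b P.A ∧ Ev w P ρ t a ∧ Ev w P ρ u b ∧
      App w P a b c

/-- A formula about a term speaks of variables for the structure, the semantic predicates of their
values; `P.map σ` mediates. Going below a binder shifts `P` and extends `σ`, and the two cancel
definitionally. -/
theorem forces_eval {w : K.World} {t : Tm} : ∀ {P : Par} {v : ℕ → ℕ} {c : ℕ} {σ : ℕ → ℕ},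
    Forces w (t.eval P v c) σ ↔ Ev w (P.map σ) (σ ∘ v) t (σ c) := by
  induction t with
  | app t u ih₁ ih₂ =>
    intro P v c σ
    refine exists_congr fun a => and_congr Iff.rfl (exists_congr fun b => and_congr Iff.rfl
      (and_congr ?_ (and_congr ?_ Iff.rfl)))
    · exact ih₁
    · exact ih₂
  | _ => exact Iff.rfl

/-- The structure `P` is forced to be a partial combinatory algebra over `ω`, in a model of CZF. -/
structure Pca (w : K.World) (P : Par) : Prop where
  czf : K.IsCZF
  env : Env w P.env
  forced : Forces w stdPar.isPCAω P.env

namespace Pca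

variable {w w' : K.World} {P : Par} {a b c f g r n m : ℕ}

theorem mono (h : Pca w P) (H : w ≤ w') : Pca w' P := ⟨h.czf, h.env.mono H, h.forced.mono H⟩

theorem ex_app (h : Pca w P) : K.Ex w P.app := h.env 1

theorem app_congr (h : Pca w P) {a' b' c' : ℕ} (ha : K.Eq w a a') (hb : K.Eq w b b')
    (hc : K.Eq w c c') (H : App w P a b c) : App w P a' b' c' :=
  TripleMem.congr H ha hb hc (K.eq_refl h.ex_app)

theorem app_mem (h : Pca w P) (H : App w P a b c) :
    K.Mem w a P.A ∧ K.Mem w b P.A ∧ K.Mem w c P.A := by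
  obtain ⟨⟨⟨hop, -⟩, -⟩, -⟩ := h.forced
  obtain ⟨p, hp, ht⟩ := H
  obtain ⟨a', ha', b', hb', c', hc', ht'⟩ := hop w le_rfl p hp
  obtain ⟨e₁, e₂, e₃⟩ := IsTriple.inj (forces_isTriple.1 ht') ht
  exact ⟨mem_of_eq e₁ ha', mem_of_eq e₂ hb', mem_of_eq e₃ hc'⟩

theorem app_unique (h : Pca w P) {c' : ℕ} (H : App w P a b c) (H' : App w P a b c') :
    K.Eq w c c' := by
  obtain ⟨⟨⟨-, hop⟩, -⟩, -⟩ := h.forced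
  obtain ⟨ha, hb, hc⟩ := h.app_mem H
  exact hop w le_rfl a ha w le_rfl b hb w le_rfl c hc w le_rfl c' (h.app_mem H').2.2
    w le_rfl H w le_rfl H'

theorem k_mem (h : Pca w P) : K.Mem w P.k P.A := h.forced.1.2.2.1.1

theorem s_mem (h : Pca w P) : K.Mem w P.s P.A := h.forced.1.2.2.1.2

theorem succ_mem (h : Pca w P) : K.Mem w P.succ P.A := h.forced.2.1.1

theorem pred_mem (h : Pca w P) : K.Mem w P.pred P.A := h.forced.2.1.2.1

theorem d_mem (h : Pca w P) : K.Mem w P.d P.A := h.forced.2.1.2.2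

/-- Application terms of the form `t u`, without reference to the domain. -/
theorem ev_app (h : Pca w P) {ρ : ℕ → ℕ} {t u : Tm} : Ev w P ρ (.app t u) c ↔
    ∃ a b, Ev w P ρ t a ∧ Ev w P ρ u b ∧ App w P a b c := by
  constructor
  · rintro ⟨a, -, b, -, H⟩
    exact ⟨a, b, H⟩
  · rintro ⟨a, b, H⟩
    exact ⟨a, (h.app_mem H.2.2).1, b, (h.app_mem H.2.2).2.1, H⟩

/-- The axiom gives a value of `k a` for each `b` separately; since application is single-valued,
one value serves for all `b`. That there is any value is seen with `a` itself in the place of `b`.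
-/
theorem k_app (h : Pca w P) (ha : K.Mem w a P.A) :
    ∃ f, App w P P.k a f ∧ ∀ b, K.Mem w b P.A → App w P f b a := by
  obtain ⟨⟨-, -, -, ⟨-, hk⟩, -⟩, -⟩ := h.forced
  obtain ⟨b, hb⟩ : ∃ b, K.Mem w b P.A := ⟨_, ha⟩
  have key : ∀ b, K.Mem w b P.A → ∃ f, App w P P.k a f ∧ App w P f b a := by
    intro b hb
    have := forces_eval.1 (hk w le_rfl a ha w le_rfl b hb)
    obtain ⟨f, b', h₁, h₂, h₃⟩ := h.ev_app.1 this
    obtain ⟨k', a', h₄, h₅, h₆⟩ := h.ev_app.1 h₁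
    have hf : K.Eq w f f := K.eq_refl (K.mem_ex (h.app_mem h₃).1).1
    exact ⟨f, h.app_congr (K.eq_symm h₄) (K.eq_symm h₅) hf h₆,
      h.app_congr hf (K.eq_symm h₂) (K.eq_refl (K.mem_ex ha).1) h₃⟩
  obtain ⟨f, hf, -⟩ := key b hb
  refine ⟨f, hf, fun b hb => ?_⟩
  obtain ⟨f', hf', H⟩ := key b hb
  exact h.app_congr (h.app_unique hf' hf) (K.eq_refl (K.mem_ex hb).1)
    (K.eq_refl (K.mem_ex ha).1) H

theorem s_app (h : Pca w P) (ha : K.Mem w a P.A) (hb : K.Mem w b P.A) :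
    ∃ f g, App w P P.s a f ∧ App w P f b g := by
  obtain ⟨⟨-, -, -, -, -, hs, -⟩, -⟩ := h.forced
  obtain ⟨g, hg, H⟩ := hs w le_rfl a ha w le_rfl b hb
  obtain ⟨f, b', h₁, h₂, h₃⟩ := h.ev_app.1 (forces_eval.1 H)
  obtain ⟨s', a', h₄, h₅, h₆⟩ := h.ev_app.1 h₁
  have hf : K.Eq w f f := K.eq_refl (K.mem_ex (h.app_mem h₃).1).1
  exact ⟨f, g, h.app_congr (K.eq_symm h₄) (K.eq_symm h₅) hf h₆,
    h.app_congr hf (K.eq_symm h₂) (K.eq_refl (K.mem_ex hg).1) h₃⟩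

/-- Both directions of the equality of partial terms in the axiom for `s`, freed from terms. The
equivalence lets `ev_lam` describe exactly when an abstraction applied to an argument is defined. -/
theorem app_of_s (h : Pca w P) (hf : App w P P.s a f) (hg : App w P f b g)
    (hc : K.Mem w c P.A) :
    App w P g c r ↔ ∃ x y, App w P a c x ∧ App w P b c y ∧ App w P x y r := by
  obtain ⟨⟨-, -, -, -, -, -, hs⟩, -⟩ := h.forced
  have ha := (h.app_mem hf).2.1
  have hb := (h.app_mem hg).2.1
  have refl : ∀ {x}, K.Mem w x P.A → K.Eq w x x := fun hx => K.eq_refl (K.mem_ex hx).1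
  have key : ∀ (hr : K.Mem w r P.A), App w P g c r ↔
      ∃ x y, App w P a c x ∧ App w P b c y ∧ App w P x y r := by
    intro hr
    have H := hs w le_rfl a ha w le_rfl b hb w le_rfl c hc w le_rfl r hr
    have H₁ := fun h' => forces_eval.1 (H.1 w le_rfl (forces_eval.2 h'))
    have H₂ := fun h' => forces_eval.1 (H.2 w le_rfl (forces_eval.2 h'))
    constructor
    · intro hgc
      obtain ⟨x, y, h₁, h₂, h₃⟩ := h.ev_app.1 (H₁ (h.ev_app.2 ⟨g, c, h.ev_app.2 ⟨f, b,
        h.ev_app.2 ⟨P.s, a, refl h.s_mem, refl ha, hf⟩, refl hb, hg⟩, refl hc, hgc⟩))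
      obtain ⟨a', c', h₄, h₅, h₆⟩ := h.ev_app.1 h₁
      obtain ⟨b', c'', h₇, h₈, h₉⟩ := h.ev_app.1 h₂
      exact ⟨x, y,
        h.app_congr (K.eq_symm h₄) (K.eq_symm h₅) (refl (h.app_mem h₃).1) h₆,
        h.app_congr (K.eq_symm h₇) (K.eq_symm h₈) (refl (h.app_mem h₃).2.1) h₉, h₃⟩
    · rintro ⟨x, y, h₁, h₂, h₃⟩
      obtain ⟨g', c', h₁, h₂, h₃⟩ := h.ev_app.1 (H₂ (h.ev_app.2 ⟨x, y,
        h.ev_app.2 ⟨a, c, refl ha, refl hc, h₁⟩, h.ev_app.2 ⟨b, c, refl hb, refl hc, h₂⟩, h₃⟩))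
      obtain ⟨f', b', h₄, h₅, h₆⟩ := h.ev_app.1 h₁
      obtain ⟨s', a', h₇, h₈, h₉⟩ := h.ev_app.1 h₄
      have ef : K.Eq w f' f := h.app_unique
        (h.app_congr (K.eq_symm h₇) (K.eq_symm h₈) (refl (h.app_mem h₆).1) h₉) hf
      have eg : K.Eq w g' g := h.app_unique
        (h.app_congr ef (K.eq_symm h₅) (refl (h.app_mem h₃).1) h₆) hg
      exact h.app_congr eg (K.eq_symm h₂) (refl hr) h₃
  constructor
  · exact fun H => (key (h.app_mem H).2.2).1 H
  · rintro ⟨x, y, H⟩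
    exact (key (h.app_mem H.2.2).2.2).2 ⟨x, y, H⟩

/-! ## Zero and one -/

theorem eq_of_isEmptySet (h : Pca w P) (hn : K.Ex w n) (hm : K.Ex w m) (h₁ : IsEmptySet w n)
    (h₂ : IsEmptySet w m) : K.Eq w n m :=
  h.czf.extensionality hn hm fun w' hw z =>
    ⟨fun hz => (h₁ w' hw z hz w' le_rfl (K.eq_refl (K.mem_ex hz).1)).elim,
      fun hz => (h₂ w' hw z hz w' le_rfl (K.eq_refl (K.mem_ex hz).1)).elim⟩

theorem isZero_unique (h : Pca w P) (hr : IsZero w P r) (hc : IsZero w P c) : K.Eq w r c := by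
  obtain ⟨-, -, W, hW, hω, ⟨hnum, -, hfun⟩, -⟩ := h.forced
  obtain ⟨p, hp, u, hu, n, hn, he, hpn⟩ := hr
  obtain ⟨q, hq, v, hv, m, hm, he', hqm⟩ := hc
  obtain ⟨n', hn', r', hr', h₁⟩ := hnum w le_rfl p hp
  obtain ⟨m', hm', c', hc', h₂⟩ := hnum w le_rfl q hq
  obtain ⟨e₁, e₂⟩ := IsPair.inj (forces_isPair.1 h₁) hpn
  obtain ⟨e₃, e₄⟩ := IsPair.inj (forces_isPair.1 h₂) hqm
  have e := h.eq_of_isEmptySet (K.mem_ex hn).1 (K.mem_ex hm).1 he he'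
  refine hfun w le_rfl n (mem_of_eq e₁ hn') w le_rfl r (mem_of_eq e₂ hr') w le_rfl c
    (mem_of_eq e₄ hc') w le_rfl ⟨p, hp, hpn⟩ w le_rfl ⟨q, hq, ?_⟩
  exact hqm.congr (K.eq_refl (K.mem_ex hq).1) (K.eq_symm e) (K.eq_refl hqm.exists_first.2.2)

theorem isZero_mem (h : Pca w P) (hr : IsZero w P r) : K.Mem w r P.A := by
  obtain ⟨-, -, W, hW, hω, ⟨hnum, -⟩, -⟩ := h.forced
  obtain ⟨p, hp, u, hu, n, hn, he, hpn⟩ := hr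
  obtain ⟨n', hn', r', hr', h₁⟩ := hnum w le_rfl p hp
  exact mem_of_eq (IsPair.inj (forces_isPair.1 h₁) hpn).2 hr'

theorem isZero_congr (hr : IsZero w P r) (e : K.Eq w r c) : IsZero w P c := by
  obtain ⟨p, hp, u, hu, n, hn, he, hpn⟩ := hr
  exact ⟨p, hp, u, hu, n, hn, he,
    hpn.congr (K.eq_refl (K.mem_ex hp).1) (K.eq_refl (K.mem_ex hn).1) e⟩

/-- The value of `d n̄ m̄ a b`. -/
def CaseApp (w : K.World) (P : Par) (n m a b r : ℕ) : Prop :=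
  ∃ f g j, App w P P.d n f ∧ App w P f m g ∧ App w P g a j ∧ App w P j b r

/-- What the logic needs of the numerals: the tags of disjunctions exist and `d` tells them apart.
They are the numerals of `∅` and `{∅}`. -/
theorem exists_zero_one (h : Pca w P) : ∃ z o, IsZero w P z ∧ App w P P.succ z o ∧
    (∀ a b, K.Mem w a P.A → K.Mem w b P.A → CaseApp w P z z a b a) ∧
    (∀ a b, K.Mem w a P.A → K.Mem w b P.A → CaseApp w P z o a b b) := by
  obtain ⟨-, -, W, hW, hω, ⟨hnum, hdef, hfun⟩, hsp, hcases⟩ := h.forced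
  obtain ⟨n, hn, hn'⟩ := h.czf.empty hW
  obtain ⟨m, hm, hm'⟩ := h.czf.upair hn hn
  have refl : ∀ {x}, K.Mem w x P.A → K.Eq w x x := fun hx => K.eq_refl (K.mem_ex hx).1
  have hempty : IsEmptySet w n := fun w' hw c hc => (hn' w' hw c hc).elim
  have hnW : K.Mem w n W := (hω w le_rfl n hn).2 w le_rfl (Or.inl hempty)
  have hnm : K.Mem w n m := (hm' w le_rfl n).2 (Or.inl (K.eq_refl hn))
  -- Stated for any variables with the values `m` and `n`, because the successor formula occurs
  -- below with two different choices of indices.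
  have hsucc : ∀ {σ : ℕ → ℕ} {i j : ℕ}, σ i = m → σ j = n → Forces w (isSucc i j) σ := by
    rintro σ i j hi hj
    refine ⟨fun w' hw c hc => Or.inr ?_, fun w' hw c hc => ?_, ?_⟩
    · change K.Mem w' c (σ i) at hc
      rw [hi] at hc
      show K.Eq w' c (σ j)
      rw [hj]
      exact ((hm' w' hw c).1 hc).elim id id
    · change K.Mem w' c (σ j) at hc
      rw [hj] at hc
      exact (hn' w' hw c hc).elim
    · show K.Mem w (σ j) (σ i)
      rwa [hi, hj]
  have hmW : K.Mem w m W := (hω w le_rfl m hm).2 w le_rfl (Or.inr ⟨n, hnW, hsucc rfl rfl⟩)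
  obtain ⟨z, hz, hzn⟩ := hdef w le_rfl n hnW
  obtain ⟨o, ho, hom⟩ := hdef w le_rfl m hmW
  have hzn : PairMem w n z P.num := hzn
  have hom : PairMem w m o P.num := hom
  have hsz := (hsp w le_rfl n hnW w le_rfl m hmW w le_rfl z hz w le_rfl o ho w le_rfl
    (hsucc rfl rfl) w le_rfl hzn w le_rfl hom).1
  obtain ⟨s', z', e₁, e₂, hs⟩ := h.ev_app.1 (forces_eval.1 hsz)
  have conv : ∀ {ρ : ℕ → ℕ} {r : ℕ}, Ev w P ρ
      (.app (.app (.app (.app .d (.var 3)) (.var 2)) (.var 1)) (.var 0)) r →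
      CaseApp w P (ρ 3) (ρ 2) (ρ 1) (ρ 0) r := by
    intro ρ r H
    obtain ⟨j, b, H, e₁, h₁⟩ := h.ev_app.1 H
    obtain ⟨g, a, H, e₂, h₂⟩ := h.ev_app.1 H
    obtain ⟨f, m, H, e₃, h₃⟩ := h.ev_app.1 H
    obtain ⟨d, n, e₅, e₄, h₄⟩ := h.ev_app.1 H
    exact ⟨f, g, j, h.app_congr (K.eq_symm e₅) (K.eq_symm e₄) (refl (h.app_mem h₄).2.2) h₄,
      h.app_congr (refl (h.app_mem h₃).1) (K.eq_symm e₃) (refl (h.app_mem h₃).2.2) h₃,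
      h.app_congr (refl (h.app_mem h₂).1) (K.eq_symm e₂) (refl (h.app_mem h₂).2.2) h₂,
      h.app_congr (refl (h.app_mem h₁).1) (K.eq_symm e₁) (refl (h.app_mem h₁).2.2) h₁⟩
  refine ⟨z, o, ?_, h.app_congr (K.eq_symm e₁) (K.eq_symm e₂) (refl ho) hs,
    fun a b ha hb => ?_, fun a b ha hb => ?_⟩
  · obtain ⟨p, hp, hpn⟩ := hzn
    obtain ⟨u, hu, hun⟩ := hpn.1
    exact ⟨p, hp, u, hu, n, hun.1, hempty, hpn⟩
  · exact conv (forces_eval.1 ((hcases w le_rfl n hnW w le_rfl n hnW w le_rfl z hz w le_rfl z hz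
      w le_rfl a ha w le_rfl b hb w le_rfl hzn w le_rfl hzn).1 w le_rfl (K.eq_refl hn)))
  · refine conv (forces_eval.1 ((hcases w le_rfl n hnW w le_rfl m hmW w le_rfl z hz w le_rfl o ho
      w le_rfl a ha w le_rfl b hb w le_rfl hzn w le_rfl hom).2 w le_rfl fun w' hw e => ?_))
    have e : K.Eq w' n m := e
    -- If `∅` and `{∅}` became equal at a later world, `∅ ∈ {∅}` would give `∅ ∈ ∅`.
    exact hn' w' hw n (K.mem_congr (K.eq_refl (K.ex_mono hw hn)) (K.eq_symm e) (K.mem_mono hw hnm))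

/-! ## Properties of values -/

theorem ev_mono {ρ : ℕ → ℕ} {t : Tm} (H : w ≤ w') :
    ∀ {c}, Ev w P ρ t c → Ev w' P ρ t c := by
  induction t with
  | app t u ih₁ ih₂ =>
    rintro c ⟨a, ha, b, hb, h₁, h₂, h₃⟩
    exact ⟨a, K.mem_mono H ha, b, K.mem_mono H hb, ih₁ h₁, ih₂ h₂, TripleMem.mono h₃ H⟩
  | zero =>
    rintro c ⟨p, hp, u, hu, n, hn, he, hpn⟩
    exact ⟨p, K.mem_mono H hp, u, K.mem_mono H hu, n, K.mem_mono H hn,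
      fun w'' hw => he w'' (H.trans hw), hpn.mono H⟩
  | _ => exact fun h => K.eq_mono H h

theorem ev_unique (h : Pca w P) {ρ : ℕ → ℕ} {t : Tm} :
    ∀ {c c'}, Ev w P ρ t c → Ev w P ρ t c' → K.Eq w c c' := by
  induction t with
  | app t u ih₁ ih₂ =>
    rintro c c' ⟨a, ha, b, hb, h₁, h₂, h₃⟩ ⟨a', ha', b', hb', h₁', h₂', h₃'⟩
    exact h.app_unique (h.app_congr (ih₁ h₁ h₁') (ih₂ h₂ h₂')
      (K.eq_refl (K.mem_ex (h.app_mem h₃).2.2).1) h₃) h₃'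
  | zero => exact h.isZero_unique
  | _ => exact fun h h' => K.eq_trans (K.eq_symm h) h'

theorem ev_congr (h : Pca w P) {ρ : ℕ → ℕ} {t : Tm} :
    ∀ {c c'}, Ev w P ρ t c → K.Eq w c c' → Ev w P ρ t c' := by
  induction t with
  | app t u ih₁ ih₂ =>
    rintro c c' ⟨a, ha, b, hb, h₁, h₂, h₃⟩ e
    exact ⟨a, ha, b, hb, h₁, h₂, h.app_congr (K.eq_refl (K.mem_ex ha).1)
      (K.eq_refl (K.mem_ex hb).1) e h₃⟩
  | zero => exact isZero_congr
  | _ => exact fun h h' => K.eq_trans h h'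

theorem ev_agree {ρ ρ' : ℕ → ℕ} {t : Tm} {n : ℕ} (ht : t.Below n) (H : ∀ i < n, ρ i = ρ' i) :
    ∀ {c}, Ev w P ρ t c → Ev w P ρ' t c := by
  induction t with
  | app t u ih₁ ih₂ =>
    rintro c ⟨a, ha, b, hb, h₁, h₂, h₃⟩
    exact ⟨a, ha, b, hb, ih₁ ht.1 h₁, ih₂ ht.2 h₂, h₃⟩
  | var i => intro c e; change K.Eq w (ρ' i) c; rw [← H i ht]; exact e
  | _ => exact fun e => e

theorem ev_mem (h : Pca w P) {ρ : ℕ → ℕ} (hρ : ∀ i, K.Mem w (ρ i) P.A) {t : Tm} :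
    ∀ {c}, Ev w P ρ t c → K.Mem w c P.A := by
  induction t with
  | app t u ih₁ ih₂ =>
    rintro c ⟨a, ha, b, hb, h₁, h₂, h₃⟩
    exact (h.app_mem h₃).2.2
  | zero => exact h.isZero_mem
  | var i => exact fun e => mem_of_eq e (hρ i)
  | k => exact fun e => mem_of_eq e h.k_mem
  | s => exact fun e => mem_of_eq e h.s_mem
  | succ => exact fun e => mem_of_eq e h.succ_mem
  | pred => exact fun e => mem_of_eq e h.pred_mem
  | d => exact fun e => mem_of_eq e h.d_mem

theorem ev_app_of (h : Pca w P) {ρ : ℕ → ℕ} {t u : Tm} (ht : Ev w P ρ t a) (hu : Ev w P ρ u b) :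
    Ev w P ρ (.app t u) c ↔ App w P a b c := by
  rw [h.ev_app]
  constructor
  · rintro ⟨a', b', h₁, h₂, h₃⟩
    exact h.app_congr (h.ev_unique h₁ ht) (h.ev_unique h₂ hu)
      (K.eq_refl (K.mem_ex (h.app_mem h₃).2.2).1) h₃
  · exact fun H => ⟨a, b, ht, hu, H⟩

theorem ev_lam_const (h : Pca w P) {ρ : ℕ → ℕ} {t : Tm} (ha : K.Mem w a P.A)
    (ht : Ev w P ρ t a) : ∃ f, Ev w P ρ (.app .k t) f ∧
      ∀ b c, K.Mem w b P.A → (App w P f b c ↔ K.Eq w a c) := by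
  obtain ⟨f, hf, hf'⟩ := h.k_app ha
  refine ⟨f, (h.ev_app_of (t := .k) (K.eq_refl (K.mem_ex h.k_mem).1) ht).2 hf,
    fun b c hb => ⟨fun H => h.app_unique (hf' b hb) H, fun e => ?_⟩⟩
  exact h.app_congr (K.eq_refl (K.mem_ex (h.app_mem hf).2.2).1) (K.eq_refl (K.mem_ex hb).1) e
    (hf' b hb)

/-- By induction on `t`. Abstraction is pushed through all applications, so only `k a` and `s a b`
have to be defined and the abstraction has a value even where `t` has none. The equivalence in the
conclusion records the definedness of `t` exactly. -/
theorem ev_lam (h : Pca w P) {ρ : ℕ → ℕ} (hρ : ∀ i, K.Mem w (ρ i) P.A) (x : ℕ) (t : Tm) :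
    ∃ f, Ev w P ρ (t.lam x) f ∧ ∀ b c, K.Mem w b P.A →
      (App w P f b c ↔ Ev w P (Function.update ρ x b) t c) := by
  have refl : ∀ {x}, K.Mem w x P.A → K.Eq w x x := fun hx => K.eq_refl (K.mem_ex hx).1
  induction t with
  | var i =>
    by_cases hi : i = x
    · obtain ⟨f, hf, -⟩ := h.k_app h.k_mem
      obtain ⟨f, g, hf, hg⟩ := h.s_app h.k_mem h.k_mem
      refine ⟨g, ?_, fun b c hb => ?_⟩
      · rw [Tm.lam, if_pos hi]
        exact (h.ev_app_of (u := .k) ((h.ev_app_of (t := .s) (u := .k) (refl h.s_mem)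
          (refl h.k_mem)).2 hf) (refl h.k_mem)).2 hg
      · rw [h.app_of_s hf hg hb]
        obtain ⟨f', hf', H⟩ := h.k_app hb
        have hf'm := (h.app_mem hf').2.2
        subst hi
        simp only [Ev, Function.update_self]
        constructor
        · rintro ⟨y, z, h₁, h₂, h₃⟩
          have e₁ := h.app_unique h₁ hf'
          have e₂ := h.app_unique h₂ hf'
          exact h.app_unique (H f' hf'm) (h.app_congr e₁ e₂ (refl (h.app_mem h₃).2.2) h₃)
        · exact fun e => ⟨f', f', hf', hf', h.app_congr (refl hf'm) (refl hf'm) e (H f' hf'm)⟩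
    · rw [Tm.lam, if_neg hi]
      simp only [Ev, Function.update_of_ne hi]
      exact h.ev_lam_const (t := .var i) (hρ i) (refl (hρ i))
  | app t u ih₁ ih₂ =>
    obtain ⟨F, hF, HF⟩ := ih₁
    obtain ⟨G, hG, HG⟩ := ih₂
    obtain ⟨f, g, hf, hg⟩ := h.s_app (h.ev_mem hρ hF) (h.ev_mem hρ hG)
    refine ⟨g, (h.ev_app_of ((h.ev_app_of (t := .s) (refl h.s_mem) hF).2 hf) hG).2 hg, fun b c hb => ?_⟩
    rw [h.app_of_s hf hg hb, h.ev_app]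
    exact exists_congr fun y => exists_congr fun z =>
      and_congr (HF b y hb) (and_congr (HG b z hb) Iff.rfl)
  | zero =>
    obtain ⟨z, -, hz, -⟩ := h.exists_zero_one
    obtain ⟨f, hf, H⟩ := h.ev_lam_const (ρ := ρ) (t := .zero) (h.isZero_mem hz) hz
    exact ⟨f, hf, fun b c hb => (H b c hb).trans
      ⟨fun e => isZero_congr hz e, fun hc => h.isZero_unique hz hc⟩⟩
  | k => exact h.ev_lam_const (t := .k) h.k_mem (refl h.k_mem)
  | s => exact h.ev_lam_const (t := .s) h.s_mem (refl h.s_mem)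
  | succ => exact h.ev_lam_const (t := .succ) h.succ_mem (refl h.succ_mem)
  | pred => exact h.ev_lam_const (t := .pred) h.pred_mem (refl h.pred_mem)
  | d => exact h.ev_lam_const (t := .d) h.d_mem (refl h.d_mem)

theorem app_ev_lam (h : Pca w P) {ρ : ℕ → ℕ} (hρ : ∀ i, K.Mem w (ρ i) P.A) {x : ℕ} {t : Tm}
    (hf : Ev w P ρ (t.lam x) f) (hb : K.Mem w b P.A) :
    App w P f b c ↔ Ev w P (Function.update ρ x b) t c := by
  obtain ⟨f', hf', H⟩ := h.ev_lam hρ x t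
  rw [← H b c hb]
  have e := h.ev_unique hf hf'
  have eb := K.eq_refl (K.mem_ex hb).1
  exact ⟨fun H => h.app_congr e eb (K.eq_refl (K.mem_ex (h.app_mem H).2.2).1) H,
    fun H => h.app_congr (K.eq_symm e) eb (K.eq_refl (K.mem_ex (h.app_mem H).2.2).1) H⟩

theorem update_mem {ρ : ℕ → ℕ} (hρ : ∀ i, K.Mem w (ρ i) P.A) (x : ℕ) (hb : K.Mem w b P.A) :
    ∀ i, K.Mem w (Function.update ρ x b i) P.A := by
  intro i
  by_cases hi : i = x
  · subst hi; simpa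
  · simpa [hi] using hρ i

theorem ev_beta (h : Pca w P) {ρ : ℕ → ℕ} (hρ : ∀ i, K.Mem w (ρ i) P.A) {x : ℕ} {t u : Tm}
    (hu : Ev w P ρ u b) :
    Ev w P ρ (.app (t.lam x) u) c ↔ Ev w P (Function.update ρ x b) t c := by
  obtain ⟨f, hf, H⟩ := h.ev_lam hρ x t
  rw [h.ev_app_of hf hu, H b c (h.ev_mem hρ hu)]

end Pca

end KripkeModel

namespace KripkeModel

variable {K : KripkeModel} {w w' : K.World} {P : Par}

/-! ## Pairs of values -/

/-- The value of `p a`, for a closed term `p`. -/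
def Proj (w : K.World) (P : Par) (p : Tm) (a c : ℕ) : Prop :=
  Ev w P (fun _ => a) (.app p (.var 0)) c

/-- `Φ` holds of the values of `p a` and `p a'`. -/
def OnProj (w : K.World) (P : Par) (p : Tm) (Φ : ℕ → ℕ → Prop) (a a' : ℕ) : Prop :=
  ∃ c c', Proj w P p a c ∧ Proj w P p a' c' ∧ Φ c c'

/-- `Φ` holds of the values of `a b` and `a' b'`. -/
def OnApp (w : K.World) (P : Par) (a a' b b' : ℕ) (Φ : ℕ → ℕ → Prop) : Prop :=
  ∃ c c', App w P a b c ∧ App w P a' b' c' ∧ Φ c c'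

/-- `Φ` holds of the values of the term `t` in the environments `ρ` and `ρ'`. -/
def OnEv (w : K.World) (P : Par) (ρ ρ' : ℕ → ℕ) (t : Tm) (Φ : ℕ → ℕ → Prop) : Prop :=
  ∃ c c', Ev w P ρ t c ∧ Ev w P ρ' t c' ∧ Φ c c'

theorem OnProj.imp {p : Tm} {Φ Ψ : ℕ → ℕ → Prop} {a a' : ℕ} (h : OnProj w P p Φ a a')
    (H : ∀ c c', Φ c c' → Ψ c c') : OnProj w P p Ψ a a' := by
  obtain ⟨c, c', h₁, h₂, h₃⟩ := h
  exact ⟨c, c', h₁, h₂, H _ _ h₃⟩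

theorem OnApp.imp {Φ Ψ : ℕ → ℕ → Prop} {a a' b b' : ℕ} (h : OnApp w P a a' b b' Φ)
    (H : ∀ c c', Φ c c' → Ψ c c') : OnApp w P a a' b b' Ψ := by
  obtain ⟨c, c', h₁, h₂, h₃⟩ := h
  exact ⟨c, c', h₁, h₂, H _ _ h₃⟩

theorem OnEv.imp {ρ ρ' : ℕ → ℕ} {t : Tm} {Φ Ψ : ℕ → ℕ → Prop} (h : OnEv w P ρ ρ' t Φ)
    (H : ∀ c c', Φ c c' → Ψ c c') : OnEv w P ρ ρ' t Ψ := by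
  obtain ⟨c, c', h₁, h₂, h₃⟩ := h
  exact ⟨c, c', h₁, h₂, H _ _ h₃⟩

theorem Proj.mono {p : Tm} {a c : ℕ} (h : Proj w P p a c) (H : w ≤ w') : Proj w' P p a c :=
  Pca.ev_mono H h

/-- The term with the projections `t` and `u`, where each projection is defined as soon as the
respective term is.  The variables `n` and `n + 1` must not occur in `t` and `u`. -/
def lazyPair (n : ℕ) (t u : Tm) : Tm :=
  .lam n (.app (.app (.app (.var n) (t.lam (n + 1))) (u.lam (n + 1))) .k)

theorem lazyPair_below {n : ℕ} {t u : Tm} (ht : t.Below n) (hu : u.Below n) :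
    (lazyPair n t u).Below n := by
  refine Tm.Below.lam ⟨⟨⟨Nat.lt_succ_self n, ?_⟩, ?_⟩, trivial⟩
  · exact Tm.Below.lam (ht.mono (by omega))
  · exact Tm.Below.lam (hu.mono (by omega))

namespace Pca

variable {a b c f g r : ℕ} {ρ ρ' : ℕ → ℕ} {t u : Tm} {p : Tm} {Φ Ψ : ℕ → ℕ → Prop}

theorem refl_of_mem {x y : ℕ} (hx : K.Mem w x y) : K.Eq w x x := K.eq_refl (K.mem_ex hx).1

theorem ev_closed (hp : p.Closed) (H : Ev w P ρ p c) : Ev w P ρ' p c :=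
  ev_agree (Tm.below_zero_iff.2 hp) (by simp) H

theorem proj_mem (h : Pca w P) (H : Proj w P p a c) : K.Mem w a P.A ∧ K.Mem w c P.A := by
  obtain ⟨a', b', -, h₁, h₂⟩ := h.ev_app.1 H
  exact ⟨mem_of_eq (K.eq_symm h₁) (h.app_mem h₂).2.1, (h.app_mem h₂).2.2⟩

theorem ev_proj (h : Pca w P) (hp : p.Closed) (ht : Ev w P ρ t a) :
    Ev w P ρ (.app p t) c ↔ Proj w P p a c := by
  rw [Proj, h.ev_app, h.ev_app]
  constructor
  · rintro ⟨f, a', h₁, h₂, h₃⟩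
    exact ⟨f, a', ev_closed hp h₁, h.ev_unique ht h₂, h₃⟩
  · rintro ⟨f, a', h₁, h₂, h₃⟩
    exact ⟨f, a', ev_closed hp h₁, h.ev_congr ht h₂, h₃⟩

theorem proj_p₀ (h : Pca w P) (ha : K.Mem w a P.A) : Proj w P .p₀ a c ↔ App w P a P.k c := by
  have e : Ev w P (fun _ => a) (.var 0) a := refl_of_mem ha
  refine (h.ev_beta (x := 0) (fun _ => ha) e).trans ?_
  exact h.ev_app_of (t := .var 0) (u := .k) (by simpa [Ev] using refl_of_mem ha)
    (refl_of_mem h.k_mem)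

theorem proj_p₁ (h : Pca w P) (ha : K.Mem w a P.A) {k' : ℕ}
    (hk : Ev w P (fun _ => a) (.lam 0 (.lam 1 (.var 1))) k') :
    Proj w P .p₁ a c ↔ App w P a k' c := by
  have e : Ev w P (fun _ => a) (.var 0) a := refl_of_mem ha
  refine (h.ev_beta (x := 0) (fun _ => ha) e).trans ?_
  refine h.ev_app_of (t := .var 0) (by simpa [Ev] using refl_of_mem ha) ?_
  exact ev_closed (by simp [Tm.lam, Tm.Closed]) hk

/-- A projection passes `k` or `λ x y. y` to the value `q`. This selects one of the two abstractions
over the dummy variable `n + 1`, and the final `k` is the dummy argument that runs it; the other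
body is never evaluated. So one component may be undefined, whereas `ev_pair` needs values of both.
-/
theorem ev_lazyPair (h : Pca w P) (hρ : ∀ i, K.Mem w (ρ i) P.A) {n : ℕ} (ht : t.Below n)
    (hu : u.Below n) : ∃ q, Ev w P ρ (lazyPair n t u) q ∧
      (∀ c, Ev w P ρ t c → Proj w P .p₀ q c) ∧ (∀ c, Ev w P ρ u c → Proj w P .p₁ q c) := by
  obtain ⟨q, hq, H⟩ := h.ev_lam hρ n
    (.app (.app (.app (.var n) (t.lam (n + 1))) (u.lam (n + 1))) .k)
  have hqm := h.ev_mem hρ hq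
  have hk : K.Eq w P.k P.k := refl_of_mem h.k_mem
  have agree : ∀ {v : Tm} {x y c : ℕ}, v.Below n → Ev w P ρ v c →
      Ev w P (Function.update (Function.update ρ n x) (n + 1) y) v c := by
    intro v x y c hv
    refine ev_agree hv fun i hi => ?_
    rw [Function.update_of_ne (by omega), Function.update_of_ne (by omega)]
  refine ⟨q, hq, fun c hc => ?_, fun c hc => ?_⟩
  · rw [h.proj_p₀ hqm, H _ _ h.k_mem]
    have hρ' := update_mem hρ n h.k_mem
    obtain ⟨f, hf, Hf⟩ := h.ev_lam hρ' (n + 1) t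
    obtain ⟨g, hg, Hg⟩ := h.ev_lam hρ' (n + 1) u
    have hfm := h.ev_mem hρ' hf
    have hgm := h.ev_mem hρ' hg
    obtain ⟨x, hx, hx'⟩ := h.k_app hfm
    have hv : Ev w P (Function.update ρ n P.k) (.var n) P.k := by simpa [Ev] using hk
    refine (h.ev_app_of (u := .k) ((h.ev_app_of ((h.ev_app_of hv hf).2 hx) hg).2 (hx' g hgm))
      hk).2 ((Hf _ _ h.k_mem).2 (agree ht hc))
  · obtain ⟨k', hk', Hk⟩ := h.ev_lam (ρ := fun _ => q) (fun _ => hqm) 0 (.lam 1 (.var 1))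
    have hk'm := h.ev_mem (fun _ => hqm) hk'
    rw [h.proj_p₁ hqm hk', H _ _ hk'm]
    have hρ' := update_mem hρ n hk'm
    obtain ⟨f, hf, Hf⟩ := h.ev_lam hρ' (n + 1) t
    obtain ⟨g, hg, Hg⟩ := h.ev_lam hρ' (n + 1) u
    have hfm := h.ev_mem hρ' hf
    have hgm := h.ev_mem hρ' hg
    have hv : Ev w P (Function.update ρ n k') (.var n) k' := by simpa [Ev] using refl_of_mem hk'm
    obtain ⟨x, hx, Hx⟩ := h.ev_lam (update_mem (fun _ => hqm) 0 hfm) 1 (.var 1)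
    have h₁ : App w P k' f x := (Hk f x hfm).2 hx
    have h₂ : App w P x g g := (Hx g g hgm).2 (by simpa [Ev] using refl_of_mem hgm)
    exact (h.ev_app_of (u := .k) ((h.ev_app_of ((h.ev_app_of hv hf).2 h₁) hg).2 h₂)
      hk).2 ((Hg _ _ h.k_mem).2 (agree hu hc))

theorem ev_pair (h : Pca w P) (hρ : ∀ i, K.Mem w (ρ i) P.A) (ht : Ev w P ρ t a)
    (hu : Ev w P ρ u b) :
    ∃ q, Ev w P ρ (.pair t u) q ∧ Proj w P .p₀ q a ∧ Proj w P .p₁ q b := by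
  have ham := h.ev_mem hρ ht
  have hbm := h.ev_mem hρ hu
  obtain ⟨f, hf, Hf⟩ := h.ev_lam hρ 0 (.lam 1 (.lam 2 (.app (.app (.var 2) (.var 0)) (.var 1))))
  obtain ⟨g, hg, Hg⟩ := h.ev_lam (update_mem hρ 0 ham) 1
    (.lam 2 (.app (.app (.var 2) (.var 0)) (.var 1)))
  have hρ' := update_mem (update_mem hρ 0 ham) 1 hbm
  obtain ⟨q, hq, Hq⟩ := h.ev_lam hρ' 2 (.app (.app (.var 2) (.var 0)) (.var 1))
  have hqm := h.ev_mem hρ' hq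
  have hv : ∀ {z}, K.Mem w z P.A → ∀ {x y}, App w P z a x → App w P x b y → App w P q z y := by
    intro z hz x y h₁ h₂
    refine (Hq z y hz).2 ((h.ev_app_of (t := .app (.var 2) (.var 0)) (u := .var 1)
      ((h.ev_app_of (t := .var 2) (u := .var 0) (a := z) (b := a) ?_ ?_).2 h₁)
      (b := b) ?_).2 h₂)
    · simpa [Ev] using refl_of_mem hz
    · simpa [Ev, Function.update] using refl_of_mem ham
    · simpa [Ev, Function.update] using refl_of_mem hbm
  refine ⟨q, (h.ev_app_of ((h.ev_app_of hf ht).2 ((Hf a g ham).2 hg)) hu).2 ((Hg b q hbm).2 hq),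
    ?_, ?_⟩
  · obtain ⟨x, hx, hx'⟩ := h.k_app ham
    exact (h.proj_p₀ hqm).2 (hv h.k_mem hx (hx' b hbm))
  · obtain ⟨k', hk', Hk⟩ := h.ev_lam (ρ := fun _ => q) (fun _ => hqm) 0 (.lam 1 (.var 1))
    have hk'm := h.ev_mem (fun _ => hqm) hk'
    obtain ⟨x, hx, Hx⟩ := h.ev_lam (update_mem (fun _ => hqm) 0 ham) 1 (.var 1)
    have h₁ : App w P k' a x := (Hk a x ham).2 hx
    have h₂ : App w P x b b := (Hx b b hbm).2 (by simpa [Ev] using refl_of_mem hbm)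
    exact (h.proj_p₁ hqm hk').2 (hv hk'm h₁ h₂)

/-! ## Terms evaluated in two environments -/

theorem onEv_var {i : ℕ} (hi : K.Ex w (ρ i)) (hi' : K.Ex w (ρ' i)) (H : Φ (ρ i) (ρ' i)) :
    OnEv w P ρ ρ' (.var i) Φ := ⟨ρ i, ρ' i, K.eq_refl hi, K.eq_refl hi', H⟩

theorem onEv_app (h : Pca w P) (H : OnEv w P ρ ρ' t fun f f' =>
    OnEv w P ρ ρ' u fun c c' => OnApp w P f f' c c' Φ) : OnEv w P ρ ρ' (.app t u) Φ := by
  obtain ⟨f, f', h₁, h₂, c, c', h₃, h₄, r, r', h₅, h₆, H⟩ := H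
  exact ⟨r, r', (h.ev_app_of h₁ h₃).2 h₅, (h.ev_app_of h₂ h₄).2 h₆, H⟩

theorem onEv_proj (h : Pca w P) (hp : p.Closed) (H : OnEv w P ρ ρ' t (OnProj w P p Φ)) :
    OnEv w P ρ ρ' (.app p t) Φ := by
  obtain ⟨f, f', h₁, h₂, c, c', h₃, h₄, H⟩ := H
  exact ⟨c, c', (h.ev_proj hp h₁).2 h₃, (h.ev_proj hp h₂).2 h₄, H⟩

theorem onEv_p₀ (h : Pca w P) (H : OnEv w P ρ ρ' t (OnProj w P .p₀ Φ)) :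
    OnEv w P ρ ρ' (.app .p₀ t) Φ := h.onEv_proj Tm.p₀_closed H

theorem onEv_p₁ (h : Pca w P) (H : OnEv w P ρ ρ' t (OnProj w P .p₁ Φ)) :
    OnEv w P ρ ρ' (.app .p₁ t) Φ := h.onEv_proj Tm.p₁_closed H

theorem onEv_pair (h : Pca w P) (hρ : ∀ i, K.Mem w (ρ i) P.A) (hρ' : ∀ i, K.Mem w (ρ' i) P.A)
    (H₁ : OnEv w P ρ ρ' t Φ) (H₂ : OnEv w P ρ ρ' u Ψ) : OnEv w P ρ ρ' (.pair t u)
      fun q q' => OnProj w P .p₀ Φ q q' ∧ OnProj w P .p₁ Ψ q q' := by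
  obtain ⟨c, c', h₁, h₂, H₁⟩ := H₁
  obtain ⟨d, d', h₃, h₄, H₂⟩ := H₂
  obtain ⟨q, hq, h₅, h₆⟩ := h.ev_pair hρ h₁ h₃
  obtain ⟨q', hq', h₅', h₆'⟩ := h.ev_pair hρ' h₂ h₄
  exact ⟨q, q', hq, hq', ⟨c, c', h₅, h₅', H₁⟩, ⟨d, d', h₆, h₆', H₂⟩⟩

theorem onEv_lazyPair (h : Pca w P) (hρ : ∀ i, K.Mem w (ρ i) P.A)
    (hρ' : ∀ i, K.Mem w (ρ' i) P.A) {n : ℕ} (ht : t.Below n) (hu : u.Below n) :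
    OnEv w P ρ ρ' (lazyPair n t u) fun q q' =>
      (∀ Φ, OnEv w P ρ ρ' t Φ → OnProj w P .p₀ Φ q q') ∧
      (∀ Φ, OnEv w P ρ ρ' u Φ → OnProj w P .p₁ Φ q q') := by
  obtain ⟨q, hq, h₁, h₂⟩ := h.ev_lazyPair hρ ht hu
  obtain ⟨q', hq', h₁', h₂'⟩ := h.ev_lazyPair hρ' ht hu
  refine ⟨q, q', hq, hq', ?_, ?_⟩
  · rintro Φ ⟨c, c', hc, hc', H⟩
    exact ⟨c, c', h₁ c hc, h₁' c' hc', H⟩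
  · rintro Φ ⟨c, c', hc, hc', H⟩
    exact ⟨c, c', h₂ c hc, h₂' c' hc', H⟩

/-- The related values work at all later worlds, as the clauses for implication, bounded universal
quantification and equality require. -/
theorem onEv_lam (h : Pca w P) (hρ : ∀ i, K.Mem w (ρ i) P.A)
    (hρ' : ∀ i, K.Mem w (ρ' i) P.A) (x : ℕ) (t : Tm) :
    OnEv w P ρ ρ' (t.lam x) fun f f' => ∀ w', w ≤ w' → ∀ c c' Φ, K.Mem w' c P.A →
      K.Mem w' c' P.A → OnEv w' P (Function.update ρ x c) (Function.update ρ' x c') t Φ →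
      OnApp w' P f f' c c' Φ := by
  obtain ⟨f, hf, -⟩ := h.ev_lam hρ x t
  obtain ⟨f', hf', -⟩ := h.ev_lam hρ' x t
  refine ⟨f, f', hf, hf', fun w' hw c c' Φ hc hc' ⟨r, r', hr, hr', H⟩ => ?_⟩
  have h' := h.mono hw
  exact ⟨r, r', (h'.app_ev_lam (fun i => K.mem_mono hw (hρ i)) (ev_mono hw hf) hc).2 hr,
    (h'.app_ev_lam (fun i => K.mem_mono hw (hρ' i)) (ev_mono hw hf') hc').2 hr', H⟩

theorem onEv_beta (h : Pca w P) (hρ : ∀ i, K.Mem w (ρ i) P.A)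
    (hρ' : ∀ i, K.Mem w (ρ' i) P.A) {x : ℕ} (H : OnEv w P ρ ρ' u fun c c' =>
      OnEv w P (Function.update ρ x c) (Function.update ρ' x c') t Φ) :
    OnEv w P ρ ρ' (.app (t.lam x) u) Φ := by
  obtain ⟨c, c', h₁, h₂, r, r', h₃, h₄, H⟩ := H
  exact ⟨r, r', (h.ev_beta hρ h₁).2 h₃, (h.ev_beta hρ' h₂).2 h₄, H⟩

theorem onEv_mem (h : Pca w P) (hρ : ∀ i, K.Mem w (ρ i) P.A) (hρ' : ∀ i, K.Mem w (ρ' i) P.A)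
    (H : OnEv w P ρ ρ' t Φ) :
    OnEv w P ρ ρ' t fun c c' => K.Mem w c P.A ∧ K.Mem w c' P.A ∧ Φ c c' := by
  obtain ⟨c, c', h₁, h₂, H⟩ := H
  exact ⟨c, c', h₁, h₂, h.ev_mem hρ h₁, h.ev_mem hρ' h₂, H⟩

theorem onEv_agree {n : ℕ} {τ τ' : ℕ → ℕ} (ht : t.Below n) (hρ : ∀ i < n, ρ i = τ i)
    (hρ' : ∀ i < n, ρ' i = τ' i) (H : OnEv w P ρ ρ' t Φ) : OnEv w P τ τ' t Φ := by
  obtain ⟨c, c', h₁, h₂, H⟩ := H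
  exact ⟨c, c', ev_agree ht hρ h₁, ev_agree ht hρ' h₂, H⟩

theorem ev_cases_zero (h : Pca w P) (hρ : ∀ i, K.Mem w (ρ i) P.A) {v : Tm} {z a b : ℕ}
    (hz : IsZero w P z) (ht : Ev w P ρ t z) (hu : Ev w P ρ u a) (hv : Ev w P ρ v b) :
    Ev w P ρ (.cases t u v) a := by
  obtain ⟨z', o, hz', ho, H, -⟩ := h.exists_zero_one
  obtain ⟨f, g, j, h₁, h₂, h₃, h₄⟩ := H a b (h.ev_mem hρ hu) (h.ev_mem hρ hv)
  have ht' : Ev w P ρ t z' := h.ev_congr ht (h.isZero_unique hz hz')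
  exact (h.ev_app_of ((h.ev_app_of ((h.ev_app_of ((h.ev_app_of (t := .d) (u := .zero)
    (refl_of_mem h.d_mem) hz').2 h₁) ht').2 h₂) hu).2 h₃) hv).2 h₄

theorem ev_cases_one (h : Pca w P) (hρ : ∀ i, K.Mem w (ρ i) P.A) {v : Tm} {o a b : ℕ}
    {τ : ℕ → ℕ} (ho : Ev w P τ .one o) (ht : Ev w P ρ t o) (hu : Ev w P ρ u a)
    (hv : Ev w P ρ v b) : Ev w P ρ (.cases t u v) b := by
  obtain ⟨z', o', hz', ho', -, H⟩ := h.exists_zero_one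
  obtain ⟨f, g, j, h₁, h₂, h₃, h₄⟩ := H a b (h.ev_mem hρ hu) (h.ev_mem hρ hv)
  have e : Ev w P τ .one o' :=
    (h.ev_app_of (t := .succ) (u := .zero) (refl_of_mem h.succ_mem) hz').2 ho'
  have ht' : Ev w P ρ t o' := h.ev_congr ht (h.ev_unique ho e)
  exact (h.ev_app_of ((h.ev_app_of ((h.ev_app_of ((h.ev_app_of (t := .d) (u := .zero)
    (refl_of_mem h.d_mem) hz').2 h₁) ht').2 h₂) hu).2 h₃) hv).2 h₄

theorem exists_ev_zero (h : Pca w P) : ∃ z, IsZero w P z := by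
  obtain ⟨z, -, hz, -⟩ := h.exists_zero_one
  exact ⟨z, hz⟩

theorem exists_ev_one (h : Pca w P) (ρ : ℕ → ℕ) : ∃ o, Ev w P ρ .one o := by
  obtain ⟨z, o, hz, ho, -⟩ := h.exists_zero_one
  exact ⟨o, (h.ev_app_of (t := .succ) (u := .zero) (refl_of_mem h.succ_mem) hz).2 ho⟩

end Pca

end KripkeModel

namespace KripkeModel

variable {K : KripkeModel} {w w' : K.World} {P : Par}

/-! ## The realizability universe -/

def InV (w : K.World) (P : Par) (x : ℕ) : Prop :=
  ∃ t, K.Ex w t ∧ K.Mem w x t ∧ ∀ w', w ≤ w' → ∀ y, K.Mem w' y t → ∀ w'', w' ≤ w'' →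
    ∀ p, K.Mem w'' p y → ∃ c, K.Mem w'' c P.A ∧ ∃ d, K.Mem w'' d P.A ∧ ∃ z, K.Mem w'' z t ∧
      IsTriple w'' p c d z

theorem InV.mono {x : ℕ} (h : InV w P x) (H : w ≤ w') : InV w' P x := by
  obtain ⟨t, h₁, h₂, h₃⟩ := h
  exact ⟨t, K.ex_mono H h₁, K.mem_mono H h₂, fun w'' hw => h₃ w'' (H.trans hw)⟩

theorem InV.ex {x : ℕ} (h : InV w P x) : K.Ex w x := by
  obtain ⟨t, h₁, h₂, h₃⟩ := h
  exact (K.mem_ex h₂).1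

/-- The set `t` that witnesses membership of `x` in the universe also witnesses it for the third
components of the elements of `x`. -/
theorem InV.exists_triple {x p : ℕ} (h : InV w P x) (hp : K.Mem w p x) :
    ∃ c d z, K.Mem w c P.A ∧ K.Mem w d P.A ∧ InV w P z ∧ IsTriple w p c d z := by
  obtain ⟨t, h₁, h₂, h₃⟩ := h
  obtain ⟨c, hc, d, hd, z, hz, H⟩ := h₃ w le_rfl x h₂ w le_rfl p hp
  exact ⟨c, d, z, hc, hd, ⟨t, h₁, hz, h₃⟩, H⟩

theorem InV.congr {x y : ℕ} (h : InV w P x) (H : K.Eq w x y) : InV w P y := by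
  obtain ⟨t, h₁, h₂, h₃⟩ := h
  exact ⟨t, h₁, mem_of_eq H h₂, h₃⟩

theorem InV.of_tripleMem {x c d z : ℕ} (h : InV w P x) (H : TripleMem w c d z x) :
    K.Mem w c P.A ∧ K.Mem w d P.A ∧ InV w P z := by
  obtain ⟨p, hp, ht⟩ := H
  obtain ⟨c', d', z', h₁, h₂, h₃, h₄⟩ := h.exists_triple hp
  obtain ⟨e₁, e₂, e₃⟩ := h₄.inj ht
  exact ⟨mem_of_eq e₁ h₁, mem_of_eq e₂ h₂, h₃.congr e₃⟩

/-- The empty set, witnessed by its singleton. An inhabitant is needed because a universally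
quantified formula must have a defined realizer. -/
theorem Pca.exists_inV (h : Pca w P) : ∃ x, InV w P x := by
  obtain ⟨n, hn, hn'⟩ := h.czf.empty (h.env 0)
  obtain ⟨t, ht, ht'⟩ := h.czf.upair hn hn
  refine ⟨n, t, ht, (ht' w le_rfl n).2 (Or.inl (K.eq_refl hn)), ?_⟩
  intro w₁ h₁ y hy w₂ h₂ p hp
  have e : K.Eq w₂ y n := K.eq_mono h₂ (((ht' w₁ h₁ y).1 hy).elim id id)
  exact (hn' w₂ (h₁.trans h₂) p (K.mem_congr (K.eq_refl (K.mem_ex hp).1) e hp)).elim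

/-! ## The clauses for membership and equality -/

/-- The clause for `a = b ⊩ x ∈ y`, with a relation `Q` put for realized equality. -/
def MemClause (w : K.World) (P : Par) (Q : ℕ → ℕ → ℕ → ℕ → Prop) (a b x y : ℕ) : Prop :=
  ∃ z, OnProj w P .p₀ (fun c d => TripleMem w c d z y) a b ∧
    OnProj w P .p₁ (fun c d => Q c d x z) a b

/-- One half of the clause for `a = b ⊩ x = y`, with a relation `Q` put for realized equality. -/
def SubClause (w : K.World) (P : Par) (p : Tm) (Q : K.World → ℕ → ℕ → ℕ → ℕ → Prop)
    (a b x y : ℕ) : Prop :=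
  ∀ w', w ≤ w' → ∀ c d z, K.Mem w' c P.A → K.Mem w' d P.A → TripleMem w' c d z x →
    OnApp w' P a b c d (OnProj w' P p fun r s => MemClause w' P (Q w') r s z y)

/-- The clause for `a = b ⊩ x = y`, with a relation `Q` put for realized equality. -/
def EqClause (w : K.World) (P : Par) (Q : K.World → ℕ → ℕ → ℕ → ℕ → Prop)
    (a b x y : ℕ) : Prop :=
  SubClause w P .p₀ Q a b x y ∧ SubClause w P .p₁ Q a b y x

def QuadRel (R : ℕ) (w : K.World) (a b x y : ℕ) : Prop := QuadMem w a b x y R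

/-- Each quadruple in `R` satisfies the clause for realized equality with respect to `R`. -/
def Closed (w : K.World) (P : Par) (R : ℕ) : Prop :=
  ∀ w', w ≤ w' → ∀ a b x y, K.Mem w' a P.A → K.Mem w' b P.A → QuadMem w' a b x y R →
    EqClause w' P (QuadRel R) a b x y

def RlzEq (w : K.World) (P : Par) (a b x y : ℕ) : Prop :=
  ∃ R, K.Ex w R ∧ QuadMem w a b x y R ∧ Closed w P R

theorem MemClause.imp {Q Q' : ℕ → ℕ → ℕ → ℕ → Prop} {a b x y : ℕ} (h : MemClause w P Q a b x y)
    (H : ∀ c d x z, Q c d x z → Q' c d x z) : MemClause w P Q' a b x y := by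
  obtain ⟨z, h₁, h₂⟩ := h
  exact ⟨z, h₁, h₂.imp fun c d => H c d x z⟩

theorem SubClause.imp {p : Tm} {Q Q' : K.World → ℕ → ℕ → ℕ → ℕ → Prop} {a b x y : ℕ}
    (h : SubClause w P p Q a b x y)
    (H : ∀ w', w ≤ w' → ∀ c d x z, Q w' c d x z → Q' w' c d x z) :
    SubClause w P p Q' a b x y :=
  fun w' hw c d z hc hd ht => (h w' hw c d z hc hd ht).imp fun _ _ h' =>
    h'.imp fun _ _ h'' => h''.imp (H w' hw)

theorem EqClause.imp {Q Q' : K.World → ℕ → ℕ → ℕ → ℕ → Prop} {a b x y : ℕ}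
    (h : EqClause w P Q a b x y)
    (H : ∀ w', w ≤ w' → ∀ c d x z, Q w' c d x z → Q' w' c d x z) :
    EqClause w P Q' a b x y :=
  ⟨h.1.imp H, h.2.imp H⟩

theorem Closed.mono {R : ℕ} (h : Closed w P R) (H : w ≤ w') : Closed w' P R :=
  fun w'' hw => h w'' (H.trans hw)

theorem RlzEq.mono {a b x y : ℕ} (h : RlzEq w P a b x y) (H : w ≤ w') : RlzEq w' P a b x y := by
  obtain ⟨R, h₁, h₂, h₃⟩ := h
  exact ⟨R, K.ex_mono H h₁, h₂.mono H, h₃.mono H⟩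

theorem RlzEq.congr {a b x y a' b' x' y' : ℕ} (h : RlzEq w P a b x y) (ha : K.Eq w a a')
    (hb : K.Eq w b b') (hx : K.Eq w x x') (hy : K.Eq w y y') : RlzEq w P a' b' x' y' := by
  obtain ⟨R, h₁, h₂, h₃⟩ := h
  exact ⟨R, h₁, h₂.congr ha hb hx hy (K.eq_refl h₁), h₃⟩

namespace Pca

variable {σ : ℕ → ℕ}

theorem forces_sub₂ {t u : Tm} {φ : Fml} :
    Forces w (P.sub₂ t u φ) σ ↔ ∃ a, K.Mem w a (σ P.A) ∧ ∃ b, K.Mem w b (σ P.A) ∧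
      Ev w (P.map σ) σ t a ∧ Ev w (P.map σ) σ u b ∧ Forces w φ (scons b (scons a σ)) :=
  exists_congr fun _ => and_congr Iff.rfl (exists_congr fun _ => and_congr Iff.rfl
    (and_congr forces_eval (and_congr forces_eval Iff.rfl)))

theorem forces_sub₂_proj (h : Pca w (P.map σ)) {p : Tm} (hp : p.Closed) {a b : ℕ} {φ : Fml}
    {Φ : ℕ → ℕ → Prop}
    (hΦ : ∀ c d, K.Mem w c (σ P.A) → K.Mem w d (σ P.A) →
      (Forces w φ (scons d (scons c σ)) ↔ Φ c d)) :
    Forces w (P.sub₂ (.app p (.var a)) (.app p (.var b)) φ) σ ↔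
      OnProj w (P.map σ) p Φ (σ a) (σ b) := by
  have e : ∀ i c, Ev w (P.map σ) σ (.app p (.var i)) c ↔ Proj w (P.map σ) p (σ i) c := by
    intro i c
    have swap : ∀ {ρ ρ' : ℕ → ℕ} {f : ℕ}, Ev w (P.map σ) ρ p f → Ev w (P.map σ) ρ' p f :=
      fun H => ev_closed hp H
    rw [Proj, h.ev_app, h.ev_app]
    exact exists_congr fun f => exists_congr fun a =>
      and_congr ⟨swap, swap⟩ (and_congr Iff.rfl Iff.rfl)
  rw [forces_sub₂]
  constructor
  · rintro ⟨c, hc, d, hd, h₁, h₂, h₃⟩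
    exact ⟨c, d, (e _ _).1 h₁, (e _ _).1 h₂, (hΦ c d hc hd).1 h₃⟩
  · rintro ⟨c, d, h₁, h₂, h₃⟩
    have hc := (h.proj_mem h₁).2
    have hd := (h.proj_mem h₂).2
    exact ⟨c, hc, d, hd, (e _ _).2 h₁, (e _ _).2 h₂, (hΦ c d hc hd).2 h₃⟩

theorem ev_ap (h : Pca w P) {i j c : ℕ} : Ev w P σ (.ap i j) c ↔ App w P (σ i) (σ j) c := by
  rw [Tm.ap, h.ev_app]
  constructor
  · rintro ⟨a, b, h₁, h₂, h₃⟩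
    exact h.app_congr (K.eq_symm h₁) (K.eq_symm h₂) (refl_of_mem (h.app_mem h₃).2.2) h₃
  · exact fun H => ⟨σ i, σ j, refl_of_mem (h.app_mem H).1, refl_of_mem (h.app_mem H).2.1, H⟩

theorem forces_sub₂_ap (h : Pca w (P.map σ)) {a b a' b' : ℕ} {φ : Fml} {Φ : ℕ → ℕ → Prop}
    (hΦ : ∀ c d, K.Mem w c (σ P.A) → K.Mem w d (σ P.A) →
      (Forces w φ (scons d (scons c σ)) ↔ Φ c d)) :
    Forces w (P.sub₂ (.ap a b) (.ap a' b') φ) σ ↔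
      OnApp w (P.map σ) (σ a) (σ a') (σ b) (σ b') Φ := by
  rw [forces_sub₂]
  constructor
  · rintro ⟨c, hc, d, hd, h₁, h₂, h₃⟩
    exact ⟨c, d, h.ev_ap.1 h₁, h.ev_ap.1 h₂, (hΦ c d hc hd).1 h₃⟩
  · rintro ⟨c, d, h₁, h₂, h₃⟩
    have hc := (h.app_mem h₁).2.2
    have hd := (h.app_mem h₂).2.2
    exact ⟨c, hc, d, hd, h.ev_ap.2 h₁, h.ev_ap.2 h₂, (hΦ c d hc hd).2 h₃⟩

theorem forces_sub₂_proj_ap (h : Pca w (P.map σ)) {p : Tm} (hp : p.Closed) {a b a' b' : ℕ}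
    {φ : Fml} {Φ : ℕ → ℕ → Prop}
    (hΦ : ∀ c d, K.Mem w c (σ P.A) → K.Mem w d (σ P.A) →
      (Forces w φ (scons d (scons c σ)) ↔ Φ c d)) :
    Forces w (P.sub₂ (.app p (.ap a b)) (.app p (.ap a' b')) φ) σ ↔
      OnApp w (P.map σ) (σ a) (σ a') (σ b) (σ b') (OnProj w (P.map σ) p Φ) := by
  have e : ∀ i j c, Ev w (P.map σ) σ (.app p (.ap i j)) c ↔
      ∃ f, App w (P.map σ) (σ i) (σ j) f ∧ Proj w (P.map σ) p f c := by
    intro i j c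
    constructor
    · intro H
      obtain ⟨a, f, h₁, h₂, h₃⟩ := h.ev_app.1 H
      exact ⟨f, h.ev_ap.1 h₂, (h.ev_proj hp h₂).1 H⟩
    · rintro ⟨f, h₁, h₂⟩
      exact (h.ev_proj hp (h.ev_ap.2 h₁)).2 h₂
  rw [forces_sub₂]
  constructor
  · rintro ⟨c, hc, d, hd, h₁, h₂, h₃⟩
    obtain ⟨f, h₄, h₅⟩ := (e _ _ _).1 h₁
    obtain ⟨g, h₆, h₇⟩ := (e _ _ _).1 h₂
    exact ⟨f, g, h₄, h₆, c, d, h₅, h₇, (hΦ c d hc hd).1 h₃⟩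
  · rintro ⟨f, g, h₄, h₆, c, d, h₅, h₇, h₃⟩
    have hc := (h.proj_mem h₅).2
    have hd := (h.proj_mem h₇).2
    exact ⟨c, hc, d, hd, (e _ _ _).2 ⟨f, h₄, h₅⟩, (e _ _ _).2 ⟨g, h₆, h₇⟩, (hΦ c d hc hd).2 h₃⟩

theorem forces_memClause (h : Pca w (P.map σ)) {E : ℕ → ℕ → ℕ → ℕ → Fml}
    {Q : ℕ → ℕ → ℕ → ℕ → Prop} {a b x y : ℕ}
    (hE : ∀ c d z, Forces w (E 1 0 (x + 3) 2) (scons d (scons c (scons z σ))) ↔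
      Q c d (σ x) z) :
    Forces w (P.memClause E a b x y) σ ↔ MemClause w (P.map σ) Q (σ a) (σ b) (σ x) (σ y) := by
  have key : ∀ z, (Forces w ((P.shift 1).sub₂ (.fst (a + 1)) (.fst (b + 1))
      (tripleMem 1 0 2 (y + 3))) (scons z σ) ∧
      Forces w ((P.shift 1).sub₂ (.snd (a + 1)) (.snd (b + 1)) (E 1 0 (x + 3) 2)) (scons z σ)) ↔
      (OnProj w (P.map σ) .p₀ (fun c d => TripleMem w c d z (σ y)) (σ a) (σ b) ∧
        OnProj w (P.map σ) .p₁ (fun c d => Q c d (σ x) z) (σ a) (σ b)) := fun z =>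
    and_congr
      (forces_sub₂_proj (P := P.shift 1) (σ := scons z σ) h Tm.p₀_closed fun _ _ _ _ => Iff.rfl)
      (forces_sub₂_proj (P := P.shift 1) (σ := scons z σ) h Tm.p₁_closed fun c d _ _ => hE c d z)
  constructor
  · rintro ⟨z, -, H⟩
    exact ⟨z, (key z).1 H⟩
  · rintro ⟨z, H⟩
    obtain ⟨c, d, -, -, ht⟩ := H.1
    exact ⟨z, ht.ex.2.2.1, (key z).2 H⟩

/-- Bounded quantification over two realizers and a set. -/
theorem forces_ball_ball_all {A : ℕ} {φ ψ : Fml}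
    {F G : K.World → ℕ → ℕ → ℕ → Prop} (hFE : ∀ w a b z, F w a b z → K.Ex w z)
    (hF : ∀ w', w ≤ w' → ∀ a b z, Forces w' φ (scons z (scons b (scons a σ))) ↔ F w' a b z)
    (hG : ∀ w', w ≤ w' → ∀ a b z, Forces w' ψ (scons z (scons b (scons a σ))) ↔ G w' a b z) :
    Forces w (ball A (ball (A + 1) (all (imp φ ψ)))) σ ↔
      ∀ w', w ≤ w' → ∀ a b z, K.Mem w' a (σ A) → K.Mem w' b (σ A) → F w' a b z →
        G w' a b z := by
  constructor
  · intro H w' hw a b z ha hb hf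
    exact (hG w' hw a b z).1 (H w' hw a ha w' le_rfl b hb w' le_rfl z (hFE _ _ _ _ hf)
      w' le_rfl ((hF w' hw a b z).2 hf))
  · intro H w₁ h₁ a ha w₂ h₂ b hb w₃ h₃ z _ w₄ h₄ hf
    have hw : w ≤ w₄ := h₁.trans (h₂.trans (h₃.trans h₄))
    exact (hG w₄ hw a b z).2 (H w₄ hw a b z (K.mem_mono (h₂.trans (h₃.trans h₄)) ha)
      (K.mem_mono (h₃.trans h₄) hb) ((hF w₄ hw a b z).1 hf))

theorem forces_eqClause (h : Pca w (P.map σ)) {R a b x y : ℕ} :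
    Forces w (P.eqClause R a b x y) σ ↔
      EqClause w (P.map σ) (QuadRel (σ R)) (σ a) (σ b) (σ x) (σ y) := by
  refine and_congr ?_ ?_
  · refine forces_ball_ball_all (fun w a b z H => TripleMem.ex H |>.2.2.1)
      (fun _ _ _ _ _ => Iff.rfl) fun w' hw c d z => ?_
    have h' := h.mono hw
    refine forces_sub₂_proj_ap (P := P.shift 3) (σ := scons z (scons d (scons c σ))) h'
      Tm.p₀_closed fun r s _ _ => ?_
    exact forces_memClause (P := P.shift 5)
      (σ := scons s (scons r (scons z (scons d (scons c σ))))) h' fun _ _ _ => Iff.rfl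
  · refine forces_ball_ball_all (fun w a b z H => TripleMem.ex H |>.2.2.1)
      (fun _ _ _ _ _ => Iff.rfl) fun w' hw c d z => ?_
    have h' := h.mono hw
    refine forces_sub₂_proj_ap (P := P.shift 3) (σ := scons z (scons d (scons c σ))) h'
      Tm.p₁_closed fun r s _ _ => ?_
    exact forces_memClause (P := P.shift 5)
      (σ := scons s (scons r (scons z (scons d (scons c σ))))) h' fun _ _ _ => Iff.rfl

/-- Each quadruple in `R` satisfies the clause for realized equality with respect to `R`. -/
def closedFml (P : Par) (R : ℕ) : Fml :=
  ball P.A (ball (P.A + 1) (all (all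
    (imp (quadMem 3 2 1 0 (R + 4)) ((P.shift 4).eqClause (R + 4) 3 2 1 0)))))

theorem forces_closedFml (h : Pca w (P.map σ)) {R : ℕ} :
    Forces w (closedFml P R) σ ↔ Closed w (P.map σ) (σ R) := by
  have key : ∀ w', w ≤ w' → ∀ a b x y, Forces w' ((P.shift 4).eqClause (R + 4) 3 2 1 0)
      (scons y (scons x (scons b (scons a σ)))) ↔
      EqClause w' (P.map σ) (QuadRel (σ R)) a b x y := fun w' hw a b x y =>
    forces_eqClause (P := P.shift 4) (σ := scons y (scons x (scons b (scons a σ)))) (h.mono hw)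
  constructor
  · intro H w' hw a b x y ha hb hq
    exact (key w' hw a b x y).1 (H w' hw a ha w' le_rfl b hb w' le_rfl x hq.ex.2.2.1 w' le_rfl y
      hq.ex.2.2.2.1 w' le_rfl hq)
  · intro H w₁ h₁ a ha w₂ h₂ b hb w₃ h₃ x _ w₄ h₄ y _ w₅ h₅ hq
    have h₂₅ := h₂.trans (h₃.trans (h₄.trans h₅))
    have h₃₅ := h₃.trans (h₄.trans h₅)
    exact (key w₅ (h₁.trans h₂₅) a b x y).2 (H w₅ (h₁.trans h₂₅) a b x y (K.mem_mono h₂₅ ha)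
      (K.mem_mono h₃₅ hb) hq)

theorem forces_rlzEq (h : Pca w (P.map σ)) {a b x y : ℕ} :
    Forces w (P.rlzEq a b x y) σ ↔ RlzEq w (P.map σ) (σ a) (σ b) (σ x) (σ y) := by
  refine exists_congr fun R => and_congr Iff.rfl (and_congr Iff.rfl ?_)
  exact forces_closedFml (P := P.shift 1) (σ := scons R σ) (R := 0) h

theorem forces_rlzMem (h : Pca w (P.map σ)) {a b x y : ℕ} :
    Forces w (P.rlzMem a b x y) σ ↔
      MemClause w (P.map σ) (RlzEq w (P.map σ)) (σ a) (σ b) (σ x) (σ y) :=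
  forces_memClause h fun c d z =>
    forces_rlzEq (P := P.shift 3) (σ := scons d (scons c (scons z σ))) h

end Pca

end KripkeModel

namespace KripkeModel

variable {K : KripkeModel} {w w' : K.World} {P : Par}

/-! ## The recursion equation for realized equality -/

/-- The set `R` is closed, and with `R` for realized equality the element `p` of `X` satisfies its
part of one half of the clause for the equality of `X` and `Y`; the variables are
`R, p, X, a, b, Y`, followed by those of the structure. -/
def halfFml (q : Tm) : Fml :=
  conj (Pca.closedFml (stdPar.shift 6) 0) (bex 6 (bex 7 (ex (conj (isTriple 4 2 1 0)
    ((stdPar.shift 9).sub₂ (.app q (.ap 6 2)) (.app q (.ap 7 1))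
      ((stdPar.shift 11).memClause (fun a' b' x' y' => quadMem a' b' x' y' 8) 1 0 2 10))))))

namespace Pca

theorem forces_halfFml (h : Pca w P) {q : Tm} (hq : q.Closed) {R p X a b Y : ℕ} :
    Forces w (halfFml q)
      (scons R (scons p (scons X (scons a (scons b (scons Y P.env)))))) ↔
      Closed w P R ∧ ∃ c, K.Mem w c P.A ∧ ∃ d, K.Mem w d P.A ∧ ∃ z, K.Ex w z ∧
        IsTriple w p c d z ∧
        OnApp w P a b c d (OnProj w P q fun r s => MemClause w P (QuadRel R w) r s z Y) := by
  refine and_congr (forces_closedFml (P := stdPar.shift 6) h) ?_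
  refine exists_congr fun c => and_congr Iff.rfl (exists_congr fun d => and_congr Iff.rfl
    (exists_congr fun z => and_congr Iff.rfl (and_congr Iff.rfl ?_)))
  refine forces_sub₂_proj_ap (P := stdPar.shift 9) (σ := scons z (scons d (scons c _))) h hq
    fun r s _ _ => ?_
  exact forces_memClause (P := stdPar.shift 11)
    (σ := scons s (scons r (scons z (scons d (scons c _))))) h fun _ _ _ => Iff.rfl

/-- For every element of `X` the hypothesis provides a closed set that witnesses one realized
equality, but no choice of it. Strong Collection gathers such sets in `C`; its second half
guarantees that every member of `C` is closed. The clause is monotone in the relation, so the union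
of `C` is closed, and it contains all witnesses at once. -/
theorem exists_closed_half (h : Pca w P) {q : Tm} (hq : q.Closed) {X Y a b : ℕ}
    (hX : InV w P X) (hY : K.Ex w Y) (ha : K.Mem w a P.A) (hb : K.Mem w b P.A)
    (H : SubClause w P q (fun w' => RlzEq w' P) a b X Y) :
    ∃ U, K.Ex w U ∧ Closed w P U ∧ SubClause w P q (QuadRel U) a b X Y := by
  have hσ : Env w (scons a (scons b (scons Y P.env))) :=
    Env.scons (K.mem_ex ha).1 (Env.scons (K.mem_ex hb).1 (Env.scons hY h.env))
  obtain ⟨C, hC, h₁, h₂⟩ := h.czf.collection (halfFml q) hσ hX.ex (by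
    intro w' hw p hp
    obtain ⟨c, d, z, hc, hd, hz, ht⟩ := (hX.mono hw).exists_triple hp
    obtain ⟨f, g, hf, hg, r, s, hr, hs, z', ht', c', d', hc', hd', R, hR, hR', hR''⟩ :=
      H w' hw c d z hc hd ⟨p, hp, ht⟩
    exact ⟨R, hR, (forces_halfFml (h.mono hw) hq).2 ⟨hR'', c, hc, d, hd, z, hz.ex, ht, f, g, hf,
      hg, r, s, hr, hs, z', ht', c', d', hc', hd', hR'⟩⟩)
  obtain ⟨U, hU, hU'⟩ := h.czf.union hC
  have sub : ∀ {w'}, w ≤ w' → ∀ {R}, K.Mem w' R C → ∀ w'', w' ≤ w'' → ∀ c d x z,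
      QuadRel R w'' c d x z → QuadRel U w'' c d x z := by
    rintro w' hw R hR w'' hw' c d x z ⟨p, hp, hq⟩
    exact ⟨p, (hU' w'' (hw.trans hw') p).2 ⟨R, K.mem_mono hw' hR, hp⟩, hq⟩
  refine ⟨U, hU, ?_, ?_⟩
  · rintro w' hw a' b' x' y' ha' hb' ⟨p, hp, hp'⟩
    obtain ⟨R, hR, hpR⟩ := (hU' w' hw p).1 hp
    obtain ⟨p', -, hgood⟩ := h₂ w' hw R hR
    exact (((forces_halfFml (h.mono hw) hq).1 hgood).1 w' le_rfl a' b' x' y' ha' hb'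
      ⟨p, hpR, hp'⟩).imp (sub hw hR)
  · rintro w' hw c d z hc hd ⟨p, hp, ht⟩
    have h' := h.mono hw
    obtain ⟨R, hR, hgood⟩ := h₁ w' hw p hp
    obtain ⟨-, c', hc', d', hd', z', hz', ht', f, g, hf, hg, r, s, hr, hs, z'', ht'',
      H⟩ := (forces_halfFml h' hq).1 hgood
    obtain ⟨e₁, e₂, e₃⟩ := ht'.inj ht
    refine ⟨f, g, h'.app_congr (refl_of_mem (h'.app_mem hf).1) e₁
      (refl_of_mem (h'.app_mem hf).2.2) hf, h'.app_congr (refl_of_mem (h'.app_mem hg).1) e₂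
      (refl_of_mem (h'.app_mem hg).2.2) hg, r, s, hr, hs, z'', ht'', H.imp fun c d hcd => ?_⟩
    have ex := hcd.ex
    exact sub hw hR w' le_rfl _ _ _ _ (hcd.congr (K.eq_refl ex.1) (K.eq_refl ex.2.1) e₃
      (K.eq_refl ex.2.2.2.1) (K.eq_refl ex.2.2.2.2))

/-- The clause is the forcing of a formula, so it respects equality of all its parameters. -/
theorem eqClause_congr (h : Pca w P) {R a b x y a' b' x' y' : ℕ} (hR : K.Ex w R)
    (ha : K.Eq w a a') (hb : K.Eq w b b') (hx : K.Eq w x x') (hy : K.Eq w y y')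
    (H : EqClause w P (QuadRel R) a b x y) : EqClause w P (QuadRel R) a' b' x' y' := by
  have key : ∀ a b x y, Forces w ((stdPar.shift 5).eqClause 0 1 2 3 4)
      (scons R (scons a (scons b (scons x (scons y P.env))))) ↔
      EqClause w P (QuadRel R) a b x y := fun a b x y =>
    forces_eqClause (P := stdPar.shift 5) h
  refine (key _ _ _ _).1 (Forces.congr ?_ ((key _ _ _ _).2 H))
  exact eq_scons (K.eq_refl hR) (eq_scons ha (eq_scons hb (eq_scons hx (eq_scons hy
    fun i => K.eq_refl (h.env i)))))

theorem eqClause_of_rlzEq {a b x y : ℕ} (ha : K.Mem w a P.A) (hb : K.Mem w b P.A)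
    (H : RlzEq w P a b x y) : EqClause w P (fun w' => RlzEq w' P) a b x y := by
  obtain ⟨R, hR, hq, hc⟩ := H
  exact (hc w le_rfl a b x y ha hb hq).imp fun w' hw c d x z hq =>
    ⟨R, K.ex_mono hw hR, hq, hc.mono hw⟩

/-- The set `R` consists of the two closed sets `U₁`, `U₂` for the halves and the new quadruple `⟨a,
b, x, y⟩`. Old quadruples satisfy their clauses by monotonicity, the new one by the choice of `U₁`
and `U₂`. -/
theorem rlzEq_of_eqClause (h : Pca w P) {a b x y : ℕ} (ha : K.Mem w a P.A) (hb : K.Mem w b P.A)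
    (hx : InV w P x) (hy : InV w P y) (H : EqClause w P (fun w' => RlzEq w' P) a b x y) :
    RlzEq w P a b x y := by
  obtain ⟨U₁, hU₁, hc₁, H₁⟩ := h.exists_closed_half Tm.p₀_closed hx hy.ex ha hb H.1
  obtain ⟨U₂, hU₂, hc₂, H₂⟩ := h.exists_closed_half Tm.p₁_closed hy hx.ex ha hb H.2
  obtain ⟨q, hq⟩ := h.czf.isQuad (K.mem_ex ha).1 (K.mem_ex hb).1 hx.ex hy.ex
  have hqe : K.Ex w q := by obtain ⟨u, hu, -⟩ := hq; exact (K.mem_ex hu).2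
  -- `S = {q}`, `V = U₁ ∪ U₂` and `R = V ∪ S`, each binary union being formed from an unordered
  -- pair.
  obtain ⟨S, hS, hS'⟩ := h.czf.upair hqe hqe
  obtain ⟨D₁, hD₁, hD₁'⟩ := h.czf.upair hU₁ hU₂
  obtain ⟨V, hV, hV'⟩ := h.czf.union hD₁
  obtain ⟨D₂, hD₂, hD₂'⟩ := h.czf.upair hV hS
  obtain ⟨R, hR, hR'⟩ := h.czf.union hD₂
  have memU₁ : ∀ w', w ≤ w' → ∀ p, K.Mem w' p U₁ → K.Mem w' p R := fun w' hw p hp =>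
    (hR' w' hw p).2 ⟨V, (hD₂' w' hw V).2 (Or.inl (K.eq_refl (K.ex_mono hw hV))),
      (hV' w' hw p).2 ⟨U₁, (hD₁' w' hw U₁).2 (Or.inl (K.eq_refl (K.ex_mono hw hU₁))), hp⟩⟩
  have memU₂ : ∀ w', w ≤ w' → ∀ p, K.Mem w' p U₂ → K.Mem w' p R := fun w' hw p hp =>
    (hR' w' hw p).2 ⟨V, (hD₂' w' hw V).2 (Or.inl (K.eq_refl (K.ex_mono hw hV))),
      (hV' w' hw p).2 ⟨U₂, (hD₁' w' hw U₂).2 (Or.inr (K.eq_refl (K.ex_mono hw hU₂))), hp⟩⟩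
  have memQ : K.Mem w q R := (hR' w le_rfl q).2 ⟨S, (hD₂' w le_rfl S).2 (Or.inr (K.eq_refl hS)),
    (hS' w le_rfl q).2 (Or.inl (K.eq_refl hqe))⟩
  have eqSet : ∀ {w' : K.World} {p s s' : ℕ}, K.Eq w' s s' → K.Mem w' p s → K.Mem w' p s' :=
    fun e hp => K.mem_congr (refl_of_mem hp) e hp
  have memR : ∀ w', w ≤ w' → ∀ p, K.Mem w' p R →
      K.Mem w' p U₁ ∨ K.Mem w' p U₂ ∨ K.Eq w' p q := by
    intro w' hw p hp
    obtain ⟨s, hs, hp⟩ := (hR' w' hw p).1 hp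
    rcases (hD₂' w' hw s).1 hs with e | e
    · obtain ⟨s, hs, hp⟩ := (hV' w' hw p).1 (eqSet e hp)
      rcases (hD₁' w' hw s).1 hs with e | e
      · exact Or.inl (eqSet e hp)
      · exact Or.inr (Or.inl (eqSet e hp))
    · exact Or.inr (Or.inr (((hS' w' hw p).1 (eqSet e hp)).elim id id))
  have sub₁ : ∀ w', w ≤ w' → ∀ c d x z, QuadRel U₁ w' c d x z → QuadRel R w' c d x z :=
    fun w' hw _ _ _ _ ⟨p, hp, H⟩ => ⟨p, memU₁ w' hw p hp, H⟩
  have sub₂ : ∀ w', w ≤ w' → ∀ c d x z, QuadRel U₂ w' c d x z → QuadRel R w' c d x z :=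
    fun w' hw _ _ _ _ ⟨p, hp, H⟩ => ⟨p, memU₂ w' hw p hp, H⟩
  have HR : EqClause w P (QuadRel R) a b x y := ⟨H₁.imp sub₁, H₂.imp sub₂⟩
  refine ⟨R, hR, ⟨q, memQ, hq⟩, ?_⟩
  rintro w' hw a' b' x' y' ha' hb' ⟨p, hp, hp'⟩
  rcases memR w' hw p hp with hp | hp | e
  · exact (hc₁ w' hw a' b' x' y' ha' hb' ⟨p, hp, hp'⟩).imp fun w'' hw' => sub₁ w'' (hw.trans hw')
  · exact (hc₂ w' hw a' b' x' y' ha' hb' ⟨p, hp, hp'⟩).imp fun w'' hw' => sub₂ w'' (hw.trans hw')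
  -- `p` is the new quadruple only up to the equality of the model, so the components are matched by
  -- injectivity and the clause is transported.
  · have ex : QuadMem w' a' b' x' y' R := ⟨p, hp, hp'⟩
    have ex := ex.ex
    obtain ⟨e₁, e₂, e₃, e₄⟩ := (hq.mono hw).inj (hp'.congr e (K.eq_refl ex.1)
      (K.eq_refl ex.2.1) (K.eq_refl ex.2.2.1) (K.eq_refl ex.2.2.2.1))
    exact eqClause_congr (h.mono hw) (K.ex_mono hw hR) e₁ e₂ e₃ e₄
      ⟨fun w'' hw' => HR.1 w'' (hw.trans hw'), fun w'' hw' => HR.2 w'' (hw.trans hw')⟩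

/-! ## Realizers for the laws of equality -/

variable {ρ ρ' : ℕ → ℕ} {t u : Tm} {x y z : ℕ}

theorem onEv_memClause (h : Pca w P) (hρ : ∀ i, K.Mem w (ρ i) P.A)
    (hρ' : ∀ i, K.Mem w (ρ' i) P.A) {Q : ℕ → ℕ → ℕ → ℕ → Prop} (z : ℕ)
    (H₁ : OnEv w P ρ ρ' t fun c d => TripleMem w c d z y)
    (H₂ : OnEv w P ρ ρ' u fun c d => Q c d x z) :
    OnEv w P ρ ρ' (.pair t u) fun a b => MemClause w P Q a b x y :=
  (h.onEv_pair hρ hρ' H₁ H₂).imp fun _ _ H => ⟨z, H⟩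

theorem exists_of_onEv_memClause (h : Pca w P) {Q : ℕ → ℕ → ℕ → ℕ → Prop}
    (H : OnEv w P ρ ρ' t fun a b => MemClause w P Q a b x y) :
    ∃ z, (OnEv w P ρ ρ' (.app .p₀ t) fun c d => TripleMem w c d z y) ∧
      OnEv w P ρ ρ' (.app .p₁ t) fun c d => Q c d x z := by
  obtain ⟨a, b, ha, hb, z, H₁, H₂⟩ := H
  exact ⟨z, h.onEv_p₀ ⟨a, b, ha, hb, H₁⟩, h.onEv_p₁ ⟨a, b, ha, hb, H₂⟩⟩

theorem onEv_eq_left (h : Pca w P) (hρ : ∀ i, K.Mem w (ρ i) P.A)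
    (hρ' : ∀ i, K.Mem w (ρ' i) P.A) (H : OnEv w P ρ ρ' t fun a b => RlzEq w P a b x y)
    (Hu : OnEv w P ρ ρ' u fun c d => TripleMem w c d z x) :
    OnEv w P ρ ρ' (.app .p₀ (.app t u)) fun a b => MemClause w P (RlzEq w P) a b z y := by
  obtain ⟨a, b, ha, hb, H⟩ := H
  obtain ⟨c, d, hc, hd, ht⟩ := Hu
  exact h.onEv_p₀ (h.onEv_app ⟨a, b, ha, hb, c, d, hc, hd,
    (eqClause_of_rlzEq (h.ev_mem hρ ha) (h.ev_mem hρ' hb) H).1 w le_rfl c d z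
      (h.ev_mem hρ hc) (h.ev_mem hρ' hd) ht⟩)

theorem onEv_eq_right (h : Pca w P) (hρ : ∀ i, K.Mem w (ρ i) P.A)
    (hρ' : ∀ i, K.Mem w (ρ' i) P.A) (H : OnEv w P ρ ρ' t fun a b => RlzEq w P a b x y)
    (Hu : OnEv w P ρ ρ' u fun c d => TripleMem w c d z y) :
    OnEv w P ρ ρ' (.app .p₁ (.app t u)) fun a b => MemClause w P (RlzEq w P) a b z x := by
  obtain ⟨a, b, ha, hb, H⟩ := H
  obtain ⟨c, d, hc, hd, ht⟩ := Hu
  exact h.onEv_p₁ (h.onEv_app ⟨a, b, ha, hb, c, d, hc, hd,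
    (eqClause_of_rlzEq (h.ev_mem hρ ha) (h.ev_mem hρ' hb) H).2 w le_rfl c d z
      (h.ev_mem hρ hc) (h.ev_mem hρ' hd) ht⟩)

theorem mem_env_mono (H : w ≤ w') (hρ : ∀ i, K.Mem w (ρ i) P.A) : ∀ i, K.Mem w' (ρ i) P.A :=
  fun i => K.mem_mono H (hρ i)

/-- `t` is known to be defined only at names of elements of `x`, and `u` only at names of elements
of `y`. A strict pair could therefore be undefined where one half of the clause needs it. -/
theorem onEv_eq_intro (h : Pca w P) (hρ : ∀ i, K.Mem w (ρ i) P.A)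
    (hρ' : ∀ i, K.Mem w (ρ' i) P.A) (hx : InV w P x) (hy : InV w P y) {n : ℕ}
    (ht : t.Below (n + 1)) (hu : u.Below (n + 1))
    (H₁ : ∀ w', w ≤ w' → ∀ c d z, K.Mem w' c P.A → K.Mem w' d P.A → TripleMem w' c d z x →
      OnEv w' P (Function.update ρ n c) (Function.update ρ' n d) t
        fun r s => MemClause w' P (RlzEq w' P) r s z y)
    (H₂ : ∀ w', w ≤ w' → ∀ c d z, K.Mem w' c P.A → K.Mem w' d P.A → TripleMem w' c d z y →
      OnEv w' P (Function.update ρ n c) (Function.update ρ' n d) u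
        fun r s => MemClause w' P (RlzEq w' P) r s z x) :
    OnEv w P ρ ρ' (.lam n (lazyPair (n + 1) t u)) fun a b => RlzEq w P a b x y := by
  refine (h.onEv_mem hρ hρ' (h.onEv_lam hρ hρ' n (lazyPair (n + 1) t u))).imp ?_
  rintro a b ⟨ha, hb, H⟩
  have pairs : ∀ w', w ≤ w' → ∀ c d, K.Mem w' c P.A → K.Mem w' d P.A →
      OnEv w' P (Function.update ρ n c) (Function.update ρ' n d) (lazyPair (n + 1) t u) _ :=
    fun w' hw c d hc hd => (h.mono hw).onEv_lazyPair (update_mem (mem_env_mono hw hρ) n hc)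
      (update_mem (mem_env_mono hw hρ') n hd) ht hu
  refine h.rlzEq_of_eqClause ha hb hx hy ⟨fun w' hw c d z hc hd ht => ?_,
    fun w' hw c d z hc hd ht => ?_⟩
  · exact H w' hw c d _ hc hd ((pairs w' hw c d hc hd).imp fun q q' hq =>
      hq.1 _ (H₁ w' hw c d z hc hd ht))
  · exact H w' hw c d _ hc hd ((pairs w' hw c d hc hd).imp fun q q' hq =>
      hq.2 _ (H₂ w' hw c d z hc hd ht))

end Pca

/-- The realizer of `y = x` obtained from a realizer of `x = y` -/
def symmTm : Tm := .lam 0 (.lam 1 (lazyPair 2 (.app .p₁ (.app (.var 0) (.var 1)))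
  (.app .p₀ (.app (.var 0) (.var 1)))))

theorem symmTm_closed : symmTm.Closed := by
  rw [← Tm.below_zero_iff]
  refine Tm.Below.lam (Tm.Below.lam (lazyPair_below ⟨Tm.p₁_closed.below _, ?_⟩
    ⟨Tm.p₀_closed.below _, ?_⟩)) <;> exact ⟨Nat.zero_lt_two, Nat.one_lt_two⟩

/-- The body of the fixed point that realizes `x = x` -/
def reflBody : Tm := .lam 0 (.lam 1 (lazyPair 2 (.pair (.var 1) (.app (.var 0) (.var 0)))
  (.pair (.var 1) (.app (.var 0) (.var 0)))))

/-- The realizer of `x = x` -/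
def reflTm : Tm := .app reflBody reflBody

theorem reflBody_closed : reflBody.Closed := by
  have hb : (Tm.pair (.var 1) (.app (.var 0) (.var 0))).Below 2 :=
    ⟨⟨Tm.pr_closed.below _, Nat.one_lt_two⟩, Nat.zero_lt_two, Nat.zero_lt_two⟩
  exact Tm.below_zero_iff.1 (Tm.Below.lam (Tm.Below.lam (lazyPair_below hb hb)))

theorem reflTm_closed : reflTm.Closed := ⟨reflBody_closed, reflBody_closed⟩

namespace Pca

variable {ρ ρ' : ℕ → ℕ} {t u : Tm} {x y z : ℕ}

/-- The two halves of the clause are exchanged, so no recursion is needed. -/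
theorem onEv_symm (h : Pca w P) (hρ : ∀ i, K.Mem w (ρ i) P.A)
    (hρ' : ∀ i, K.Mem w (ρ' i) P.A) (hx : InV w P x) (hy : InV w P y)
    (H : OnEv w P ρ ρ' t fun a b => RlzEq w P a b x y) :
    OnEv w P ρ ρ' (.app symmTm t) fun a b => RlzEq w P a b y x := by
  refine h.onEv_beta hρ hρ' ((h.onEv_mem hρ hρ' H).imp ?_)
  rintro a b ⟨ha, hb, H⟩
  refine h.onEv_eq_intro (update_mem hρ 0 ha) (update_mem hρ' 0 hb) hy hx
    ⟨Tm.p₁_closed.below _, Nat.zero_lt_two, Nat.one_lt_two⟩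
    ⟨Tm.p₀_closed.below _, Nat.zero_lt_two, Nat.one_lt_two⟩ ?_ ?_
  · intro w' hw c d z hc hd ht
    refine (h.mono hw).onEv_eq_right (x := x) (y := y)
      (update_mem (update_mem (mem_env_mono hw hρ) 0 (K.mem_mono hw ha)) 1 hc)
      (update_mem (update_mem (mem_env_mono hw hρ') 0 (K.mem_mono hw hb)) 1 hd) ?_ ?_
    · exact ⟨a, b, refl_of_mem (K.mem_mono hw ha), refl_of_mem (K.mem_mono hw hb), H.mono hw⟩
    · exact ⟨c, d, refl_of_mem hc, refl_of_mem hd, ht⟩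
  · intro w' hw c d z hc hd ht
    refine (h.mono hw).onEv_eq_left (x := x) (y := y)
      (update_mem (update_mem (mem_env_mono hw hρ) 0 (K.mem_mono hw ha)) 1 hc)
      (update_mem (update_mem (mem_env_mono hw hρ') 0 (K.mem_mono hw hb)) 1 hd) ?_ ?_
    · exact ⟨a, b, refl_of_mem (K.mem_mono hw ha), refl_of_mem (K.mem_mono hw hb), H.mono hw⟩
    · exact ⟨c, d, refl_of_mem hc, refl_of_mem hd, ht⟩

/-- The self-application `j j` is defined because the body waits for a further argument before it
calls itself. Both values are the same in all environments, the terms being closed. -/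
theorem exists_ev_reflTm (h : Pca w P) : ∃ j i, K.Mem w j P.A ∧ K.Mem w i P.A ∧
    App w P j j i ∧ ∀ ρ, Ev w P ρ reflBody j ∧ Ev w P ρ reflTm i := by
  have hρ : ∀ _ : ℕ, K.Mem w P.k P.A := fun _ => h.k_mem
  obtain ⟨j, hj, H⟩ := h.ev_lam hρ 0 (.lam 1 (lazyPair 2
    (.pair (.var 1) (.app (.var 0) (.var 0))) (.pair (.var 1) (.app (.var 0) (.var 0)))))
  have hjm := h.ev_mem hρ hj
  obtain ⟨i, hi, -⟩ := h.ev_lam (update_mem hρ 0 hjm) 1 (lazyPair 2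
    (.pair (.var 1) (.app (.var 0) (.var 0))) (.pair (.var 1) (.app (.var 0) (.var 0))))
  have hji := (H j i hjm).2 hi
  have hj' : ∀ ρ, Ev w P ρ reflBody j := fun ρ => ev_closed reflBody_closed hj
  exact ⟨j, i, hjm, (h.app_mem hji).2.2, hji, fun ρ =>
    ⟨hj' ρ, (h.ev_app_of (hj' ρ) (hj' ρ)).2 hji⟩⟩

/-- The value `i` of `j j` sends a name `c` of `z` in `x` to a lazy pair, both of whose projections
are the pair of `c` and `i`. By induction `i` realizes `z = z`, so these pairs realize `z ∈ x` with
`z` itself as the witness. -/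
theorem onEv_refl (h : Pca w P) (hx : InV w P x) :
    OnEv w P ρ ρ' reflTm fun a b => RlzEq w P a b x x := by
  obtain ⟨j, i, hj, hi, hji, hev⟩ := h.exists_ev_reflTm
  refine ⟨i, i, (hev ρ).2, (hev ρ').2, ?_⟩
  -- The induction is on a formula, so the statement for the fixed value `i` is written as one,
  -- relativized to the universe.
  have key : ∀ {w'}, w ≤ w' → ∀ {x}, Forces w' (imp ((stdPar.shift 2).inV 0)
      ((stdPar.shift 2).rlzEq 1 1 0 0)) (scons x (scons i P.env)) ↔
      ∀ w'', w' ≤ w'' → InV w'' P x → RlzEq w'' P i i x x := fun {w'} hw {x} =>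
    forall_congr' fun w'' => forall_congr' fun hw' => imp_congr Iff.rfl
      (forces_rlzEq (P := stdPar.shift 2) (h.mono (hw.trans hw')))
  refine (key le_rfl).1 (h.czf.triple_induction _ (Env.scons (K.mem_ex hi).1 h.env) ?_ hx.ex)
    w le_rfl hx
  intro w₁ h₁ x _ ih
  rw [key h₁]
  intro w₂ h₂ hx
  have h' := h.mono (h₁.trans h₂)
  have hi₂ := K.mem_mono (h₁.trans h₂) hi
  have hj₂ := K.mem_mono (h₁.trans h₂) hj
  have hρ : ∀ _ : ℕ, K.Mem w₂ i P.A := fun _ => hi₂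
  have half : ∀ w', w₂ ≤ w' → ∀ c d z, K.Mem w' c P.A → K.Mem w' d P.A →
      TripleMem w' c d z x →
      OnEv w' P (Function.update (Function.update (fun _ => i) 0 j) 1 c)
        (Function.update (Function.update (fun _ => i) 0 j) 1 d)
        (.pair (.var 1) (.app (.var 0) (.var 0)))
        fun r s => MemClause w' P (RlzEq w' P) r s z x := by
    intro w₃ h₃ c d z hc hd ht
    have h₁₃ := h₁.trans (h₂.trans h₃)
    have h'' := h'.mono h₃
    have e : ∀ b, Ev w₃ P (Function.update (Function.update (fun _ => i) 0 j) 1 b)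
        (.app (.var 0) (.var 0)) i := fun b =>
      (h''.ev_app_of (t := .var 0) (u := .var 0) (refl_of_mem (K.mem_mono h₃ hj₂))
        (refl_of_mem (K.mem_mono h₃ hj₂))).2 (TripleMem.mono hji h₁₃)
    refine h''.onEv_memClause
      (update_mem (update_mem (mem_env_mono h₃ hρ) 0 (K.mem_mono h₃ hj₂)) 1 hc)
      (update_mem (update_mem (mem_env_mono h₃ hρ) 0 (K.mem_mono h₃ hj₂)) 1 hd) z ?_ ?_
    · exact ⟨c, d, refl_of_mem hc, refl_of_mem hd, ht⟩
    · exact ⟨i, i, e c, e d, (key h₁₃).1 (ih w₃ (h₂.trans h₃) c d z ht) w₃ le_rfl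
        ((hx.mono h₃).of_tripleMem ht).2.2⟩
  have hb : (Tm.pair (.var 1) (.app (.var 0) (.var 0))).Below 2 :=
    ⟨⟨Tm.pr_closed.below _, Nat.one_lt_two⟩, Nat.zero_lt_two, Nat.zero_lt_two⟩
  obtain ⟨c, d, hc, hd, H⟩ := h'.onEv_eq_intro (update_mem hρ 0 hj₂) (update_mem hρ 0 hj₂)
    hx hx hb hb half half
  -- The inner abstraction was evaluated afresh; its value equals `i` because `j j` evaluates to
  -- that abstraction.
  have e : ∀ {c}, Ev w₂ P (Function.update (fun _ => i) 0 j) (.lam 1 (lazyPair 2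
      (.pair (.var 1) (.app (.var 0) (.var 0))) (.pair (.var 1) (.app (.var 0) (.var 0))))) c →
      K.Eq w₂ c i := fun hc => h'.app_unique
    ((h'.app_ev_lam hρ (ev_mono (h₁.trans h₂) (hev _).1) hj₂).2 hc)
    (TripleMem.mono hji (h₁.trans h₂))
  exact H.congr (e hc) (e hd) (K.eq_refl hx.ex) (K.eq_refl hx.ex)

end Pca

end KripkeModel

namespace KripkeModel

variable {K : KripkeModel} {w w' : K.World} {P : Par}

/-! ## Transitivity of realized equality -/

/-- The fixed point for transitivity, applied to two terms, in terms of the variable `0` -/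
def transCall (t u : Tm) : Tm := .app (.app (.app (.var 0) (.var 0)) t) u

/-- If `p` realizes `v ∈ y`, where `f` realizes `y = z` in the direction of the projection `q`, and
the fixed point realizes transitivity, then this term realizes `v ∈ z`. -/
def transStep (q f p : Tm) : Tm :=
  .pair (.app .p₀ (.app q (.app f (.app .p₀ p))))
    (transCall (.app .p₁ p) (.app .p₁ (.app q (.app f (.app .p₀ p)))))

def transLeft : Tm := transStep .p₀ (.var 2) (.app .p₀ (.app (.var 1) (.var 3)))

def transRight : Tm := transStep .p₁ (.var 1) (.app .p₁ (.app (.var 2) (.var 3)))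

def transBody : Tm := .lam 0 (.lam 1 (.lam 2 (.lam 3 (lazyPair 4 transLeft transRight))))

/-- The realizer of the transitivity of equality -/
def transTm : Tm := .app transBody transBody

theorem transStep_below {q f p : Tm} {n : ℕ} (hn : 0 < n) (hq : q.Closed) (hf : f.Below n)
    (hp : p.Below n) : (transStep q f p).Below n := by
  have h₀ := Tm.p₀_closed.below n
  have h₁ := Tm.p₁_closed.below n
  have hq := hq.below n
  exact ⟨⟨Tm.pr_closed.below n, h₀, hq, hf, h₀, hp⟩, ⟨⟨hn, hn⟩, h₁, hp⟩, h₁, hq, hf, h₀, hp⟩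

theorem transLeft_below : transLeft.Below 4 :=
  transStep_below (by norm_num) Tm.p₀_closed (by simp [Tm.Below])
    ⟨Tm.p₀_closed.below _, by simp [Tm.Below], by simp [Tm.Below]⟩

theorem transRight_below : transRight.Below 4 :=
  transStep_below (by norm_num) Tm.p₁_closed (by simp [Tm.Below])
    ⟨Tm.p₁_closed.below _, by simp [Tm.Below], by simp [Tm.Below]⟩

theorem transBody_closed : transBody.Closed :=
  Tm.below_zero_iff.1 (Tm.Below.lam (Tm.Below.lam (Tm.Below.lam (Tm.Below.lam
    (lazyPair_below transLeft_below transRight_below)))))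

theorem transTm_closed : transTm.Closed := ⟨transBody_closed, transBody_closed⟩

/-- The value `g` realizes transitivity of equality with `y` in the middle. -/
def TransAt (w : K.World) (P : Par) (g y : ℕ) : Prop :=
  ∀ w', w ≤ w' → ∀ x z a a' b b', K.Mem w' a P.A → K.Mem w' a' P.A → K.Mem w' b P.A →
    K.Mem w' b' P.A → InV w' P x → InV w' P y → InV w' P z → RlzEq w' P a a' x y →
    RlzEq w' P b b' y z →
    OnApp w' P g g a a' fun f f' => OnApp w' P f f' b b' fun r r' => RlzEq w' P r r' x z

/-- A formula for `TransAt`; its variables are `y, g`, followed by those of the structure. -/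
def transFml : Fml :=
  all (all (ball 4 (ball 5 (ball 6 (ball 7
    (imp (conj ((stdPar.shift 8).inV 5) (conj ((stdPar.shift 8).inV 6)
      (conj ((stdPar.shift 8).inV 4) (conj ((stdPar.shift 8).rlzEq 3 2 5 6)
        ((stdPar.shift 8).rlzEq 1 0 6 4)))))
      ((stdPar.shift 8).sub₂ (.app (.app (.var 7) (.var 3)) (.var 1))
        (.app (.app (.var 7) (.var 2)) (.var 0)) ((stdPar.shift 10).rlzEq 1 0 7 6))))))))

namespace Pca

variable {ρ ρ' : ℕ → ℕ} {t u : Tm} {x y z : ℕ}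

theorem ev_app_app_var (h : Pca w P) {i j k r : ℕ} :
    Ev w P ρ (.app (.app (.var i) (.var j)) (.var k)) r ↔
      ∃ f, App w P (ρ i) (ρ j) f ∧ App w P f (ρ k) r := by
  constructor
  · intro H
    obtain ⟨f, c, h₁, h₂, h₃⟩ := h.ev_app.1 H
    refine ⟨f, h.ev_ap.1 h₁, ?_⟩
    exact h.app_congr (refl_of_mem (h.app_mem h₃).1) (K.eq_symm h₂)
      (refl_of_mem (h.app_mem h₃).2.2) h₃
  · rintro ⟨f, h₁, h₂⟩
    exact h.ev_app.2 ⟨f, ρ k, h.ev_ap.2 h₁, refl_of_mem (h.app_mem h₂).2.1, h₂⟩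

/-- Makes set induction available for `TransAt`. The two outer sets and their realizers are
quantified inside the formula, so the induction hypothesis applies to new ones. -/
theorem forces_transFml (h : Pca w P) {g : ℕ} :
    Forces w transFml (scons y (scons g P.env)) ↔ TransAt w P g y := by
  have eqv : ∀ w', w ≤ w' → ∀ a b x y (σ : ℕ → ℕ) (n : ℕ) i j k l,
      (stdPar.shift n).map σ = P → σ i = a → σ j = b → σ k = x → σ l = y →
      (Forces w' ((stdPar.shift n).rlzEq i j k l) σ ↔ RlzEq w' P a b x y) := by
    rintro w' hw a b x y σ n i j k l rfl rfl rfl rfl rfl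
    exact forces_rlzEq (h.mono hw)
  constructor
  · intro H w' hw x z a a' b b' ha ha' hb hb' hx hy hz h₁ h₂
    have h' := h.mono hw
    obtain ⟨r, -, r', -, e₁, e₂, H⟩ := forces_sub₂.1 (H w' hw x hx.ex w' le_rfl z hz.ex
      w' le_rfl a ha w' le_rfl a' ha' w' le_rfl b hb w' le_rfl b' hb' w' le_rfl
      ⟨hx, hy, hz, (eqv w' hw _ _ _ _ _ _ _ _ _ _ rfl rfl rfl rfl rfl).2 h₁,
        (eqv w' hw _ _ _ _ _ _ _ _ _ _ rfl rfl rfl rfl rfl).2 h₂⟩)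
    obtain ⟨f, hf, hr⟩ := h'.ev_app_app_var.1 e₁
    obtain ⟨f', hf', hr'⟩ := h'.ev_app_app_var.1 e₂
    exact ⟨f, f', hf, hf', r, r', hr, hr',
      (eqv w' hw _ _ _ _ _ _ _ _ _ _ rfl rfl rfl rfl rfl).1 H⟩
  · rintro H w₁ hw₁ x hx w₂ hw₂ z hz w₃ hw₃ a ha w₄ hw₄ a' ha' w₅ hw₅ b hb w₆ hw₆ b' hb' w₇ hw₇
      ⟨hx, hy, hz, h₁, h₂⟩
    have e₆ := hw₇
    have e₅ := hw₆.trans e₆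
    have e₄ := hw₅.trans e₅
    have e₃ := hw₄.trans e₄
    have hw := hw₁.trans (hw₂.trans (hw₃.trans e₃))
    have h' := h.mono hw
    obtain ⟨f, f', hf, hf', r, r', hr, hr', H⟩ := H w₇ hw x z a a' b b' (K.mem_mono e₃ ha)
      (K.mem_mono e₄ ha') (K.mem_mono e₅ hb) (K.mem_mono e₆ hb') hx hy hz
      ((eqv w₇ hw _ _ _ _ _ _ _ _ _ _ rfl rfl rfl rfl rfl).1 h₁)
      ((eqv w₇ hw _ _ _ _ _ _ _ _ _ _ rfl rfl rfl rfl rfl).1 h₂)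
    exact forces_sub₂.2 ⟨r, (h'.app_mem hr).2.2, r', (h'.app_mem hr').2.2,
      h'.ev_app_app_var.2 ⟨f, hf, hr⟩, h'.ev_app_app_var.2 ⟨f', hf', hr'⟩,
      (eqv w₇ hw _ _ _ _ _ _ _ _ _ _ rfl rfl rfl rfl rfl).2 H⟩

theorem exists_ev_transTm (h : Pca w P) : ∃ j g, K.Mem w j P.A ∧ K.Mem w g P.A ∧
    App w P j j g ∧ ∀ ρ, Ev w P ρ transBody j ∧ Ev w P ρ transTm g := by
  have hρ : ∀ _ : ℕ, K.Mem w P.k P.A := fun _ => h.k_mem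
  obtain ⟨j, hj, H⟩ := h.ev_lam hρ 0 (.lam 1 (.lam 2 (.lam 3 (lazyPair 4 transLeft transRight))))
  have hjm := h.ev_mem hρ hj
  obtain ⟨g, hg, -⟩ := h.ev_lam (update_mem hρ 0 hjm) 1
    (.lam 2 (.lam 3 (lazyPair 4 transLeft transRight)))
  have hjg := (H j g hjm).2 hg
  have hj' : ∀ ρ, Ev w P ρ transBody j := fun ρ => ev_closed transBody_closed hj
  exact ⟨j, g, hjm, (h.app_mem hjg).2.2, hjg, fun ρ =>
    ⟨hj' ρ, (h.ev_app_of (hj' ρ) (hj' ρ)).2 hjg⟩⟩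

theorem onEv_transCall (h : Pca w P) (hρ : ∀ i, K.Mem w (ρ i) P.A)
    (hρ' : ∀ i, K.Mem w (ρ' i) P.A) {g : ℕ} (hg : App w P (ρ 0) (ρ 0) g)
    (hg' : App w P (ρ' 0) (ρ' 0) g) (H : TransAt w P g y) (hx : InV w P x) (hy : InV w P y)
    (hz : InV w P z) (Ht : OnEv w P ρ ρ' t fun a b => RlzEq w P a b x y)
    (Hu : OnEv w P ρ ρ' u fun a b => RlzEq w P a b y z) :
    OnEv w P ρ ρ' (transCall t u) fun a b => RlzEq w P a b x z := by
  obtain ⟨a, a', ha, ha', Ht⟩ := Ht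
  obtain ⟨b, b', hb, hb', Hu⟩ := Hu
  obtain ⟨f, f', hf, hf', r, r', hr, hr', H⟩ := H w le_rfl x z a a' b b' (h.ev_mem hρ ha)
    (h.ev_mem hρ' ha') (h.ev_mem hρ hb) (h.ev_mem hρ' hb') hx hy hz Ht Hu
  exact ⟨r, r', (h.ev_app_of ((h.ev_app_of (h.ev_ap.2 hg) ha).2 hf) hb).2 hr,
    (h.ev_app_of ((h.ev_app_of (h.ev_ap.2 hg') ha').2 hf') hb').2 hr', H⟩

/-- The step of the recursion for transitivity -/
theorem onEv_transStep (h : Pca w P) (hρ : ∀ i, K.Mem w (ρ i) P.A)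
    (hρ' : ∀ i, K.Mem w (ρ' i) P.A) {g : ℕ} (hg : App w P (ρ 0) (ρ 0) g)
    (hg' : App w P (ρ' 0) (ρ' 0) g) {q f p : Tm} {v : ℕ} (hv : InV w P v) (hy : InV w P y)
    (hz : InV w P z) (H : ∀ c d v', TripleMem w c d v' y → TransAt w P g v')
    (Hp : OnEv w P ρ ρ' p fun r s => MemClause w P (RlzEq w P) r s v y)
    (Hq : ∀ {u v'}, (OnEv w P ρ ρ' u fun c d => TripleMem w c d v' y) →
      OnEv w P ρ ρ' (.app q (.app f u)) fun r s => MemClause w P (RlzEq w P) r s v' z) :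
    OnEv w P ρ ρ' (transStep q f p) fun r s => MemClause w P (RlzEq w P) r s v z := by
  obtain ⟨v', h₁, h₂⟩ := h.exists_of_onEv_memClause Hp
  obtain ⟨v'', h₃, h₄⟩ := h.exists_of_onEv_memClause (Hq h₁)
  obtain ⟨c, d, -, -, ht⟩ := id h₁
  obtain ⟨c', d', -, -, ht'⟩ := id h₃
  exact h.onEv_memClause hρ hρ' v'' h₃ (h.onEv_transCall hρ hρ' hg hg' (H c d v' ht) hv
    (hy.of_tripleMem ht).2.2 (hz.of_tripleMem ht').2.2 h₂ h₄)

/-- The induction is on the middle set. In either direction, an element of one outer set is matched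
first with an element of `y` and then with one of the other outer set. The recursive call thus has
an element of `y` in the middle, and both halves are instances of one step. -/
theorem transAt_of_children (h : Pca w P) {j g : ℕ} (hj : K.Mem w j P.A) (hjg : App w P j j g)
    (hb : Ev w P (fun _ => j) transBody j)
    (H : ∀ w', w ≤ w' → ∀ c d v, TripleMem w' c d v y → TransAt w' P g v) :
    TransAt w P g y := by
  intro w' hw x z a a' b b' ha ha' hb₁ hb₁' hx hy hz Hxy Hyz
  have h' := h.mono hw
  have hj' := K.mem_mono hw hj
  have hρ : ∀ _ : ℕ, K.Mem w' j P.A := fun _ => hj'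
  have hg : Ev w' P (Function.update (fun _ => j) 0 j)
      (.lam 1 (.lam 2 (.lam 3 (lazyPair 4 transLeft transRight)))) g :=
    (h'.app_ev_lam hρ (ev_mono hw hb) hj').1 (TripleMem.mono hjg hw)
  have call : ∀ {a b}, K.Mem w' a P.A → K.Mem w' b P.A → ∃ f, App w' P g a f ∧ ∀ r,
      Ev w' P (Function.update (Function.update (Function.update (fun _ => j) 0 j) 1 a) 2 b)
        (.lam 3 (lazyPair 4 transLeft transRight)) r → App w' P f b r := by
    intro a b ha hb
    have hρ₁ := update_mem hρ 0 hj'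
    have hρ₂ := update_mem hρ₁ 1 ha
    obtain ⟨f, hf, Hf⟩ := h'.ev_lam hρ₂ 2 (.lam 3 (lazyPair 4 transLeft transRight))
    exact ⟨f, (h'.app_ev_lam hρ₁ hg ha).2 hf, fun r hr => (Hf b r hb).2 hr⟩
  obtain ⟨f, hf, Hf⟩ := call ha hb₁
  obtain ⟨f', hf', Hf'⟩ := call ha' hb₁'
  have hE : ∀ {a b}, K.Mem w' a P.A → K.Mem w' b P.A → ∀ i, K.Mem w' (Function.update
      (Function.update (Function.update (fun _ => j) 0 j) 1 a) 2 b i) P.A := fun ha hb =>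
    update_mem (update_mem (update_mem hρ 0 hj') 1 ha) 2 hb
  obtain ⟨r, r', hr, hr', HR⟩ := h'.onEv_eq_intro (n := 3) (hE ha hb₁) (hE ha' hb₁') hx hz
    transLeft_below transRight_below (by
      intro w'' hw' c d v hc hd ht
      have h'' := h'.mono hw'
      have hc' := update_mem (mem_env_mono hw' (hE ha hb₁)) 3 hc
      have hd' := update_mem (mem_env_mono hw' (hE ha' hb₁')) 3 hd
      have hg'' := TripleMem.mono hjg (hw.trans hw')
      refine h''.onEv_transStep hc' hd' (g := g) hg'' hg'' ((hx.mono hw').of_tripleMem ht).2.2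
        (hy.mono hw') (hz.mono hw') (H w'' (hw.trans hw')) ?_ fun hu => ?_
      · exact h''.onEv_eq_left hc' hd'
          ⟨a, a', refl_of_mem (K.mem_mono hw' ha), refl_of_mem (K.mem_mono hw' ha'),
            Hxy.mono hw'⟩ ⟨c, d, refl_of_mem hc, refl_of_mem hd, ht⟩
      · exact h''.onEv_eq_left hc' hd'
          ⟨b, b', refl_of_mem (K.mem_mono hw' hb₁), refl_of_mem (K.mem_mono hw' hb₁'),
            Hyz.mono hw'⟩ hu) (by
      intro w'' hw' c d v hc hd ht
      have h'' := h'.mono hw'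
      have hc' := update_mem (mem_env_mono hw' (hE ha hb₁)) 3 hc
      have hd' := update_mem (mem_env_mono hw' (hE ha' hb₁')) 3 hd
      have hg'' := TripleMem.mono hjg (hw.trans hw')
      refine h''.onEv_transStep hc' hd' (g := g) hg'' hg'' ((hz.mono hw').of_tripleMem ht).2.2
        (hy.mono hw') (hx.mono hw') (H w'' (hw.trans hw')) ?_ fun hu => ?_
      · exact h''.onEv_eq_right hc' hd'
          ⟨b, b', refl_of_mem (K.mem_mono hw' hb₁), refl_of_mem (K.mem_mono hw' hb₁'),
            Hyz.mono hw'⟩ ⟨c, d, refl_of_mem hc, refl_of_mem hd, ht⟩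
      · exact h''.onEv_eq_right hc' hd'
          ⟨a, a', refl_of_mem (K.mem_mono hw' ha), refl_of_mem (K.mem_mono hw' ha'),
            Hxy.mono hw'⟩ hu)
  exact ⟨f, f', hf, hf', r, r', Hf r hr, Hf' r' hr', HR⟩

theorem onEv_trans (h : Pca w P) (hρ : ∀ i, K.Mem w (ρ i) P.A)
    (hρ' : ∀ i, K.Mem w (ρ' i) P.A) (hx : InV w P x) (hy : InV w P y) (hz : InV w P z)
    (Ht : OnEv w P ρ ρ' t fun a b => RlzEq w P a b x y)
    (Hu : OnEv w P ρ ρ' u fun a b => RlzEq w P a b y z) :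
    OnEv w P ρ ρ' (.app (.app transTm t) u) fun a b => RlzEq w P a b x z := by
  obtain ⟨j, g, hj, hg, hjg, hev⟩ := h.exists_ev_transTm
  have H : TransAt w P g y := by
    refine h.forces_transFml.1 (h.czf.triple_induction _ (Env.scons (K.mem_ex hg).1 h.env) ?_
      hy.ex)
    intro w' hw y _ ih
    exact (h.mono hw).forces_transFml.2 ((h.mono hw).transAt_of_children (K.mem_mono hw hj)
      (TripleMem.mono hjg hw) (ev_mono hw (hev _).1) fun w'' hw' c d v hv =>
      (h.mono (hw.trans hw')).forces_transFml.1 (ih w'' hw' c d v hv))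
  obtain ⟨a, a', ha, ha', Ht⟩ := Ht
  obtain ⟨b, b', hb, hb', Hu⟩ := Hu
  obtain ⟨f, f', hf, hf', r, r', hr, hr', H⟩ := H w le_rfl x z a a' b b' (h.ev_mem hρ ha)
    (h.ev_mem hρ' ha') (h.ev_mem hρ hb) (h.ev_mem hρ' hb') hx hy hz Ht Hu
  exact ⟨r, r', (h.ev_app_of ((h.ev_app_of (hev ρ).2 ha).2 hf) hb).2 hr,
    (h.ev_app_of ((h.ev_app_of (hev ρ').2 ha').2 hf') hb').2 hr', H⟩

end Pca

end KripkeModel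

namespace KripkeModel

variable {K : KripkeModel} {w w' : K.World} {P : Par}

/-! ## Realizability of formulas -/

/-- The environment is a dummy, since the term is closed. -/
def IsOne (w : K.World) (P : Par) (c : ℕ) : Prop := Ev w P (fun _ => c) .one c

/-- `a = b ⊩ φ` at the world `w`, where the variable `i` of `φ` has the value `v i` -/
def Rlz (P : Par) : Fml → K.World → ℕ → ℕ → (ℕ → ℕ) → Prop
  | mem x y, w, a, b, v => MemClause w P (RlzEq w P) a b (v x) (v y)
  | eq x y, w, a, b, v => RlzEq w P a b (v x) (v y)
  | conj φ ψ, w, a, b, v =>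
      OnProj w P .p₀ (fun c d => Rlz P φ w c d v) a b ∧
        OnProj w P .p₁ (fun c d => Rlz P ψ w c d v) a b
  | disj φ ψ, w, a, b, v =>
      (OnProj w P .p₀ (fun c d => IsZero w P c ∧ IsZero w P d) a b ∧
        OnProj w P .p₁ (fun c d => Rlz P φ w c d v) a b) ∨
      (OnProj w P .p₀ (fun c d => IsOne w P c ∧ IsOne w P d) a b ∧
        OnProj w P .p₁ (fun c d => Rlz P ψ w c d v) a b)
  | neg φ, w, _, _, v => ∀ w', w ≤ w' → ∀ c d, K.Mem w' c P.A → K.Mem w' d P.A →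
      ¬ Rlz P φ w' c d v
  | imp φ ψ, w, a, b, v => ∀ w', w ≤ w' → ∀ c d, K.Mem w' c P.A → K.Mem w' d P.A →
      Rlz P φ w' c d v → OnApp w' P a b c d fun r s => Rlz P ψ w' r s v
  | ball y φ, w, a, b, v => ∀ w', w ≤ w' → ∀ c d z, K.Mem w' c P.A → K.Mem w' d P.A →
      TripleMem w' c d z (v y) → OnApp w' P a b c d fun r s => Rlz P φ w' r s (scons z v)
  | bex y φ, w, a, b, v =>
      ∃ z, OnProj w P .p₀ (fun c d => TripleMem w c d z (v y)) a b ∧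
        OnProj w P .p₁ (fun c d => Rlz P φ w c d (scons z v)) a b
  | all φ, w, a, b, v => ∀ w', w ≤ w' → ∀ x, InV w' P x → Rlz P φ w' a b (scons x v)
  | ex φ, w, a, b, v => ∃ x, InV w P x ∧ Rlz P φ w a b (scons x v)

namespace Pca

/-- The bridge between the formula `rlz φ` and its meaning in the model. For implications and for
universal and bounded universal quantifiers, forcing yields a chain of worlds; persistence moves
everything to the last one. -/
theorem forces_rlz (φ : Fml) : ∀ {w : K.World} {P : Par} {σ : ℕ → ℕ} {a b : ℕ} {v : ℕ → ℕ},
    Pca w (P.map σ) →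
    (Forces w (rlz φ P a b v) σ ↔ Rlz (P.map σ) φ w (σ a) (σ b) (σ ∘ v)) := by
  have under : ∀ (z : ℕ) (σ v : ℕ → ℕ), scons z σ ∘ liftRen v = scons z (σ ∘ v) := by
    intro z σ v; funext i; cases i <;> rfl
  induction φ with
  | mem x y => exact fun h => forces_rlzMem h
  | eq x y => exact fun h => forces_rlzEq h
  | conj φ ψ ih₁ ih₂ =>
    intro w P σ a b v h
    exact and_congr
      (forces_sub₂_proj h Tm.p₀_closed fun c d _ _ =>
        ih₁ (P := P.shift 2) (σ := scons d (scons c σ)) h)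
      (forces_sub₂_proj h Tm.p₁_closed fun c d _ _ =>
        ih₂ (P := P.shift 2) (σ := scons d (scons c σ)) h)
  | disj φ ψ ih₁ ih₂ =>
    intro w P σ a b v h
    refine or_congr (and_congr ?_ ?_) (and_congr ?_ ?_)
    · exact forces_sub₂_proj h Tm.p₀_closed fun c d _ _ => and_congr forces_eval forces_eval
    · exact forces_sub₂_proj h Tm.p₁_closed fun c d _ _ =>
        ih₁ (P := P.shift 2) (σ := scons d (scons c σ)) h
    · exact forces_sub₂_proj h Tm.p₀_closed fun c d _ _ => and_congr forces_eval forces_eval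
    · exact forces_sub₂_proj h Tm.p₁_closed fun c d _ _ =>
        ih₂ (P := P.shift 2) (σ := scons d (scons c σ)) h
  | neg φ ih =>
    intro w P σ a b v h
    have key : ∀ w', w ≤ w' → ∀ c d, Forces w' (rlz φ (P.shift 2) 1 0 fun i => v i + 2)
        (scons d (scons c σ)) ↔ Rlz (P.map σ) φ w' c d (σ ∘ v) := fun w' hw c d =>
      ih (P := P.shift 2) (σ := scons d (scons c σ)) (h.mono hw)
    constructor
    · intro H w' hw c d hc hd hr
      exact H w' hw c hc w' le_rfl d hd w' le_rfl ((key w' hw c d).2 hr)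
    · intro H w₁ h₁ c hc w₂ h₂ d hd w₃ h₃ hr
      have hw := h₁.trans (h₂.trans h₃)
      exact H w₃ hw c d (K.mem_mono (h₂.trans h₃) hc) (K.mem_mono h₃ hd) ((key w₃ hw c d).1 hr)
  | imp φ ψ ih₁ ih₂ =>
    intro w P σ a b v h
    have key₁ : ∀ w', w ≤ w' → ∀ c d, Forces w' (rlz φ (P.shift 2) 1 0 fun i => v i + 2)
        (scons d (scons c σ)) ↔ Rlz (P.map σ) φ w' c d (σ ∘ v) := fun w' hw c d =>
      ih₁ (P := P.shift 2) (σ := scons d (scons c σ)) (h.mono hw)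
    have key₂ : ∀ w', w ≤ w' → ∀ c d, Forces w' ((P.shift 2).sub₂ (.ap (a + 2) 1) (.ap (b + 2) 0)
        (rlz ψ (P.shift 4) 1 0 fun i => v i + 4)) (scons d (scons c σ)) ↔
        OnApp w' (P.map σ) (σ a) (σ b) c d fun r s => Rlz (P.map σ) ψ w' r s (σ ∘ v) :=
      fun w' hw c d => forces_sub₂_ap (P := P.shift 2) (σ := scons d (scons c σ)) (h.mono hw)
        fun r s _ _ => ih₂ (P := P.shift 4) (σ := scons s (scons r (scons d (scons c σ))))
          (h.mono hw)
    constructor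
    · intro H w' hw c d hc hd hr
      exact (key₂ w' hw c d).1 (H w' hw c hc w' le_rfl d hd w' le_rfl ((key₁ w' hw c d).2 hr))
    · intro H w₁ h₁ c hc w₂ h₂ d hd w₃ h₃ hr
      have hw := h₁.trans (h₂.trans h₃)
      exact (key₂ w₃ hw c d).2 (H w₃ hw c d (K.mem_mono (h₂.trans h₃) hc) (K.mem_mono h₃ hd)
        ((key₁ w₃ hw c d).1 hr))
  | ball y φ ih =>
    intro w P σ a b v h
    refine forces_ball_ball_all (fun w a b z H => TripleMem.ex H |>.2.2.1)
      (fun _ _ _ _ _ => Iff.rfl) fun w' hw c d z => ?_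
    refine forces_sub₂_ap (P := P.shift 3) (σ := scons z (scons d (scons c σ))) (h.mono hw)
      fun r s _ _ => ?_
    refine (ih (P := P.shift 5) (σ := scons s (scons r (scons z (scons d (scons c σ)))))
      (h.mono hw)).trans (iff_of_eq (congrArg _ ?_))
    funext i; cases i <;> rfl
  | bex y φ ih =>
    intro w P σ a b v h
    have key : ∀ z, (Forces w ((P.shift 1).sub₂ (.fst (a + 1)) (.fst (b + 1))
        (tripleMem 1 0 2 (v y + 3))) (scons z σ) ∧
        Forces w ((P.shift 1).sub₂ (.snd (a + 1)) (.snd (b + 1))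
          (rlz φ (P.shift 3) 1 0 (fun | 0 => 2 | i + 1 => v i + 3))) (scons z σ)) ↔
        (OnProj w (P.map σ) .p₀ (fun c d => TripleMem w c d z (σ (v y))) (σ a) (σ b) ∧
          OnProj w (P.map σ) .p₁ (fun c d => Rlz (P.map σ) φ w c d (scons z (σ ∘ v)))
            (σ a) (σ b)) := fun z =>
      and_congr
        (forces_sub₂_proj (P := P.shift 1) (σ := scons z σ) h Tm.p₀_closed
          fun _ _ _ _ => Iff.rfl)
        (forces_sub₂_proj (P := P.shift 1) (σ := scons z σ) h Tm.p₁_closed fun c d _ _ =>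
          (ih (P := P.shift 3) (σ := scons d (scons c (scons z σ))) h).trans
            (iff_of_eq (congrArg _ (by funext i; cases i <;> rfl))))
    constructor
    · rintro ⟨z, -, H⟩
      exact ⟨z, (key z).1 H⟩
    · rintro ⟨z, H⟩
      obtain ⟨c, d, -, -, ht⟩ := H.1
      exact ⟨z, ht.ex.2.2.1, (key z).2 H⟩
  | all φ ih =>
    intro w P σ a b v h
    have key : ∀ w', w ≤ w' → ∀ x, Forces w' (rlz φ (P.shift 1) (a + 1) (b + 1) (liftRen v))
        (scons x σ) ↔ Rlz (P.map σ) φ w' (σ a) (σ b) (scons x (σ ∘ v)) := fun w' hw x =>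
      (ih (P := P.shift 1) (σ := scons x σ) (h.mono hw)).trans
        (iff_of_eq (congrArg _ (under x σ v)))
    constructor
    · intro H w' hw x hx
      exact (key w' hw x).1 (H w' hw x hx.ex w' le_rfl hx)
    · intro H w₁ h₁ x _ w₂ h₂ hx
      exact (key w₂ (h₁.trans h₂) x).2 (H w₂ (h₁.trans h₂) x hx)
  | ex φ ih =>
    intro w P σ a b v h
    have key : ∀ x, Forces w (rlz φ (P.shift 1) (a + 1) (b + 1) (liftRen v))
        (scons x σ) ↔ Rlz (P.map σ) φ w (σ a) (σ b) (scons x (σ ∘ v)) := fun x =>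
      (ih (P := P.shift 1) (σ := scons x σ) h).trans (iff_of_eq (congrArg _ (under x σ v)))
    constructor
    · rintro ⟨x, -, hx, H⟩
      exact ⟨x, hx, (key x).1 H⟩
    · rintro ⟨x, hx, H⟩
      exact ⟨x, InV.ex hx, hx, (key x).2 H⟩

end Pca

theorem OnProj.mono {p : Tm} {Φ Ψ : ℕ → ℕ → Prop} {a a' : ℕ} (h : OnProj w P p Φ a a')
    (hw : w ≤ w') (H : ∀ c c', Φ c c' → Ψ c c') : OnProj w' P p Ψ a a' := by
  obtain ⟨c, c', h₁, h₂, h₃⟩ := h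
  exact ⟨c, c', h₁.mono hw, h₂.mono hw, H _ _ h₃⟩

theorem Rlz.mono {φ : Fml} : ∀ {w w' : K.World} {a b : ℕ} {v : ℕ → ℕ}, Rlz P φ w a b v →
    w ≤ w' → Rlz P φ w' a b v := by
  induction φ with
  | mem x y =>
    rintro w w' a b v ⟨z, h₁, h₂⟩ hw
    exact ⟨z, h₁.mono hw fun c d H => H.mono hw, h₂.mono hw fun c d H => H.mono hw⟩
  | eq x y => exact fun h hw => RlzEq.mono h hw
  | conj φ ψ ih₁ ih₂ =>
    exact fun h hw => ⟨h.1.mono hw fun _ _ H => ih₁ H hw, h.2.mono hw fun _ _ H => ih₂ H hw⟩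
  | disj φ ψ ih₁ ih₂ =>
    have up : ∀ {w w' : K.World} {ρ : ℕ → ℕ} {t : Tm} {c : ℕ}, w ≤ w' → Ev w P ρ t c →
        Ev w' P ρ t c := fun hw H => Pca.ev_mono hw H
    rintro w w' a b v (⟨h₁, h₂⟩ | ⟨h₁, h₂⟩) hw
    · exact Or.inl ⟨h₁.mono hw fun c d H => ⟨up (ρ := id) (t := .zero) hw H.1,
        up (ρ := id) (t := .zero) hw H.2⟩, h₂.mono hw fun _ _ H => ih₁ H hw⟩
    · exact Or.inr ⟨h₁.mono hw fun c d H => ⟨up hw H.1, up hw H.2⟩,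
        h₂.mono hw fun _ _ H => ih₂ H hw⟩
  | neg φ ih => exact fun h hw w'' hw' => h w'' (hw.trans hw')
  | imp φ ψ ih₁ ih₂ => exact fun h hw w'' hw' => h w'' (hw.trans hw')
  | ball y φ ih => exact fun h hw w'' hw' => h w'' (hw.trans hw')
  | bex y φ ih =>
    rintro w w' a b v ⟨z, h₁, h₂⟩ hw
    exact ⟨z, h₁.mono hw fun c d H => H.mono hw, h₂.mono hw fun c d H => ih H hw⟩
  | all φ ih => exact fun h hw w'' hw' => h w'' (hw.trans hw')
  | ex φ ih => exact fun ⟨x, hx, h⟩ hw => ⟨x, hx.mono hw, ih h hw⟩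

theorem rlz_rename (φ : Fml) : ∀ {w : K.World} {a b : ℕ} {v ρ : ℕ → ℕ},
    Rlz P (φ.rename ρ) w a b v ↔ Rlz P φ w a b (v ∘ ρ) := by
  have key : ∀ (ρ v : ℕ → ℕ) (c : ℕ), scons c v ∘ liftRen ρ = scons c (v ∘ ρ) := by
    intro ρ v c; funext i; cases i <;> rfl
  induction φ <;> intro w a b v ρ <;> simp_all [Fml.rename, Rlz]

theorem rlz_inst {φ : Fml} {x a b : ℕ} {v : ℕ → ℕ} :
    Rlz P (φ.inst x) w a b v ↔ Rlz P φ w a b (scons (v x) v) := by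
  rw [inst, rlz_rename, show v ∘ instRen x = scons (v x) v by funext i; cases i <;> rfl]

theorem rlz_lift {φ : Fml} {x a b : ℕ} {v : ℕ → ℕ} :
    Rlz P φ.lift w a b (scons x v) ↔ Rlz P φ w a b v := rlz_rename φ

/-- Obtained from invariance under renaming rather than by another induction: two renamings that
agree on the free variables give the same formula. -/
theorem rlz_agree {φ : Fml} {n : ℕ} (hφ : φ.Supp (· < n)) {a b : ℕ} {v v' : ℕ → ℕ}
    (H : ∀ i < n, v i = v' i) : Rlz P φ w a b v ↔ Rlz P φ w a b v' := by
  -- The two assignments are interleaved, `v` at even and `v'` at odd positions, so that each arises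
  -- from `u` by a renaming.
  let u : ℕ → ℕ := fun i => if i % 2 = 0 then v (i / 2) else v' (i / 2)
  have e := hφ.rename_congr (ρ := fun i => 2 * i) (τ := fun i => if i < n then 2 * i else 2 * i + 1)
    fun i hi => by simp only [if_pos (show i < n from hi)]
  have h₁ : u ∘ (fun i => 2 * i) = v := by funext i; simp [u]
  have h₂ : u ∘ (fun i => if i < n then 2 * i else 2 * i + 1) = v' := by
    funext i
    by_cases hi : i < n
    · simp [u, hi, H i hi]
    · have : (2 * i + 1) / 2 = i := by omega
      simp [u, hi, this]
  rw [← h₁, ← h₂, ← rlz_rename, ← rlz_rename, e]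

namespace Pca

variable {ρ ρ' : ℕ → ℕ} {t u q : Tm} {Φ Ψ : ℕ → ℕ → Prop}

/-- Application is strict, so the branch not taken must have a value too; a definition by cases is
therefore applied to abstractions, which always have one. -/
theorem onEv_cases_zero (h : Pca w P) (hρ : ∀ i, K.Mem w (ρ i) P.A)
    (hρ' : ∀ i, K.Mem w (ρ' i) P.A)
    (Ht : OnEv w P ρ ρ' t fun c d => IsZero w P c ∧ IsZero w P d) (Hu : OnEv w P ρ ρ' u Φ)
    (Hs : OnEv w P ρ ρ' q Ψ) : OnEv w P ρ ρ' (.cases t u q) Φ := by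
  obtain ⟨z, z', h₁, h₁', hz, hz'⟩ := Ht
  obtain ⟨a, a', h₂, h₂', H⟩ := Hu
  obtain ⟨b, b', h₃, h₃', -⟩ := Hs
  exact ⟨a, a', h.ev_cases_zero hρ hz h₁ h₂ h₃, h.ev_cases_zero hρ' hz' h₁' h₂' h₃', H⟩

theorem onEv_cases_one (h : Pca w P) (hρ : ∀ i, K.Mem w (ρ i) P.A)
    (hρ' : ∀ i, K.Mem w (ρ' i) P.A)
    (Ht : OnEv w P ρ ρ' t fun c d => IsOne w P c ∧ IsOne w P d) (Hu : OnEv w P ρ ρ' u Ψ)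
    (Hs : OnEv w P ρ ρ' q Φ) : OnEv w P ρ ρ' (.cases t u q) Φ := by
  obtain ⟨z, z', h₁, h₁', hz, hz'⟩ := Ht
  obtain ⟨a, a', h₂, h₂', -⟩ := Hu
  obtain ⟨b, b', h₃, h₃', H⟩ := Hs
  exact ⟨b, b', h.ev_cases_one hρ hz h₁ h₂ h₃, h.ev_cases_one hρ' hz' h₁' h₂' h₃', H⟩

theorem ev_beta₂ (h : Pca w P) (hρ : ∀ i, K.Mem w (ρ i) P.A) {x y : ℕ} {a b r : ℕ}
    (ht : Ev w P ρ t a) (hu : Ev w P ρ u b)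
    (hr : Ev w P (Function.update (Function.update ρ x a) y b) q r) :
    Ev w P ρ (.app (.app (.lam x (.lam y q)) t) u) r := by
  have ha := h.ev_mem hρ ht
  obtain ⟨f, hf, Hf⟩ := h.ev_lam (update_mem hρ x ha) y q
  exact (h.ev_app_of ((h.ev_beta hρ ht).2 hf) hu).2 ((Hf b r (h.ev_mem hρ hu)).2 hr)

theorem onEv_beta₂ (h : Pca w P) (hρ : ∀ i, K.Mem w (ρ i) P.A)
    (hρ' : ∀ i, K.Mem w (ρ' i) P.A) {x y : ℕ} {Θ : ℕ → ℕ → Prop} (Ht : OnEv w P ρ ρ' t Φ)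
    (Hu : OnEv w P ρ ρ' u Ψ)
    (Hs : ∀ a a' b b', K.Mem w a P.A → K.Mem w a' P.A → K.Mem w b P.A → K.Mem w b' P.A →
      Φ a a' → Ψ b b' → OnEv w P (Function.update (Function.update ρ x a) y b)
        (Function.update (Function.update ρ' x a') y b') q Θ) :
    OnEv w P ρ ρ' (.app (.app (.lam x (.lam y q)) t) u) Θ := by
  obtain ⟨a, a', ha, ha', Ht⟩ := Ht
  obtain ⟨b, b', hb, hb', Hu⟩ := Hu
  obtain ⟨r, r', hr, hr', H⟩ := Hs a a' b b' (h.ev_mem hρ ha) (h.ev_mem hρ' ha')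
    (h.ev_mem hρ hb) (h.ev_mem hρ' hb') Ht Hu
  exact ⟨r, r', h.ev_beta₂ hρ ha hb hr, h.ev_beta₂ hρ' ha' hb' hr', H⟩

theorem onEv_var_mem {i : ℕ} (hi : K.Mem w (ρ i) P.A) (hi' : K.Mem w (ρ' i) P.A)
    (H : Φ (ρ i) (ρ' i)) : OnEv w P ρ ρ' (.var i) Φ :=
  onEv_var (K.mem_ex hi).1 (K.mem_ex hi').1 H

theorem onEv_disj_left (h : Pca w P) (hρ : ∀ i, K.Mem w (ρ i) P.A)
    (hρ' : ∀ i, K.Mem w (ρ' i) P.A) {φ ψ : Fml} {v : ℕ → ℕ}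
    (Ht : OnEv w P ρ ρ' t fun c d => IsZero w P c ∧ IsZero w P d)
    (Hu : OnEv w P ρ ρ' u fun c d => Rlz P φ w c d v) :
    OnEv w P ρ ρ' (.pair t u) fun c d => Rlz P (disj φ ψ) w c d v :=
  (h.onEv_pair hρ hρ' Ht Hu).imp fun _ _ H => Or.inl H

theorem onEv_disj_right (h : Pca w P) (hρ : ∀ i, K.Mem w (ρ i) P.A)
    (hρ' : ∀ i, K.Mem w (ρ' i) P.A) {φ ψ : Fml} {v : ℕ → ℕ}
    (Ht : OnEv w P ρ ρ' t fun c d => IsOne w P c ∧ IsOne w P d)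
    (Hu : OnEv w P ρ ρ' u fun c d => Rlz P ψ w c d v) :
    OnEv w P ρ ρ' (.pair t u) fun c d => Rlz P (disj φ ψ) w c d v :=
  (h.onEv_pair hρ hρ' Ht Hu).imp fun _ _ H => Or.inr H

/-- A realized disjunction is realized on the left or on the right. -/
theorem onEv_disj_elim (h : Pca w P) {φ ψ : Fml} {v : ℕ → ℕ}
    (H : OnEv w P ρ ρ' t fun c d => Rlz P (disj φ ψ) w c d v) :
    ((OnEv w P ρ ρ' (.app .p₀ t) fun c d => IsZero w P c ∧ IsZero w P d) ∧
      OnEv w P ρ ρ' (.app .p₁ t) fun c d => Rlz P φ w c d v) ∨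
    ((OnEv w P ρ ρ' (.app .p₀ t) fun c d => IsOne w P c ∧ IsOne w P d) ∧
      OnEv w P ρ ρ' (.app .p₁ t) fun c d => Rlz P ψ w c d v) := by
  obtain ⟨c, d, hc, hd, H | H⟩ := H
  · exact Or.inl ⟨h.onEv_p₀ ⟨c, d, hc, hd, H.1⟩, h.onEv_p₁ ⟨c, d, hc, hd, H.2⟩⟩
  · exact Or.inr ⟨h.onEv_p₀ ⟨c, d, hc, hd, H.1⟩, h.onEv_p₁ ⟨c, d, hc, hd, H.2⟩⟩

end Pca

end KripkeModel

namespace KripkeModel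

variable {K : KripkeModel} {w w' : K.World} {P : Par}

namespace Pca

variable {ρ ρ' v : ℕ → ℕ} {t u : Tm} {φ ψ : Fml} {Φ Ψ : ℕ → ℕ → Prop}

/-! ## The introduction and elimination of realizers -/

/-- Realizability is the forcing of a formula in which `a`, `b`, the structure and the parameters
are variables. Membership of the parameters in the universe ensures that they exist at `w` and hence
are equal to themselves. -/
theorem rlz_congr (h : Pca w P) (hv : ∀ i, InV w P (v i)) {a b a' b' : ℕ} (ha : K.Eq w a a')
    (hb : K.Eq w b b') (H : Rlz P φ w a b v) : Rlz P φ w a' b' v := by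
  -- Two realizers and the eight components of the structure come first, which is why the parameters
  -- start at position `10`.
  let σ : ℕ → ℕ → ℕ → ℕ := fun a b => scons a (scons b (scons P.A (scons P.app (scons P.k
    (scons P.s (scons P.succ (scons P.pred (scons P.d (scons P.num v)))))))))
  have key : ∀ a b, Forces w (rlz φ (stdPar.shift 2) 0 1 fun i => i + 10) (σ a b) ↔
      Rlz P φ w a b v := fun a b =>
    forces_rlz φ (P := stdPar.shift 2) (σ := σ a b) (v := fun i => i + 10) h
  have e : ∀ i, K.Eq w (P.env i) (P.env i) := fun i => K.eq_refl (h.env i)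
  refine (key a' b').1 (Forces.congr ?_ ((key a b).2 H))
  exact eq_scons ha (eq_scons hb (eq_scons (e 0) (eq_scons (e 1) (eq_scons (e 2) (eq_scons (e 3)
    (eq_scons (e 4) (eq_scons (e 5) (eq_scons (e 6) (eq_scons (e 7)
      fun i => K.eq_refl (hv i).ex)))))))))

theorem onEv_mono (H : OnEv w P ρ ρ' t Φ) (hw : w ≤ w') (HΦ : ∀ c d, Φ c d → Ψ c d) :
    OnEv w' P ρ ρ' t Ψ := by
  obtain ⟨c, c', hc, hc', H⟩ := H
  exact ⟨c, c', ev_mono hw hc, ev_mono hw hc', HΦ _ _ H⟩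

theorem onEv_update {n m c c' : ℕ} (ht : t.Below n) (hn : n ≤ m) (H : OnEv w P ρ ρ' t Φ) :
    OnEv w P (Function.update ρ m c) (Function.update ρ' m c') t Φ :=
  onEv_agree ht (fun i hi => (Function.update_of_ne (by omega) _ _).symm)
    (fun i hi => (Function.update_of_ne (by omega) _ _).symm) H

theorem onEv_update_self {n c c' : ℕ} (hc : K.Mem w c P.A) (hc' : K.Mem w c' P.A) (H : Φ c c') :
    OnEv w P (Function.update ρ n c) (Function.update ρ' n c') (.var n) Φ :=
  ⟨c, c', by simpa [Ev] using refl_of_mem hc, by simpa [Ev] using refl_of_mem hc', H⟩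

theorem onEv_imp_intro (h : Pca w P) (hρ : ∀ i, K.Mem w (ρ i) P.A)
    (hρ' : ∀ i, K.Mem w (ρ' i) P.A) {n : ℕ} (H : ∀ w', w ≤ w' → ∀ c d, K.Mem w' c P.A →
      K.Mem w' d P.A → Rlz P φ w' c d v → OnEv w' P (Function.update ρ n c)
        (Function.update ρ' n d) t fun a b => Rlz P ψ w' a b v) :
    OnEv w P ρ ρ' (t.lam n) fun a b => Rlz P (imp φ ψ) w a b v :=
  (h.onEv_lam hρ hρ' n t).imp fun _ _ Hf w' hw c d hc hd hr =>
    Hf w' hw c d _ hc hd (H w' hw c d hc hd hr)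

theorem onEv_imp_elim (h : Pca w P) (hρ : ∀ i, K.Mem w (ρ i) P.A)
    (hρ' : ∀ i, K.Mem w (ρ' i) P.A) (Ht : OnEv w P ρ ρ' t fun a b => Rlz P (imp φ ψ) w a b v)
    (Hu : OnEv w P ρ ρ' u fun a b => Rlz P φ w a b v) :
    OnEv w P ρ ρ' (.app t u) fun a b => Rlz P ψ w a b v :=
  h.onEv_app (Ht.imp fun _ _ Hf => (h.onEv_mem hρ hρ' Hu).imp fun c d H =>
    Hf w le_rfl c d H.1 H.2.1 H.2.2)

theorem onEv_ball_intro (h : Pca w P) (hρ : ∀ i, K.Mem w (ρ i) P.A)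
    (hρ' : ∀ i, K.Mem w (ρ' i) P.A) {n y : ℕ} (H : ∀ w', w ≤ w' → ∀ c d z, K.Mem w' c P.A →
      K.Mem w' d P.A → TripleMem w' c d z (v y) → OnEv w' P (Function.update ρ n c)
        (Function.update ρ' n d) t fun a b => Rlz P φ w' a b (scons z v)) :
    OnEv w P ρ ρ' (t.lam n) fun a b => Rlz P (ball y φ) w a b v :=
  (h.onEv_lam hρ hρ' n t).imp fun _ _ Hf w' hw c d z hc hd hz =>
    Hf w' hw c d _ hc hd (H w' hw c d z hc hd hz)

theorem onEv_ball_elim (h : Pca w P) (hρ : ∀ i, K.Mem w (ρ i) P.A)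
    (hρ' : ∀ i, K.Mem w (ρ' i) P.A) {y z : ℕ}
    (Ht : OnEv w P ρ ρ' t fun a b => Rlz P (ball y φ) w a b v)
    (Hu : OnEv w P ρ ρ' u fun a b => TripleMem w a b z (v y)) :
    OnEv w P ρ ρ' (.app t u) fun a b => Rlz P φ w a b (scons z v) :=
  h.onEv_app (Ht.imp fun _ _ Hf => (h.onEv_mem hρ hρ' Hu).imp fun c d H =>
    Hf w le_rfl c d z H.1 H.2.1 H.2.2)

theorem onEv_bex_intro (h : Pca w P) (hρ : ∀ i, K.Mem w (ρ i) P.A)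
    (hρ' : ∀ i, K.Mem w (ρ' i) P.A) {y z : ℕ}
    (Ht : OnEv w P ρ ρ' t fun a b => TripleMem w a b z (v y))
    (Hu : OnEv w P ρ ρ' u fun a b => Rlz P φ w a b (scons z v)) :
    OnEv w P ρ ρ' (.pair t u) fun a b => Rlz P (bex y φ) w a b v :=
  (h.onEv_pair hρ hρ' Ht Hu).imp fun _ _ H => ⟨z, H⟩

theorem onEv_bex_elim (h : Pca w P) {y : ℕ}
    (H : OnEv w P ρ ρ' t fun a b => Rlz P (bex y φ) w a b v) :
    ∃ z, (OnEv w P ρ ρ' (.app .p₀ t) fun a b => TripleMem w a b z (v y)) ∧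
      OnEv w P ρ ρ' (.app .p₁ t) fun a b => Rlz P φ w a b (scons z v) := by
  obtain ⟨a, b, ha, hb, z, H₁, H₂⟩ := H
  exact ⟨z, h.onEv_p₀ ⟨a, b, ha, hb, H₁⟩, h.onEv_p₁ ⟨a, b, ha, hb, H₂⟩⟩

/-- One pair of values has to realize all instances. The values of `t` depend neither on `x` nor, up
to equality, on the world, so those found for a single element of the universe serve for all. -/
theorem onEv_all_intro (h : Pca w P) (hv : ∀ i, InV w P (v i))
    (H : ∀ w', w ≤ w' → ∀ x, InV w' P x →
      OnEv w' P ρ ρ' t fun a b => Rlz P φ w' a b (scons x v)) :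
    OnEv w P ρ ρ' t fun a b => Rlz P (all φ) w a b v := by
  obtain ⟨x, hx⟩ := h.exists_inV
  obtain ⟨a, b, ha, hb, -⟩ := H w le_rfl x hx
  refine ⟨a, b, ha, hb, fun w' hw x hx => ?_⟩
  obtain ⟨a', b', ha', hb', H⟩ := H w' hw x hx
  have h' := h.mono hw
  refine h'.rlz_congr ?_ (h'.ev_unique ha' (ev_mono hw ha)) (h'.ev_unique hb' (ev_mono hw hb)) H
  rintro (_ | i)
  · exact hx
  · exact (hv i).mono hw

theorem onEv_of_tripleMem {y z : ℕ} (hy : InV w P y)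
    (H : OnEv w P ρ ρ' t fun a b => TripleMem w a b z y) : InV w P z := by
  obtain ⟨a, b, -, -, H⟩ := H
  exact (hy.of_tripleMem H).2.2

end Pca

/-! ## The substitution of equals -/

/-- Assignments that differ at `j` only are related by the given realizer at `j` and by reflexivity
elsewhere. -/
def eqAt (j i : ℕ) : Tm := if i = j then .var 0 else reflTm

/-- A body in the variables `0` and `1` becomes a closed term, which can be called in any
environment; this is how the clauses of `substBody` refer to subformulas. -/
def substLam (t : Tm) : Tm := .lam 0 (.lam 1 t)

def substApp (f t u : Tm) : Tm := .app (.app (substLam f) t) u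

/-- If the variable `0` realizes `x = x'` and the variable `1` realizes `φ`, where the variable `j`
of `φ` is `x`, then this term realizes `φ` where the variable `j` is `x'`. -/
def substBody : Fml → ℕ → Tm
  | mem i k, j =>
      let q := .app .p₀ (.app (eqAt j k) (.app .p₀ (.var 1)))
      .pair (.app .p₀ q) (.app (.app transTm (.app symmTm (eqAt j i)))
        (.app (.app transTm (.app .p₁ (.var 1))) (.app .p₁ q)))
  | eq i k, j => .app (.app transTm (.app symmTm (eqAt j i)))
      (.app (.app transTm (.var 1)) (eqAt j k))
  | conj φ ψ, j => .pair (substApp (substBody φ j) (.var 0) (.app .p₀ (.var 1)))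
      (substApp (substBody ψ j) (.var 0) (.app .p₁ (.var 1)))
  | disj φ ψ, j => .pair (.app .p₀ (.var 1)) (.app (.app (.cases (.app .p₀ (.var 1))
      (substLam (substBody φ j)) (substLam (substBody ψ j))) (.var 0)) (.app .p₁ (.var 1)))
  | neg _, _ => .var 1
  | imp φ ψ, j => .lam 2 (substApp (substBody ψ j) (.var 0)
      (.app (.var 1) (substApp (substBody φ j) (.app symmTm (.var 0)) (.var 2))))
  | ball k φ, j =>
      let q := .app .p₁ (.app (eqAt j k) (.var 2))
      .lam 2 (substApp (substBody φ 0) (.app symmTm (.app .p₁ q))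
        (substApp (substBody φ (j + 1)) (.var 0) (.app (.var 1) (.app .p₀ q))))
  | bex k φ, j =>
      let q := .app .p₀ (.app (eqAt j k) (.app .p₀ (.var 1)))
      .pair (.app .p₀ q) (substApp (substBody φ 0) (.app .p₁ q)
        (substApp (substBody φ (j + 1)) (.var 0) (.app .p₁ (.var 1))))
  | all φ, j => substApp (substBody φ (j + 1)) (.var 0) (.var 1)
  | ex φ, j => substApp (substBody φ (j + 1)) (.var 0) (.var 1)

theorem eqAt_below (j i : ℕ) {n : ℕ} (hn : 0 < n) : (eqAt j i).Below n := by
  unfold eqAt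
  split
  · exact hn
  · exact reflTm_closed.below n

theorem substLam_closed {t : Tm} (ht : t.Below 2) : (substLam t).Closed :=
  Tm.below_zero_iff.1 (Tm.Below.lam (Tm.Below.lam ht))

theorem substApp_below {f t u : Tm} {n : ℕ} (hf : f.Below 2) (ht : t.Below n) (hu : u.Below n) :
    (substApp f t u).Below n :=
  ⟨⟨(substLam_closed hf).below n, ht⟩, hu⟩

theorem substBody_below (φ : Fml) : ∀ j, (substBody φ j).Below 2 := by
  have c₀ := Tm.p₀_closed.below
  have c₁ := Tm.p₁_closed.below
  have cp := Tm.pr_closed.below 2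
  have cs := symmTm_closed.below
  have ct := transTm_closed.below 2
  have v₀ : (Tm.var 0).Below 2 := Nat.zero_lt_two
  have v₁ : (Tm.var 1).Below 2 := Nat.one_lt_two
  have e₂ := fun j i => eqAt_below j i (n := 2) (by omega)
  have e₃ := fun j i => eqAt_below j i (n := 3) (by omega)
  induction φ with
  | mem i k =>
    exact fun j => ⟨⟨cp, c₀ _, c₀ _, e₂ _ _, c₀ _, v₁⟩, ⟨ct, cs _, e₂ _ _⟩,
      ⟨ct, c₁ _, v₁⟩, c₁ _, c₀ _, e₂ _ _, c₀ _, v₁⟩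
  | eq i k => exact fun j => ⟨⟨ct, cs _, e₂ _ _⟩, ⟨ct, v₁⟩, e₂ _ _⟩
  | conj φ ψ ih₁ ih₂ =>
    exact fun j => ⟨⟨cp, substApp_below (ih₁ j) v₀ ⟨c₀ _, v₁⟩⟩,
      substApp_below (ih₂ j) v₀ ⟨c₁ _, v₁⟩⟩
  | disj φ ψ ih₁ ih₂ =>
    exact fun j => ⟨⟨cp, c₀ _, v₁⟩, ⟨⟨⟨⟨⟨trivial, trivial⟩, c₀ _, v₁⟩,
      (substLam_closed (ih₁ j)).below 2⟩, (substLam_closed (ih₂ j)).below 2⟩, v₀⟩, c₁ _, v₁⟩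
  | neg φ ih => exact fun _ => v₁
  | imp φ ψ ih₁ ih₂ =>
    exact fun j => Tm.Below.lam (substApp_below (ih₂ j) (v₀.mono (by omega))
      ⟨v₁.mono (by omega), substApp_below (ih₁ j) ⟨cs _, v₀.mono (by omega)⟩ (Nat.lt_succ_self 2)⟩)
  | ball k φ ih =>
    have q := fun j => And.intro (c₁ 3) (And.intro (e₃ j k) (Nat.lt_succ_self 2))
    exact fun j => Tm.Below.lam (substApp_below (ih 0) ⟨cs _, c₁ _, q j⟩
      (substApp_below (ih (j + 1)) (v₀.mono (by omega)) ⟨v₁.mono (by omega), c₀ _, q j⟩))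
  | bex k φ ih =>
    have q := fun j => And.intro (c₀ 2) (And.intro (e₂ j k) (And.intro (c₀ 2) v₁))
    exact fun j => ⟨⟨cp, c₀ _, q j⟩, substApp_below (ih 0) ⟨c₁ _, q j⟩
      (substApp_below (ih (j + 1)) v₀ ⟨c₁ _, v₁⟩)⟩
  | all φ ih => exact fun j => substApp_below (ih (j + 1)) v₀ v₁
  | ex φ ih => exact fun j => substApp_below (ih (j + 1)) v₀ v₁

/-- The term `f` transforms realizers `t` of `x = x'` and `u` of `φ`, where the variable `j` of `φ` is
`x`, to a realizer of `φ` where the variable `j` is `x'`. -/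
def Substitutes (w : K.World) (P : Par) (ρ ρ' : ℕ → ℕ) (φ : Fml) (j : ℕ) (t u f : Tm) : Prop :=
  ∀ v v' : ℕ → ℕ, (∀ i, InV w P (v i)) → (∀ i, InV w P (v' i)) → (∀ i, i ≠ j → v i = v' i) →
    (OnEv w P ρ ρ' t fun a b => RlzEq w P a b (v j) (v' j)) →
    (OnEv w P ρ ρ' u fun a b => Rlz P φ w a b v) → OnEv w P ρ ρ' f fun a b => Rlz P φ w a b v'

theorem inV_scons {x : ℕ} {v : ℕ → ℕ} (hx : InV w P x) (hv : ∀ i, InV w P (v i)) :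
    ∀ i, InV w P (scons x v i) := by
  rintro (_ | i)
  · exact hx
  · exact hv i

theorem scons_agree {v v' : ℕ → ℕ} {j : ℕ} (x : ℕ) (H : ∀ i, i ≠ j → v i = v' i) :
    ∀ i, i ≠ j + 1 → scons x v i = scons x v' i := by
  rintro (_ | i) hi
  · rfl
  · exact H i (by omega)

theorem scons_agree_zero {v : ℕ → ℕ} (x x' : ℕ) : ∀ i, i ≠ 0 → scons x v i = scons x' v i := by
  rintro (_ | i) hi
  · exact absurd rfl hi
  · rfl

namespace Pca

variable {ρ ρ' v v' : ℕ → ℕ} {t u : Tm} {φ : Fml}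

theorem onEv_eqAt (h : Pca w P) {j : ℕ} (hv : ∀ i, InV w P (v i))
    (hne : ∀ i, i ≠ j → v i = v' i)
    (H : OnEv w P ρ ρ' (.var 0) fun a b => RlzEq w P a b (v j) (v' j)) (i : ℕ) :
    OnEv w P ρ ρ' (eqAt j i) fun a b => RlzEq w P a b (v i) (v' i) := by
  by_cases hi : i = j
  · rw [eqAt, if_pos hi, hi]
    exact H
  · rw [eqAt, if_neg hi, ← hne i hi]
    exact h.onEv_refl (hv i)

theorem substitutes_substApp (h : Pca w P) (hρ : ∀ i, K.Mem w (ρ i) P.A)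
    (hρ' : ∀ i, K.Mem w (ρ' i) P.A) {j : ℕ} {f : Tm}
    (H : ∀ {ρ ρ' : ℕ → ℕ}, (∀ i, K.Mem w (ρ i) P.A) → (∀ i, K.Mem w (ρ' i) P.A) →
      Substitutes w P ρ ρ' φ j (.var 0) (.var 1) f) :
    Substitutes w P ρ ρ' φ j t u (substApp f t u) := by
  intro v v' hv hv' hne Ht Hu
  refine h.onEv_beta₂ hρ hρ' Ht Hu fun a a' b b' ha ha' hb hb' Ht Hu => ?_
  exact H (update_mem (update_mem hρ 0 ha) 1 hb) (update_mem (update_mem hρ' 0 ha') 1 hb') v v'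
    hv hv' hne (onEv_update (n := 1) Nat.zero_lt_one le_rfl (onEv_update_self ha ha' Ht))
    (onEv_update_self hb hb' Hu)

/-- By induction on the formula, for all positions `j`. Symmetry reverses the equality in negative
places. At a bounded quantifier, an element of one bound corresponds in the other only to an element
realized equal to it. So the body is transported twice: at `j + 1` for the given equality, and at
`0` for the equality of the elements. Unbounded quantifiers leave the realizer of the instances
unchanged. -/
theorem substitutes_substBody (φ : Fml) : ∀ {w : K.World}, Pca w P → ∀ {ρ ρ' : ℕ → ℕ},
    (∀ i, K.Mem w (ρ i) P.A) → (∀ i, K.Mem w (ρ' i) P.A) → ∀ {j},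
      Substitutes w P ρ ρ' φ j (.var 0) (.var 1) (substBody φ j) := by
  have call : ∀ {φ : Fml}, (∀ {w : K.World}, Pca w P → ∀ {ρ ρ' : ℕ → ℕ},
      (∀ i, K.Mem w (ρ i) P.A) → (∀ i, K.Mem w (ρ' i) P.A) → ∀ {j},
      Substitutes w P ρ ρ' φ j (.var 0) (.var 1) (substBody φ j)) →
      ∀ {w : K.World}, Pca w P → ∀ {ρ ρ' : ℕ → ℕ}, (∀ i, K.Mem w (ρ i) P.A) →
      (∀ i, K.Mem w (ρ' i) P.A) → ∀ {j t u},
      Substitutes w P ρ ρ' φ j t u (substApp (substBody φ j) t u) :=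
    fun H _ h _ _ hρ hρ' _ _ _ => h.substitutes_substApp hρ hρ' fun hρ hρ' => H h hρ hρ'
  have up : ∀ {w w' : K.World} {ρ ρ' : ℕ → ℕ} {i c d : ℕ} {Φ Ψ : ℕ → ℕ → Prop}, w ≤ w' → i < 2 →
      OnEv w P ρ ρ' (.var i) Φ → (∀ a b, Φ a b → Ψ a b) →
      OnEv w' P (Function.update ρ 2 c) (Function.update ρ' 2 d) (.var i) Ψ :=
    fun hw hi H HΦ => onEv_update (n := 2) hi le_rfl (onEv_mono H hw HΦ)
  induction φ with
  | mem i k =>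
    intro w h ρ ρ' hρ hρ' j v v' hv hv' hne H₀ H₁
    have E := h.onEv_eqAt hv hne H₀
    obtain ⟨z, h₁, h₂⟩ := h.exists_of_onEv_memClause H₁
    obtain ⟨z', h₃, h₄⟩ := h.exists_of_onEv_memClause (h.onEv_eq_left hρ hρ' (E k) h₁)
    have hz := onEv_of_tripleMem (hv k) h₁
    have hz' := onEv_of_tripleMem (hv' k) h₃
    exact h.onEv_memClause hρ hρ' z' h₃ (h.onEv_trans hρ hρ' (hv' i) (hv i) hz'
      (h.onEv_symm hρ hρ' (hv i) (hv' i) (E i)) (h.onEv_trans hρ hρ' (hv i) hz hz' h₂ h₄))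
  | eq i k =>
    intro w h ρ ρ' hρ hρ' j v v' hv hv' hne H₀ H₁
    have E := h.onEv_eqAt hv hne H₀
    exact h.onEv_trans hρ hρ' (hv' i) (hv i) (hv' k) (h.onEv_symm hρ hρ' (hv i) (hv' i) (E i))
      (h.onEv_trans hρ hρ' (hv i) (hv k) (hv' k) H₁ (E k))
  | conj φ ψ ih₁ ih₂ =>
    intro w h ρ ρ' hρ hρ' j v v' hv hv' hne H₀ H₁
    exact h.onEv_pair hρ hρ'
      (call ih₁ h hρ hρ' v v' hv hv' hne H₀ (h.onEv_p₀ (H₁.imp fun _ _ H => H.1)))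
      (call ih₂ h hρ hρ' v v' hv hv' hne H₀ (h.onEv_p₁ (H₁.imp fun _ _ H => H.2)))
  | disj φ ψ ih₁ ih₂ =>
    intro w h ρ ρ' hρ hρ' j v v' hv hv' hne H₀ H₁
    -- Both branches are closed, hence have the same value in the two environments. `conv` then
    -- replaces a branch by the case term that selects it.
    obtain ⟨f, hf, -⟩ := h.ev_lam hρ 0 (.lam 1 (substBody φ j))
    obtain ⟨g, hg, -⟩ := h.ev_lam hρ 0 (.lam 1 (substBody ψ j))
    have hf' := ev_closed (ρ' := ρ') (substLam_closed (substBody_below φ j)) hf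
    have hg' := ev_closed (ρ' := ρ') (substLam_closed (substBody_below ψ j)) hg
    have Hf : OnEv w P ρ ρ' (substLam (substBody φ j)) fun c c' => K.Eq w f c ∧ K.Eq w f c' :=
      ⟨f, f, hf, hf', refl_of_mem (h.ev_mem hρ hf), refl_of_mem (h.ev_mem hρ hf)⟩
    have Hg : OnEv w P ρ ρ' (substLam (substBody ψ j)) fun c c' => K.Eq w g c ∧ K.Eq w g c' :=
      ⟨g, g, hg, hg', refl_of_mem (h.ev_mem hρ hg), refl_of_mem (h.ev_mem hρ hg)⟩
    have conv : ∀ {q q' : Tm} {f : ℕ} {Φ : ℕ → ℕ → Prop}, Ev w P ρ q f → Ev w P ρ' q f →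
        (OnEv w P ρ ρ' q' fun c c' => K.Eq w f c ∧ K.Eq w f c') →
        OnEv w P ρ ρ' (.app (.app q (.var 0)) (.app .p₁ (.var 1))) Φ →
        OnEv w P ρ ρ' (.app (.app q' (.var 0)) (.app .p₁ (.var 1))) Φ := by
      rintro q q' f Φ hs hs' ⟨c, c', hc, hc', e, e'⟩ ⟨r, r', hr, hr', H⟩
      have aux : ∀ {ρ : ℕ → ℕ} {c r : ℕ}, Ev w P ρ q f → Ev w P ρ q' c → K.Eq w f c →
          Ev w P ρ (.app (.app q (.var 0)) (.app .p₁ (.var 1))) r →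
          Ev w P ρ (.app (.app q' (.var 0)) (.app .p₁ (.var 1))) r := by
        intro ρ c r hs hs' e hr
        obtain ⟨g, b, hg, hb, H⟩ := h.ev_app.1 hr
        obtain ⟨f', a, hf', ha, H'⟩ := h.ev_app.1 hg
        exact h.ev_app.2 ⟨g, b, h.ev_app.2 ⟨f', a,
          h.ev_congr hs' (K.eq_trans (K.eq_symm e) (h.ev_unique hs hf')), ha, H'⟩, hb, H⟩
      exact ⟨r, r', aux hs hc e hr, aux hs' hc' e' hr', H⟩
    obtain ⟨h₁, h₂⟩ | ⟨h₁, h₂⟩ := h.onEv_disj_elim H₁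
    · exact h.onEv_disj_left hρ hρ' h₁ (conv hf hf' (h.onEv_cases_zero hρ hρ' h₁ Hf Hg)
        (call ih₁ h hρ hρ' v v' hv hv' hne H₀ h₂))
    · exact h.onEv_disj_right hρ hρ' h₁ (conv hg hg' (h.onEv_cases_one hρ hρ' h₁ Hf Hg)
        (call ih₂ h hρ hρ' v v' hv hv' hne H₀ h₂))
  | neg φ ih =>
    intro w h ρ ρ' hρ hρ' j v v' hv hv' hne H₀ H₁
    refine H₁.imp fun a b H w' hw c d hc hd hr => ?_
    have h' := h.mono hw
    have hτ := update_mem (mem_env_mono hw hρ) 2 hc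
    have hτ' := update_mem (mem_env_mono hw hρ') 2 hd
    -- Realizers of a negation carry no information. The substitution term is no part of the
    -- realizer here; it only turns a realizer of `φ` at `v'` into one at `v`, which is impossible.
    obtain ⟨r, r', hr, hr', hrr⟩ := call ih h' hτ hτ' v' v (fun i => (hv' i).mono hw)
      (fun i => (hv i).mono hw) (fun i hi => (hne i hi).symm)
      (h'.onEv_symm hτ hτ' ((hv j).mono hw) ((hv' j).mono hw)
        (up hw Nat.zero_lt_two H₀ fun _ _ H => H.mono hw)) (onEv_update_self hc hd hr)
    exact H w' hw r r' (h'.ev_mem hτ hr) (h'.ev_mem hτ' hr') hrr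
  | imp φ ψ ih₁ ih₂ =>
    intro w h ρ ρ' hρ hρ' j v v' hv hv' hne H₀ H₁
    refine h.onEv_imp_intro hρ hρ' fun w' hw c d hc hd hr => ?_
    have h' := h.mono hw
    have hτ := update_mem (mem_env_mono hw hρ) 2 hc
    have hτ' := update_mem (mem_env_mono hw hρ') 2 hd
    have hv := fun i => (hv i).mono hw
    have hv' := fun i => (hv' i).mono hw
    have H₀ := up (c := c) (d := d) hw Nat.zero_lt_two H₀ fun _ _ H => H.mono hw
    have H₁ := up (c := c) (d := d) hw Nat.one_lt_two H₁ fun _ _ H => H.mono hw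
    exact call ih₂ h' hτ hτ' v v' hv hv' hne H₀ (h'.onEv_imp_elim hτ hτ' H₁
      (call ih₁ h' hτ hτ' v' v hv' hv (fun i hi => (hne i hi).symm)
        (h'.onEv_symm hτ hτ' (hv j) (hv' j) H₀) (onEv_update_self hc hd hr)))
  | ball k φ ih =>
    intro w h ρ ρ' hρ hρ' j v v' hv hv' hne H₀ H₁
    refine h.onEv_ball_intro hρ hρ' fun w' hw c d z hc hd hz => ?_
    have h' := h.mono hw
    have hτ := update_mem (mem_env_mono hw hρ) 2 hc
    have hτ' := update_mem (mem_env_mono hw hρ') 2 hd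
    have hv := fun i => (hv i).mono hw
    have hv' := fun i => (hv' i).mono hw
    have H₀ := up (c := c) (d := d) hw Nat.zero_lt_two H₀ fun _ _ H => H.mono hw
    have H₁ := up (c := c) (d := d) hw Nat.one_lt_two H₁ fun _ _ H => H.mono hw
    obtain ⟨z', h₁, h₂⟩ := h'.exists_of_onEv_memClause (h'.onEv_eq_right hτ hτ'
      (h'.onEv_eqAt hv hne H₀ k) (onEv_update_self hc hd hz))
    have hz := ((hv' k).of_tripleMem hz).2.2
    have hz' := onEv_of_tripleMem (hv k) h₁
    exact call ih h' hτ hτ' (scons z' v') (scons z v') (inV_scons hz' hv') (inV_scons hz hv')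
      (scons_agree_zero z' z) (h'.onEv_symm hτ hτ' hz hz' h₂)
      (call ih h' hτ hτ' (scons z' v) (scons z' v') (inV_scons hz' hv) (inV_scons hz' hv')
        (scons_agree z' hne) H₀ (h'.onEv_ball_elim hτ hτ' H₁ h₁))
  | bex k φ ih =>
    intro w h ρ ρ' hρ hρ' j v v' hv hv' hne H₀ H₁
    obtain ⟨z, h₁, h₂⟩ := h.onEv_bex_elim H₁
    obtain ⟨z', h₃, h₄⟩ := h.exists_of_onEv_memClause
      (h.onEv_eq_left hρ hρ' (h.onEv_eqAt hv hne H₀ k) h₁)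
    have hz := onEv_of_tripleMem (hv k) h₁
    have hz' := onEv_of_tripleMem (hv' k) h₃
    exact h.onEv_bex_intro hρ hρ' h₃ (call ih h hρ hρ' (scons z v') (scons z' v')
      (inV_scons hz hv') (inV_scons hz' hv') (scons_agree_zero z z') h₄
      (call ih h hρ hρ' (scons z v) (scons z v') (inV_scons hz hv) (inV_scons hz hv')
        (scons_agree z hne) H₀ h₂))
  | all φ ih =>
    intro w h ρ ρ' hρ hρ' j v v' hv hv' hne H₀ H₁
    refine h.onEv_all_intro hv' fun w' hw x hx => ?_
    exact call ih (h.mono hw) (mem_env_mono hw hρ) (mem_env_mono hw hρ') (scons x v) (scons x v')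
      (inV_scons hx fun i => (hv i).mono hw) (inV_scons hx fun i => (hv' i).mono hw)
      (scons_agree x hne) (onEv_mono H₀ hw fun _ _ H => H.mono hw)
      (onEv_mono H₁ hw fun _ _ H => H w' hw x hx)
  | ex φ ih =>
    intro w h ρ ρ' hρ hρ' j v v' hv hv' hne H₀ H₁
    obtain ⟨a, b, ha, hb, x, hx, H⟩ := H₁
    exact (call ih h hρ hρ' (scons x v) (scons x v') (inV_scons hx hv) (inV_scons hx hv')
      (scons_agree x hne) H₀ ⟨a, b, ha, hb, H⟩).imp fun _ _ H => ⟨x, hx, H⟩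

/-- The Leibniz law for realized equality, with the variable `0` of the formula replaced -/
theorem onEv_subst (h : Pca w P) (hρ : ∀ i, K.Mem w (ρ i) P.A)
    (hρ' : ∀ i, K.Mem w (ρ' i) P.A) {x x' : ℕ} (hx : InV w P x) (hx' : InV w P x')
    (hv : ∀ i, InV w P (v i)) (Ht : OnEv w P ρ ρ' t fun a b => RlzEq w P a b x x')
    (Hu : OnEv w P ρ ρ' u fun a b => Rlz P φ w a b (scons x v)) :
    OnEv w P ρ ρ' (substApp (substBody φ 0) t u) fun a b => Rlz P φ w a b (scons x' v) :=
  h.substitutes_substApp hρ hρ' (fun hρ hρ' => substitutes_substBody φ h hρ hρ') (scons x v)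
    (scons x' v) (inV_scons hx hv) (inV_scons hx' hv) (scons_agree_zero x x') Ht Hu

end Pca

end KripkeModel

namespace KripkeModel

variable {K : KripkeModel} {w w' : K.World} {P : Par}

/-! ## Soundness of extensional realizability -/

/-- The values of the variables `Γ.length - 1, …, 0` realize the respective formulas of `Γ`. -/
def RlzCtx (P : Par) (w : K.World) (ρ ρ' v : ℕ → ℕ) : List Fml → Prop
  | [] => True
  | γ :: Γ => Rlz P γ w (ρ Γ.length) (ρ' Γ.length) v ∧ RlzCtx P w ρ ρ' v Γ

variable {ρ ρ' v : ℕ → ℕ} {Γ : List Fml}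

theorem RlzCtx.mono (h : RlzCtx P w ρ ρ' v Γ) (hw : w ≤ w') : RlzCtx P w' ρ ρ' v Γ := by
  induction Γ with
  | nil => trivial
  | cons γ Γ ih => exact ⟨h.1.mono hw, ih h.2⟩

theorem RlzCtx.update (h : RlzCtx P w ρ ρ' v Γ) {n c c' : ℕ} (hn : Γ.length ≤ n) :
    RlzCtx P w (Function.update ρ n c) (Function.update ρ' n c') v Γ := by
  induction Γ with
  | nil => trivial
  | cons γ Γ ih =>
    rw [List.length_cons] at hn
    refine ⟨?_, ih h.2 (by omega)⟩
    rw [Function.update_of_ne (by omega), Function.update_of_ne (by omega)]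
    exact h.1

theorem RlzCtx.cons (h : RlzCtx P w ρ ρ' v Γ) {γ : Fml} {n c c' : ℕ} (hn : Γ.length = n)
    (H : Rlz P γ w c c' v) :
    RlzCtx P w (Function.update ρ n c) (Function.update ρ' n c') v (γ :: Γ) := by
  subst hn
  exact ⟨by simpa using H, h.update le_rfl⟩

theorem RlzCtx.lift (h : RlzCtx P w ρ ρ' v Γ) (x : ℕ) :
    RlzCtx P w ρ ρ' (scons x v) (Γ.map lift) := by
  induction Γ with
  | nil => trivial
  | cons γ Γ ih => exact ⟨by simpa [rlz_lift] using h.1, ih h.2⟩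

/-- The index depends on the position in the context only and is found before any model is given;
the realizing term must not depend on the model. -/
theorem exists_rlz_of_mem {φ : Fml} (hφ : φ ∈ Γ) : ∃ i < Γ.length,
    ∀ {K : KripkeModel} {w : K.World} {P : Par} {ρ ρ' v : ℕ → ℕ}, RlzCtx P w ρ ρ' v Γ →
      Rlz P φ w (ρ i) (ρ' i) v := by
  induction Γ with
  | nil => simp at hφ
  | cons γ Γ ih =>
    rcases List.mem_cons.1 hφ with rfl | hφ
    · exact ⟨Γ.length, by simp, fun H => H.1⟩
    · obtain ⟨i, hi, H⟩ := ih hφ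
      exact ⟨i, by simp; omega, fun h => H h.2⟩

/-- The term `t` realizes `φ` whenever its variables realize the formulas of `Γ`. -/
def Realizes (Γ : List Fml) (φ : Fml) (t : Tm) : Prop :=
  ∀ {K : KripkeModel} {w : K.World} {P : Par} {ρ ρ' v : ℕ → ℕ}, Pca w P →
    (∀ i, K.Mem w (ρ i) P.A) → (∀ i, K.Mem w (ρ' i) P.A) → (∀ i, InV w P (v i)) →
    RlzCtx P w ρ ρ' v Γ → OnEv w P ρ ρ' t fun a b => Rlz P φ w a b v

theorem onEv_zero (h : Pca w P) :
    OnEv w P ρ ρ' .zero fun c d => IsZero w P c ∧ IsZero w P d := by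
  obtain ⟨z, hz⟩ := h.exists_ev_zero
  exact ⟨z, z, hz, hz, hz, hz⟩

theorem onEv_one (h : Pca w P) : OnEv w P ρ ρ' .one fun c d => IsOne w P c ∧ IsOne w P d := by
  obtain ⟨o, ho⟩ := h.exists_ev_one ρ
  have hc : Tm.one.Closed := ⟨trivial, trivial⟩
  exact ⟨o, o, ho, Pca.ev_closed hc ho, Pca.ev_closed hc ho, Pca.ev_closed hc ho⟩

/-- By induction on the derivation. The newest assumption has the largest variable `Γ.length`, so
discharging it is abstraction over that variable. Rules for unbounded universal quantifiers do not
change the term, as realizers of `all` are uniform in the set. The rules for bounded quantifiers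
pass through realized equality, because membership is realized up to it. -/
theorem exists_realizes {Γ : List Fml} {φ : Fml} (H : Deriv ∅ Γ φ) :
    ∃ t : Tm, t.Below Γ.length ∧ Realizes Γ φ t := by
  have c₀ := Tm.p₀_closed.below
  have c₁ := Tm.p₁_closed.below
  have cp := Tm.pr_closed.below
  have cs := symmTm_closed.below
  have cr := reflTm_closed.below
  induction H with
  | ax h => exact h.elim
  | hyp h =>
    obtain ⟨i, hi, H⟩ := exists_rlz_of_mem h
    exact ⟨.var i, hi, fun _ hρ hρ' _ hΓ => Pca.onEv_var_mem (hρ i) (hρ' i) (H hΓ)⟩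
  | andI _ _ ih₁ ih₂ =>
    obtain ⟨t, ht, Ht⟩ := ih₁
    obtain ⟨u, hu, Hu⟩ := ih₂
    exact ⟨.pair t u, ⟨⟨cp _, ht⟩, hu⟩, fun h hρ hρ' hv hΓ =>
      h.onEv_pair hρ hρ' (Ht h hρ hρ' hv hΓ) (Hu h hρ hρ' hv hΓ)⟩
  | andE₁ _ ih =>
    obtain ⟨t, ht, Ht⟩ := ih
    exact ⟨.app .p₀ t, ⟨c₀ _, ht⟩, fun h hρ hρ' hv hΓ =>
      h.onEv_p₀ ((Ht h hρ hρ' hv hΓ).imp fun _ _ H => H.1)⟩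
  | andE₂ _ ih =>
    obtain ⟨t, ht, Ht⟩ := ih
    exact ⟨.app .p₁ t, ⟨c₁ _, ht⟩, fun h hρ hρ' hv hΓ =>
      h.onEv_p₁ ((Ht h hρ hρ' hv hΓ).imp fun _ _ H => H.2)⟩
  | orI₁ _ ih =>
    obtain ⟨t, ht, Ht⟩ := ih
    exact ⟨.pair .zero t, ⟨⟨cp _, trivial⟩, ht⟩, fun h hρ hρ' hv hΓ =>
      h.onEv_disj_left hρ hρ' (onEv_zero h) (Ht h hρ hρ' hv hΓ)⟩
  | orI₂ _ ih =>
    obtain ⟨t, ht, Ht⟩ := ih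
    exact ⟨.pair .one t, ⟨⟨cp _, trivial, trivial⟩, ht⟩, fun h hρ hρ' hv hΓ =>
      h.onEv_disj_right hρ hρ' (onEv_one h) (Ht h hρ hρ' hv hΓ)⟩
  | @orE Γ φ ψ χ _ _ _ ih ih₁ ih₂ =>
    obtain ⟨t, ht, Ht⟩ := ih
    obtain ⟨t₁, ht₁, H₁⟩ := ih₁
    obtain ⟨t₂, ht₂, H₂⟩ := ih₂
    refine ⟨.app (.cases (.app .p₀ t) (t₁.lam Γ.length) (t₂.lam Γ.length)) (.app .p₁ t),
      ⟨⟨⟨⟨⟨trivial, trivial⟩, c₀ _, ht⟩, ht₁.lam⟩, ht₂.lam⟩, c₁ _, ht⟩,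
      fun {K w P ρ ρ' v} h hρ hρ' hv hΓ => ?_⟩
    have L₁ : OnEv w P ρ ρ' (t₁.lam Γ.length) fun a b => Rlz P (imp φ χ) w a b v :=
      h.onEv_imp_intro hρ hρ' fun w' hw c d hc hd H =>
        H₁ (h.mono hw) (Pca.update_mem (Pca.mem_env_mono hw hρ) _ hc)
          (Pca.update_mem (Pca.mem_env_mono hw hρ') _ hd) (fun i => (hv i).mono hw)
          ((hΓ.mono hw).cons rfl H)
    have L₂ : OnEv w P ρ ρ' (t₂.lam Γ.length) fun a b => Rlz P (imp ψ χ) w a b v :=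
      h.onEv_imp_intro hρ hρ' fun w' hw c d hc hd H =>
        H₂ (h.mono hw) (Pca.update_mem (Pca.mem_env_mono hw hρ) _ hc)
          (Pca.update_mem (Pca.mem_env_mono hw hρ') _ hd) (fun i => (hv i).mono hw)
          ((hΓ.mono hw).cons rfl H)
    obtain ⟨h₁, h₂⟩ | ⟨h₁, h₂⟩ := h.onEv_disj_elim (Ht h hρ hρ' hv hΓ)
    · exact h.onEv_imp_elim hρ hρ' (h.onEv_cases_zero hρ hρ' h₁ L₁ L₂) h₂
    · exact h.onEv_imp_elim hρ hρ' (h.onEv_cases_one hρ hρ' h₁ L₁ L₂) h₂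
  | @negI Γ φ ψ _ _ ih₁ ih₂ =>
    obtain ⟨t, -, Ht⟩ := ih₁
    obtain ⟨u, -, Hu⟩ := ih₂
    -- Any defined term realizes a true negation; the terms of the premises only serve to refute
    -- realizers of `φ`.
    refine ⟨.zero, trivial, fun {K w P ρ ρ' v} h hρ hρ' hv hΓ => (onEv_zero h).imp ?_⟩
    rintro a b - w' hw c d hc hd H
    have h' := h.mono hw
    have hτ := Pca.update_mem (Pca.mem_env_mono hw hρ) Γ.length hc
    have hτ' := Pca.update_mem (Pca.mem_env_mono hw hρ') Γ.length hd
    have hv := fun i => (hv i).mono hw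
    have hΓ := (hΓ.mono hw).cons rfl H
    obtain ⟨r, r', hr, hr', hrr⟩ := Ht h' hτ hτ' hv hΓ
    obtain ⟨_, _, _, _, H⟩ := Hu h' hτ hτ' hv hΓ
    exact H w' le_rfl r r' (h'.ev_mem hτ hr) (h'.ev_mem hτ' hr') hrr
  | negE _ _ ih₁ ih₂ =>
    obtain ⟨t, -, Ht⟩ := ih₁
    obtain ⟨u, -, Hu⟩ := ih₂
    -- The premises are never realized together, so the term is arbitrary.
    refine ⟨.zero, trivial, fun {K w P ρ ρ' v} h hρ hρ' hv hΓ => ?_⟩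
    obtain ⟨r, r', hr, hr', hrr⟩ := Ht h hρ hρ' hv hΓ
    obtain ⟨_, _, _, _, H⟩ := Hu h hρ hρ' hv hΓ
    exact (H w le_rfl r r' (h.ev_mem hρ hr) (h.ev_mem hρ' hr') hrr).elim
  | @impI Γ φ ψ _ ih =>
    obtain ⟨t, ht, Ht⟩ := ih
    exact ⟨t.lam Γ.length, ht.lam, fun {K w P ρ ρ' v} h hρ hρ' hv hΓ =>
      h.onEv_imp_intro hρ hρ' fun w' hw c d hc hd H =>
        Ht (h.mono hw) (Pca.update_mem (Pca.mem_env_mono hw hρ) _ hc)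
          (Pca.update_mem (Pca.mem_env_mono hw hρ') _ hd) (fun i => (hv i).mono hw)
          ((hΓ.mono hw).cons rfl H)⟩
  | impE _ _ ih₁ ih₂ =>
    obtain ⟨t, ht, Ht⟩ := ih₁
    obtain ⟨u, hu, Hu⟩ := ih₂
    exact ⟨.app t u, ⟨ht, hu⟩, fun h hρ hρ' hv hΓ =>
      h.onEv_imp_elim hρ hρ' (Ht h hρ hρ' hv hΓ) (Hu h hρ hρ' hv hΓ)⟩
  | allI _ ih =>
    obtain ⟨t, ht, Ht⟩ := ih
    rw [List.length_map] at ht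
    exact ⟨t, ht, fun h hρ hρ' hv hΓ => h.onEv_all_intro hv fun w' hw x hx =>
      Ht (h.mono hw) (Pca.mem_env_mono hw hρ) (Pca.mem_env_mono hw hρ')
        (inV_scons hx fun i => (hv i).mono hw) ((hΓ.mono hw).lift x)⟩
  | allE x _ ih =>
    obtain ⟨t, ht, Ht⟩ := ih
    exact ⟨t, ht, fun h hρ hρ' hv hΓ => (Ht h hρ hρ' hv hΓ).imp fun _ _ H =>
      rlz_inst.2 (H _ le_rfl _ (hv x))⟩
  | exI x _ ih =>
    obtain ⟨t, ht, Ht⟩ := ih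
    exact ⟨t, ht, fun h hρ hρ' hv hΓ => (Ht h hρ hρ' hv hΓ).imp fun _ _ H =>
      ⟨_, hv x, rlz_inst.1 H⟩⟩
  | @exE Γ φ ψ _ _ ih₁ ih₂ =>
    obtain ⟨t, ht, Ht⟩ := ih₁
    obtain ⟨u, hu, Hu⟩ := ih₂
    rw [List.length_cons, List.length_map] at hu
    refine ⟨.app (u.lam Γ.length) t, ⟨hu.lam, ht⟩, fun {K w P ρ ρ' v} h hρ hρ' hv hΓ =>
      h.onEv_beta hρ hρ' ((h.onEv_mem hρ hρ' (Ht h hρ hρ' hv hΓ)).imp ?_)⟩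
    rintro a b ⟨ha, hb, x, hx, H⟩
    exact (Hu h (Pca.update_mem hρ _ ha) (Pca.update_mem hρ' _ hb) (inV_scons hx hv)
      ((hΓ.lift x).cons (by simp) H)).imp fun _ _ => rlz_lift.1
  | @ballI Γ φ y _ ih =>
    obtain ⟨t, ht, Ht⟩ := ih
    rw [List.length_cons, List.length_map] at ht
    -- A realizer of `ball` receives a bare name `c` of `z`, while the assumption `z ∈ y` asks for a
    -- name paired with a realizer of an equality; reflexivity supplies the latter.
    refine ⟨.lam Γ.length (.app (t.lam Γ.length) (.pair (.var Γ.length) reflTm)),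
      Tm.Below.lam ⟨ht.lam.mono (by omega), ⟨cp _, Nat.lt_succ_self _⟩, cr _⟩,
      fun {K w P ρ ρ' v} h hρ hρ' hv hΓ =>
        h.onEv_ball_intro hρ hρ' fun w' hw c d z hc hd hz => ?_⟩
    have h' := h.mono hw
    have hτ := Pca.update_mem (Pca.mem_env_mono hw hρ) Γ.length hc
    have hτ' := Pca.update_mem (Pca.mem_env_mono hw hρ') Γ.length hd
    have hzV := (((hv y).mono hw).of_tripleMem hz).2.2
    refine h'.onEv_beta hτ hτ' ((h'.onEv_mem hτ hτ' (h'.onEv_memClause hτ hτ'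
      (Q := RlzEq w' P) (x := z) z (Pca.onEv_update_self hc hd hz) (h'.onEv_refl hzV))).imp ?_)
    rintro a b ⟨ha, hb, H⟩
    exact Ht h' (Pca.update_mem hτ _ ha) (Pca.update_mem hτ' _ hb)
      (inV_scons hzV fun i => (hv i).mono hw)
      ((((hΓ.mono hw).update le_rfl).lift z).cons (by simp) H)
  | ballE x _ _ ih₁ ih₂ =>
    rename_i φ y _ _
    obtain ⟨t, ht, Ht⟩ := ih₁
    obtain ⟨u, hu, Hu⟩ := ih₂
    -- The realizer of `x ∈ y` names some `z` in `y` with `x = z`. The premise is instantiated at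
    -- `z`, and the result is carried back to `x`.
    refine ⟨substApp (substBody φ 0) (.app symmTm (.app .p₁ u)) (.app t (.app .p₀ u)),
      substApp_below (substBody_below φ 0) ⟨cs _, c₁ _, hu⟩ ⟨ht, c₀ _, hu⟩,
      fun {K w P ρ ρ' v} h hρ hρ' hv hΓ => ?_⟩
    obtain ⟨z, h₁, h₂⟩ := h.exists_of_onEv_memClause (Hu h hρ hρ' hv hΓ)
    have hz := Pca.onEv_of_tripleMem (hv y) h₁
    exact (h.onEv_subst hρ hρ' hz (hv x) hv (h.onEv_symm hρ hρ' (hv x) hz h₂)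
      (h.onEv_ball_elim hρ hρ' (Ht h hρ hρ' hv hΓ) h₁)).imp fun _ _ => rlz_inst.2
  | bexI x _ _ ih₁ ih₂ =>
    rename_i φ y _ _
    obtain ⟨t, ht, Ht⟩ := ih₁
    obtain ⟨u, hu, Hu⟩ := ih₂
    -- The witness named in `y` is not `x` but a `z` with `x = z` realized, so the realizer of the
    -- instance at `x` is carried over to `z`.
    refine ⟨.pair (.app .p₀ t) (substApp (substBody φ 0) (.app .p₁ t) u),
      ⟨⟨cp _, c₀ _, ht⟩, substApp_below (substBody_below φ 0) ⟨c₁ _, ht⟩ hu⟩,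
      fun {K w P ρ ρ' v} h hρ hρ' hv hΓ => ?_⟩
    obtain ⟨z, h₁, h₂⟩ := h.exists_of_onEv_memClause (Ht h hρ hρ' hv hΓ)
    exact h.onEv_bex_intro hρ hρ' h₁ (h.onEv_subst hρ hρ' (hv x)
      (Pca.onEv_of_tripleMem (hv y) h₁) hv h₂
      ((Hu h hρ hρ' hv hΓ).imp fun _ _ => rlz_inst.1))
  | @bexE Γ φ ψ y _ _ ih₁ ih₂ =>
    obtain ⟨t, ht, Ht⟩ := ih₁
    obtain ⟨u, hu, Hu⟩ := ih₂
    rw [List.length_cons, List.length_cons, List.length_map] at hu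
    -- The membership assumption sits deeper in the context than `φ`, so it has the variable
    -- `Γ.length` and `φ` has `Γ.length + 1`.
    refine ⟨.app (.app (.lam Γ.length (.lam (Γ.length + 1) u)) (.pair (.app .p₀ t) reflTm))
      (.app .p₁ t), ⟨⟨hu.lam.lam, ⟨cp _, c₀ _, ht⟩, cr _⟩, c₁ _, ht⟩,
      fun {K w P ρ ρ' v} h hρ hρ' hv hΓ => ?_⟩
    obtain ⟨z, h₁, h₂⟩ := h.onEv_bex_elim (Ht h hρ hρ' hv hΓ)
    have hz := Pca.onEv_of_tripleMem (hv y) h₁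
    refine h.onEv_beta₂ hρ hρ' (h.onEv_memClause hρ hρ' (Q := RlzEq w P) (x := z) z h₁
      (h.onEv_refl hz)) h₂ fun a a' b b' ha ha' hb hb' H₁ H₂ => ?_
    exact (Hu h (Pca.update_mem (Pca.update_mem hρ _ ha) _ hb)
      (Pca.update_mem (Pca.update_mem hρ' _ ha') _ hb') (inV_scons hz hv)
      (((hΓ.lift z).cons (γ := mem 0 (y + 1)) (by simp) H₁).cons (by simp) H₂)).imp
      fun _ _ => rlz_lift.1
  | eqRefl x => exact ⟨reflTm, cr _, fun h _ _ hv _ => h.onEv_refl (hv x)⟩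
  | @eqSubst Γ φ x y _ _ ih₁ ih₂ =>
    obtain ⟨t, ht, Ht⟩ := ih₁
    obtain ⟨u, hu, Hu⟩ := ih₂
    exact ⟨substApp (substBody φ 0) t u, substApp_below (substBody_below φ 0) ht hu,
      fun h hρ hρ' hv hΓ => (h.onEv_subst hρ hρ' (hv x) (hv y) hv (Ht h hρ hρ' hv hΓ)
        ((Hu h hρ hρ' hv hΓ).imp fun _ _ => rlz_inst.1)).imp fun _ _ => rlz_inst.2⟩

end KripkeModel

/-! ### Universal closures and the assembly of the theorem -/

theorem Fml.FreeBelow.supp {φ : Fml} : ∀ {n : ℕ}, φ.FreeBelow n → φ.Supp (· < n) := by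
  have under : ∀ {φ : Fml} {n : ℕ}, φ.Supp (· < n + 1) → φ.Supp (liftPred (· < n)) := by
    intro φ n h
    refine h.mono ?_
    rintro (_ | i) hi
    · trivial
    · exact Nat.lt_of_succ_lt_succ hi
  induction φ with
  | mem x y => exact id
  | eq x y => exact id
  | conj φ ψ ih₁ ih₂ => exact fun h => ⟨ih₁ h.1, ih₂ h.2⟩
  | disj φ ψ ih₁ ih₂ => exact fun h => ⟨ih₁ h.1, ih₂ h.2⟩
  | neg φ ih => exact ih
  | imp φ ψ ih₁ ih₂ => exact fun h => ⟨ih₁ h.1, ih₂ h.2⟩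
  | ball y φ ih => exact fun h => ⟨h.1, under (ih h.2)⟩
  | bex y φ ih => exact fun h => ⟨h.1, under (ih h.2)⟩
  | all φ ih => exact fun h => under (ih h)
  | ex φ ih => exact fun h => under (ih h)

theorem Fml.FreeBelow.alls : ∀ {n : ℕ} {φ : Fml}, φ.FreeBelow n → (φ.alls n).FreeBelow 0
  | 0, _, h => h
  | n + 1, φ, h => FreeBelow.alls (n := n) (φ := all φ) h

namespace KripkeModel

variable {K : KripkeModel} {w : K.World} {P : Par}

theorem forces_alls : ∀ {n : ℕ} {φ : Fml} {w : K.World} {σ : ℕ → ℕ}, Env w σ →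
    (∀ w', w ≤ w' → ∀ σ, Env w' σ → Forces w' φ σ) → Forces w (alls n φ) σ
  | 0, _, w, σ, hσ, H => H w le_rfl σ hσ
  | n + 1, φ, _, _, hσ, H => forces_alls (n := n) (φ := all φ) hσ fun _ hw _ hσ w'' hw' _ hc =>
      H w'' (hw.trans hw') _ (Env.scons hc (hσ.mono hw'))

namespace Pca

theorem onEv_alls {ρ ρ' : ℕ → ℕ} {t : Tm} : ∀ {n : ℕ} {φ : Fml} {w : K.World} {v : ℕ → ℕ},
    Pca w P → (∀ i, InV w P (v i)) →
    (∀ w', w ≤ w' → ∀ v, (∀ i, InV w' P (v i)) → OnEv w' P ρ ρ' t fun a b => Rlz P φ w' a b v) →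
    OnEv w P ρ ρ' t fun a b => Rlz P (alls n φ) w a b v
  | 0, _, w, v, _, hv, H => H w le_rfl v hv
  | n + 1, φ, _, _, h, hv, H => onEv_alls (n := n) (φ := all φ) h hv fun _ hw _ hv =>
      (h.mono hw).onEv_all_intro hv fun w'' hw' _ hx =>
        H w'' (hw.trans hw') _ (inV_scons hx fun i => (hv i).mono hw')

/-- The environment rebuilt from the structure is `σ` composed with `i ↦ min i 7`. This map fixes
the eight variables of `stdPar`, so renaming by it leaves `stdPar.isPCAω` unchanged by computation.
-/
theorem of_forces {σ : ℕ → ℕ} (czf : K.IsCZF) (hσ : Env w σ) (H : Forces w stdPar.isPCAω σ) :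
    Pca w (stdPar.map σ) := by
  have e : (stdPar.map σ).env = σ ∘ fun i => min i 7 := by
    funext i
    obtain hi | hi := lt_or_ge i 7
    · interval_cases i <;> rfl
    · obtain ⟨j, rfl⟩ := Nat.exists_eq_add_of_le' hi
      rw [Function.comp_apply, min_eq_right hi]
      rfl
  refine ⟨czf, e ▸ fun i => hσ _, ?_⟩
  rw [e, ← forces_rename]
  exact H

/-- Evaluating the closed term twice gives a pair of values that are equal by uniqueness, and
replacing the second by the first yields a single `c` related to itself. The parameters are taken
from the universe for this, and exchanged for the given environment at the end, which is harmless
for a sentence. -/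
theorem forces_realizes (h : Pca w (stdPar.map σ)) {n : ℕ} {φ : Fml} (hn : φ.FreeBelow n)
    {e : Tm} (he : e.Closed) (H : Realizes [] φ e) :
    Forces w (stdPar.realizes e (alls n φ)) σ := by
  obtain ⟨x, hx⟩ := h.exists_inV
  have hρ : ∀ _ : ℕ, K.Mem w (stdPar.map σ).k (stdPar.map σ).A := fun _ => h.k_mem
  obtain ⟨c, c', hc, hc', Hc⟩ := h.onEv_alls (n := n) (v := fun _ => x) (fun _ => hx)
    fun w' hw v hv => H (h.mono hw) (mem_env_mono hw hρ) (mem_env_mono hw hρ) hv trivial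
  have hcm := h.ev_mem hρ hc
  have key := h.rlz_congr (fun _ => hx) (refl_of_mem hcm) (h.ev_unique hc' hc) Hc
  refine ⟨c, hcm, forces_eval.2 (ev_closed he hc),
    (forces_rlz (alls n φ) (P := stdPar.shift 1) (σ := scons c σ) h).2 ?_⟩
  exact (rlz_agree hn.alls.supp (by simp)).1 key

end Pca

end KripkeModel

open KripkeModel in
theorem theorem6p3 (n : ℕ) (φ : Fml) (hn : φ.FreeBelow n) (hφ : Deriv ∅ [] φ) :
    ∃ e : Tm, e.Closed ∧
      Deriv CZF [] (alls 8 (imp stdPar.isPCAω (stdPar.realizes e (alls n φ)))) := by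
  obtain ⟨e, he, H⟩ := exists_realizes hφ
  have he := Tm.below_zero_iff.1 he
  refine ⟨e, he, deriv_of_forces CZF.rename_mem fun K hK w σ hσ => ?_⟩
  exact forces_alls hσ fun w' _ σ hσ w'' hw h =>
    (Pca.of_forces hK (hσ.mono hw) h).forces_realizes hn he H
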